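/- Let $d\ge 1$, $\alpha=(\alpha_1,\dots,\alpha_d)\in[-1/2,\infty)^d$, $|\alpha|=\alpha_1+\dots+\alpha_d$, and let $\gamma\in\mathbb R$, $\gamma\ne 0$. Put $dw_\alpha(x)=\prod_{j=1}^d|x_j|^{2\alpha_j+1}\,dx$ on $\mathbb R^d$. For $n\in\mathbb N^d$, $|n|=n_1+\dots+n_d$, let $h_n^\alpha(x)=\prod_{j=1}^d h_{n_j}^{\alpha_j}(x_j)$ be the generalized Hermite functions, i.e. the eigenfunctions of the Dunkl harmonic oscillator $\mathcal L_\alpha$ for the reflection group $\mathbb Z_2^d$ (with eigenvalues $2|n|+2|\alpha|+2d$), where, for $m\in\mathbb N$ and $a\ge-1/2$, $$h_{2m}^{a}(u)=(-1)^m\Big(\tfrac{\Gamma(m+1)}{\Gamma(m+a+1)}\Big)^{1/2}e^{-u^2/2}L_m^{a}(u^2),\qquad h_{2m+1}^{a}(u)=(-1)^m\Big(\tfrac{\Gamma(m+1)}{\Gamma(m+a+2)}\Big)^{1/2}e^{-u^2/2}\,u\,L_m^{a+1}(u^2),$$ and $L_m^{a}(u)=\sum_{k=0}^m\frac{\Gamma(m+a+1)}{\Gamma(k+a+1)\,k!\,(m-k)!}(-u)^k$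 is the Laguerre polynomial. For complex-valued $f\in L^2(\mathbb R^d,w_\alpha)$ let $$\mathcal L_\alpha^{-i\gamma}f=\sum_{n\in\mathbb N^d}(2|n|+2|\alpha|+2d)^{-i\gamma}\,\langle f,h_n^\alpha\rangle_{L^2(w_\alpha)}\,h_n^\alpha .$$ Then: 1. the series converges unconditionally in $L^2(\mathbb R^d,w_\alpha)$ for every $f\in L^2(\mathbb R^d,w_\alpha)$, so that $\mathcal L_\alpha^{-i\gamma}$ is well defined on $L^2(\mathbb R^d,w_\alpha)$; 2. for every $1<p<\infty$ there is exactly one bounded linear operator on $L^p(\mathbb R^d,w_\alpha)$ which agrees with $\mathcal L_\alpha^{-i\gamma}$ on $L^2(\mathbb R^d,w_\alpha)\cap L^p(\mathbb R^d,w_\alpha)$; 3. there is exactly one linear operator $T$ on $L^1(\mathbb R^d,w_\alpha)$, with values in (classes of) measurable functions, which agrees with $\mathcal L_\alpha^{-i\gamma}$ on $L^1(\mathbb R^d,w_\alpha)\cap L^2(\mathbb R^d,w_\alpha)$ and is bounded from $L^1(\mathbb R^d,w_\alpha)$ to $L^{1,\infty}(\mathbb R^d,w_\alpha)$, i.e.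 for some constant $C<\infty$ $$\sup_{t>0}\,t\,w_\alpha\big(\{x:|Tf(x)|>t\}\big)\le C\,\|f\|_{L^1(w_\alpha)}\qquad\text{for all } f\in L^1(\mathbb R^d,w_\alpha).$$ -/

import Mathlib

open MeasureTheory
open scoped ENNReal NNReal

noncomputable section

namespace DunklOsc

/-- The Laguerre polynomial of degree `n` and order `a`:
`L_n^a(x) = ∑_{k=0}^n Γ(n+a+1) / (Γ(k+a+1) k! (n-k)!) (-x)^k`. -/
def laguerre (a : ℝ) (n : ℕ) (x : ℝ) : ℝ :=
  ∑ k ∈ Finset.range (n + 1),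
    Real.Gamma (n + a + 1) /
      (Real.Gamma (k + a + 1) * (k.factorial : ℝ) * ((n - k).factorial : ℝ)) * (-x) ^ k

/-- The one-dimensional generalized Hermite function of index `n` and order `a`. For `n = 2m` it is
`d_{2m,a} exp(-x²/2) L_m^a(x²)` and for `n = 2m+1` it is `d_{2m+1,a} exp(-x²/2) x L_m^{a+1}(x²)`,
where `d_{2m,a} = (-1)^m (Γ(m+1)/Γ(m+a+1))^{1/2}` and
`d_{2m+1,a} = (-1)^m (Γ(m+1)/Γ(m+a+2))^{1/2}`. -/
def hermite1 (a : ℝ) (n : ℕ) (x : ℝ) : ℝ :=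
  if Even n then
    (-1) ^ (n / 2) * √(Real.Gamma ((n / 2 : ℕ) + 1) / Real.Gamma ((n / 2 : ℕ) + a + 1)) *
      Real.exp (-x ^ 2 / 2) * laguerre a (n / 2) (x ^ 2)
  else
    (-1) ^ (n / 2) * √(Real.Gamma ((n / 2 : ℕ) + 1) / Real.Gamma ((n / 2 : ℕ) + a + 2)) *
      Real.exp (-x ^ 2 / 2) * x * laguerre (a + 1) (n / 2) (x ^ 2)

/-- The generalized Hermite function `h_n^α` on `ℝ^d` (a tensor product). -/
def hermiteFun {d : ℕ} (α : Fin d → ℝ) (n : Fin d → ℕ) (x : EuclideanSpace ℝ (Fin d)) : ℝ :=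
  ∏ j, hermite1 (α j) (n j) (x j)

/-- The weight `w_α(x) = ∏_j |x_j|^(2 α_j + 1)`. -/
def weight {d : ℕ} (α : Fin d → ℝ) (x : EuclideanSpace ℝ (Fin d)) : ℝ :=
  ∏ j, |x j| ^ (2 * α j + 1)

/-- The measure `w_α(x) dx` on `ℝ^d`. -/
def weightMeasure {d : ℕ} (α : Fin d → ℝ) : Measure (EuclideanSpace ℝ (Fin d)) :=
  volume.withDensity fun x => ENNReal.ofReal (weight α x)

/-- The eigenvalue `2|n| + 2|α| + 2d` of the Dunkl harmonic oscillator belonging to `h_n^α`. -/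
def eigenvalue {d : ℕ} (α : Fin d → ℝ) (n : Fin d → ℕ) : ℝ :=
  2 * (∑ j, (n j : ℝ)) + 2 * (∑ j, α j) + 2 * (d : ℝ)

theorem laguerre_poly (a : ℝ) (n : ℕ) :
    ∃ p : Polynomial ℝ, ∀ x, laguerre a n (x ^ 2) = p.eval x := by
  refine ⟨∑ k ∈ Finset.range (n + 1), Polynomial.C (Real.Gamma (n + a + 1) /
      (Real.Gamma (k + a + 1) * (k.factorial : ℝ) * ((n - k).factorial : ℝ))) *
        (-Polynomial.X ^ 2) ^ k, fun x => ?_⟩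
  simp [laguerre, Polynomial.eval_finsetSum]

theorem hermite1_poly (a : ℝ) (n : ℕ) :
    ∃ p : Polynomial ℝ, ∀ x, hermite1 a n x = p.eval x * Real.exp (-x ^ 2 / 2) := by
  by_cases h : Even n
  · obtain ⟨p, hp⟩ := laguerre_poly a (n / 2)
    refine ⟨Polynomial.C ((-1) ^ (n / 2) * √(Real.Gamma ((n / 2 : ℕ) + 1) /
      Real.Gamma ((n / 2 : ℕ) + a + 1))) * p, fun x => ?_⟩
    simp only [hermite1, h, if_true, hp, Polynomial.eval_mul, Polynomial.eval_C]
    ring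
  · obtain ⟨p, hp⟩ := laguerre_poly (a + 1) (n / 2)
    refine ⟨Polynomial.C ((-1) ^ (n / 2) * √(Real.Gamma ((n / 2 : ℕ) + 1) /
      Real.Gamma ((n / 2 : ℕ) + a + 2))) * Polynomial.X * p, fun x => ?_⟩
    simp only [hermite1, h, if_false, hp, Polynomial.eval_mul, Polynomial.eval_C,
      Polynomial.eval_X]
    ring

theorem continuous_hermite1 (a : ℝ) (n : ℕ) : Continuous (hermite1 a n) := by
  obtain ⟨p, hp⟩ := hermite1_poly a n
  rw [funext hp]
  fun_prop

theorem integrable_poly_gaussian (p : Polynomial ℝ) :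
    Integrable fun x : ℝ => p.eval x * Real.exp (-x ^ 2) := by
  induction p using Polynomial.induction_on' with
  | add p q hp hq =>
    refine (hp.add hq).congr (ae_of_all _ fun x => ?_)
    simp [add_mul]
  | monomial k c =>
    have h := (integrable_rpow_mul_exp_neg_mul_sq (b := 1) one_pos (s := (k : ℝ))
      (by have := Nat.cast_nonneg (α := ℝ) k; linarith)).const_mul c
    refine h.congr (ae_of_all _ fun x => ?_)
    simp [mul_assoc]

theorem integrable_hermite1_sq {a : ℝ} (ha : -1 / 2 ≤ a) (n : ℕ) :
    Integrable fun x : ℝ => hermite1 a n x ^ 2 * |x| ^ (2 * a + 1) := by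
  obtain ⟨p, hp⟩ := hermite1_poly a n
  obtain ⟨N, hN⟩ := exists_nat_ge (2 * a + 1)
  have hb : 0 ≤ 2 * a + 1 := by linarith
  have hc : Continuous fun x : ℝ => |x| ^ (2 * a + 1) :=
    continuous_abs.rpow_const fun _ => Or.inr hb
  have hh := continuous_hermite1 a n
  refine (integrable_poly_gaussian (p ^ 2 * (1 + Polynomial.X ^ (2 * N)))).mono'
    ((hh.pow 2).mul hc).aestronglyMeasurable (ae_of_all _ fun x => ?_)
  have h1 : |x| ^ (2 * a + 1) ≤ 1 + x ^ (2 * N) := by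
    have hx : x ^ (2 * N) = |x| ^ (2 * N) := by rw [pow_mul, pow_mul, sq_abs]
    rw [hx]
    rcases le_total |x| 1 with h | h
    · have := Real.rpow_le_one (abs_nonneg x) h hb
      have : 0 ≤ |x| ^ (2 * N) := by positivity
      linarith
    · have : |x| ^ (2 * a + 1) ≤ |x| ^ (((2 * N : ℕ) : ℝ)) := by
        apply Real.rpow_le_rpow_of_exponent_le h
        push_cast
        have := Nat.cast_nonneg (α := ℝ) N
        linarith
      rw [Real.rpow_natCast] at this
      linarith
  have h2 : Real.exp (-x ^ 2 / 2) ^ 2 = Real.exp (-x ^ 2) := by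
    rw [← Real.exp_nat_mul]
    congr 1
    push_cast
    ring
  rw [Real.norm_of_nonneg (by positivity), hp, mul_pow, h2]
  simp only [Polynomial.eval_mul, Polynomial.eval_pow, Polynomial.eval_add, Polynomial.eval_one,
    Polynomial.eval_X]
  calc _ ≤ Polynomial.eval x p ^ 2 * Real.exp (-x ^ 2) * (1 + x ^ (2 * N)) := by gcongr
    _ = _ := by ring

theorem continuous_hermiteFun {d : ℕ} (α : Fin d → ℝ) (n : Fin d → ℕ) :
    Continuous (hermiteFun α n) := by
  unfold hermiteFun
  exact continuous_finsetProd _ fun j _ => (continuous_hermite1 (α j) (n j)).comp (by fun_prop)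

theorem weight_nonneg {d : ℕ} (α : Fin d → ℝ) (x : EuclideanSpace ℝ (Fin d)) :
    0 ≤ weight α x :=
  Finset.prod_nonneg fun _ _ => by positivity

theorem measurable_weight {d : ℕ} (α : Fin d → ℝ) : Measurable (weight α) := by
  unfold weight
  fun_prop

theorem memLp_hermiteFun {d : ℕ} {α : Fin d → ℝ} (hα : ∀ j, -1 / 2 ≤ α j) (n : Fin d → ℕ) :
    MemLp (fun x => (hermiteFun α n x : ℂ)) 2 (weightMeasure α) := by
  have hc : Continuous fun x => (hermiteFun α n x : ℂ) :=
    Complex.continuous_ofReal.comp (continuous_hermiteFun α n)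
  rw [memLp_two_iff_integrable_sq_norm hc.aestronglyMeasurable, weightMeasure,
    integrable_withDensity_iff (measurable_weight α).ennreal_ofReal
      (ae_of_all _ fun _ => ENNReal.ofReal_lt_top)]
  have h := (Integrable.fintype_prod fun j => integrable_hermite1_sq (hα j) (n j))
  have h' := ((EuclideanSpace.volume_preserving_symm_measurableEquiv_toLp
    (Fin d)).integrable_comp_emb (MeasurableEquiv.measurableEmbedding _)).2 h
  refine h'.congr (ae_of_all _ fun x => ?_)
  beta_reduce
  rw [ENNReal.toReal_ofReal (weight_nonneg α x)]
  simp [hermiteFun, weight, Finset.prod_mul_distrib, ← Finset.prod_pow]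

/-- `h_n^α` as an element of `L²(ℝ^d, w_α)`. -/
def hermiteLp {d : ℕ} {α : Fin d → ℝ} (hα : ∀ j, -1 / 2 ≤ α j) (n : Fin d → ℕ) :
    Lp ℂ 2 (weightMeasure α) :=
  (memLp_hermiteFun hα n).toLp _

/-- The term `(2|n|+2|α|+2d)^(-iγ) ⟨f, h_n^α⟩ h_n^α` of the spectral series. Mathlib's inner product
is conjugate-linear in its first argument, so `⟨f, h⟩ = ∫ f h̄ dw_α` is `inner ℂ h f`. -/
def spectralTerm {d : ℕ} {α : Fin d → ℝ} (hα : ∀ j, -1 / 2 ≤ α j) (γ : ℝ)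
    (f : Lp ℂ 2 (weightMeasure α)) (n : Fin d → ℕ) : Lp ℂ 2 (weightMeasure α) :=
  (((eigenvalue α n : ℝ) : ℂ) ^ (-(Complex.I * (γ : ℂ))) * inner ℂ (hermiteLp hα n) f) •
    hermiteLp hα n

/-- The imaginary power `𝓛_α^(-iγ)` on `L²(ℝ^d, w_α)`, given by the spectral series. -/
def imaginaryPower {d : ℕ} {α : Fin d → ℝ} (hα : ∀ j, -1 / 2 ≤ α j) (γ : ℝ)
    (f : Lp ℂ 2 (weightMeasure α)) : Lp ℂ 2 (weightMeasure α) :=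
  ∑' n : Fin d → ℕ, spectralTerm hα γ f n

/-- The weak-`L¹` quasinorm `sup_{t > 0} t μ{|f| > t}`; `L^{1,∞}(μ)` consists of the (classes of)
measurable functions for which it is finite. -/
def weakL1Norm {X : Type*} [MeasurableSpace X] (μ : Measure X) (f : X → ℂ) : ℝ≥0∞ :=
  ⨆ t : ℝ≥0, (t : ℝ≥0∞) * μ {x | t < ‖f x‖₊}

end DunklOsc

end

/-! On `L²` the theorem is soft. All eigenvalues are at least `1`, so every factor `λ ^ (-iγ)` has
modulus one. The Hermite functions form a Hilbert basis, hence the spectral series converges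
unconditionally and defines a contraction. Everything else follows from a weak type `(1, 1)` bound
on `L¹ ∩ L²`, which is Calderón–Zygmund theory for the doubling measure `w_α`.

No integral kernel of the imaginary power is constructed. Hörmander's condition is tested directly.
Let `b` have mean zero and support in a ball of radius `r`, and let `g` be bounded by `1` and vanish
on the double ball. For `F t = ⟨g, exp(-t𝓛) b⟩` one has `|F t| ≤ M min (t / r²) ((r² / t)^(1/2))`
with `M` a multiple of the `L¹` norm of `b`. Therefore the Mellin integral of `F` at `δ + iγ` stays
bounded as `δ → 0`. Divided by `Γ(δ + iγ)`, which tends to a finite nonzero limit because `γ ≠ 0`,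
it tends to the pairing of `g` with the imaginary power of `b` (`norm_tsum_cpow_le`,
`setLIntegral_imaginaryPower_le`).

The two bounds on `F` come from the Mehler kernel: its second moment is `O(t)`
(`integral_sq_sub_mul_mehler_le`), and in one variable it is Lipschitz with values in `L¹` of the
other, with constant `O(t^(-1/2))` (`integral_abs_mehler_sub_le`). The kernel is a tensor product,
so both are one-dimensional facts. They rest on explicit Gaussian integrals of the Dunkl kernel and
on its representation as the Laplace transform of a positive measure on `[-1, 1]`
(`exists_measure_dunklExp_eq_integral`), available for orders at least `-1/2`. That the Mehler
kernel is the heat kernel is checked on Hermite functions (`integral_mehler_mul_hermite1`) and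
transferred by completeness.

A Calderón–Zygmund decomposition yields the weak type bound (`HormanderCondition.weak_type`).
Marcinkiewicz interpolation with `L²` gives `1 < p < 2`, and duality gives `p > 2`, since the
adjoint is the imaginary power with `-γ`. Density of `L² ∩ L^p` provides the unique extension for `1
< p < ∞`. On `L¹` the extension is built from limits in measure. -/

noncomputable section

namespace DunklOsc

section
/-! ### The one-dimensional power weight -/

/-- The measure `|v|^(2a+1) dv` on the line. -/
def powMeasure (a : ℝ) : Measure ℝ :=
  volume.withDensity fun v => ENNReal.ofReal (|v| ^ (2 * a + 1))

theorem measurable_powDensity (a : ℝ) :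
    Measurable fun v : ℝ => ENNReal.ofReal (|v| ^ (2 * a + 1)) := by fun_prop

theorem integral_powMeasure {E : Type*} [NormedAddCommGroup E] [NormedSpace ℝ E] (a : ℝ)
    (f : ℝ → E) : ∫ v, f v ∂powMeasure a = ∫ v, (|v| ^ (2 * a + 1) : ℝ) • f v := by
  rw [powMeasure, integral_withDensity_eq_integral_toReal_smul (measurable_powDensity a)
    (ae_of_all _ fun _ => ENNReal.ofReal_lt_top)]
  refine integral_congr_ae (ae_of_all _ fun v => ?_)
  simp only [ENNReal.toReal_ofReal (Real.rpow_nonneg (abs_nonneg v) _)]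

theorem integrable_powMeasure {E : Type*} [NormedAddCommGroup E] [NormedSpace ℝ E] (a : ℝ)
    (f : ℝ → E) :
    Integrable f (powMeasure a) ↔ Integrable fun v => (|v| ^ (2 * a + 1) : ℝ) • f v := by
  rw [powMeasure, integrable_withDensity_iff_integrable_smul' (measurable_powDensity a)
    (ae_of_all _ fun _ => ENNReal.ofReal_lt_top)]
  refine integrable_congr (ae_of_all _ fun v => ?_)
  simp only [ENNReal.toReal_ofReal (Real.rpow_nonneg (abs_nonneg v) _)]

instance (a : ℝ) : SigmaFinite (powMeasure a) := by
  unfold powMeasure; infer_instance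

theorem integral_odd_powMeasure (a : ℝ) {f : ℝ → ℝ} (hf : ∀ v, f (-v) = -f v) :
    ∫ v, f v ∂powMeasure a = 0 := by
  rw [integral_powMeasure]
  have h := integral_neg_eq_self (fun v : ℝ => |v| ^ (2 * a + 1) • f v) volume
  simp only [hf, abs_neg, smul_neg, integral_neg] at h
  linarith

theorem abs_rpow_succ {a : ℝ} (ha : -1 / 2 ≤ a) (v : ℝ) :
    |v| ^ (2 * (a + 1) + 1) = |v| ^ (2 * a + 1) * v ^ 2 := by
  rw [show 2 * (a + 1) + 1 = 2 * a + 1 + (2 : ℕ) by push_cast; ring,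
    Real.rpow_add_natCast' (abs_nonneg v) (by push_cast; linarith), sq_abs]

/-- The shift `a ↦ a + 1` costs a factor `v ^ 2`. This converts questions on odd functions of order
`a` into questions on even functions of order `a + 1`, a device used for the kernel and for the
Hermite functions alike. -/
theorem integral_powMeasure_succ {a : ℝ} (ha : -1 / 2 ≤ a) (f : ℝ → ℝ) :
    ∫ v, f v ∂powMeasure (a + 1) = ∫ v, v ^ 2 * f v ∂powMeasure a := by
  rw [integral_powMeasure, integral_powMeasure]
  refine integral_congr_ae (ae_of_all _ fun v => ?_)
  simp only [abs_rpow_succ ha v, smul_eq_mul]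
  ring

theorem integrable_powMeasure_succ {a : ℝ} (ha : -1 / 2 ≤ a) (f : ℝ → ℝ) :
    Integrable f (powMeasure (a + 1)) ↔ Integrable (fun v => v ^ 2 * f v) (powMeasure a) := by
  rw [integrable_powMeasure, integrable_powMeasure]
  refine integrable_congr (ae_of_all _ fun v => ?_)
  simp only [abs_rpow_succ ha v, smul_eq_mul]
  ring

theorem continuous_powDensity {a : ℝ} (ha : -1 / 2 ≤ a) :
    Continuous fun v : ℝ => |v| ^ (2 * a + 1) :=
  continuous_abs.rpow_const fun _ => Or.inr (by linarith)

theorem abs_rpow_le_one_add_pow {s : ℝ} (hs : 0 ≤ s) {N : ℕ} (hN : s ≤ N) (x : ℝ) :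
    |x| ^ s ≤ 1 + x ^ (2 * N) := by
  rw [pow_mul, ← sq_abs, ← pow_mul]
  rcases le_total |x| 1 with h | h
  · have := Real.rpow_le_one (abs_nonneg x) h hs
    have : 0 ≤ |x| ^ (2 * N) := by positivity
    linarith
  · have : |x| ^ s ≤ |x| ^ (((2 * N : ℕ) : ℝ)) := by
      apply Real.rpow_le_rpow_of_exponent_le h
      push_cast
      have := Nat.cast_nonneg (α := ℝ) N
      linarith
    rw [Real.rpow_natCast] at this
    linarith

theorem integrable_pow_mul_gaussian {a B : ℝ} (ha : -1 / 2 ≤ a) (hB : 0 < B) (n : ℕ) :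
    Integrable (fun v => v ^ n * Real.exp (-B * v ^ 2)) (powMeasure a) := by
  rw [integrable_powMeasure]
  have hn : (0 : ℝ) ≤ n := n.cast_nonneg
  have hs : 0 ≤ 2 * a + 1 + n := by linarith
  obtain ⟨N, hN⟩ := exists_nat_ge (2 * a + 1 + n)
  have h1 : Integrable fun x : ℝ => (1 + x ^ (2 * N)) * Real.exp (-B * x ^ 2) := by
    have h2 := integrable_rpow_mul_exp_neg_mul_sq hB (s := (2 * N : ℕ))
      (by linarith [Nat.cast_nonneg (α := ℝ) (2 * N)])
    refine ((integrable_exp_neg_mul_sq hB).add h2).congr (ae_of_all _ fun x => ?_)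
    simp only [Pi.add_apply, Real.rpow_natCast]
    ring
  refine h1.mono' ((continuous_powDensity ha).mul (by fun_prop)).aestronglyMeasurable
    (ae_of_all _ fun v => ?_)
  rw [smul_eq_mul, norm_mul, norm_mul, Real.norm_eq_abs, Real.norm_eq_abs, Real.norm_eq_abs,
    Real.abs_exp, ← mul_assoc, abs_pow, abs_of_nonneg (Real.rpow_nonneg (abs_nonneg v) _),
    ← Real.rpow_natCast |v| n, ← Real.rpow_add_of_nonneg (abs_nonneg v) (by linarith) hn]
  exact mul_le_mul_of_nonneg_right (abs_rpow_le_one_add_pow hs hN v) (Real.exp_pos _).le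

theorem integral_even_pow_mul_gaussian {a B : ℝ} (ha : -1 / 2 ≤ a) (hB : 0 < B) (n : ℕ) :
    ∫ v, v ^ (2 * n) * Real.exp (-B * v ^ 2) ∂powMeasure a =
      Real.Gamma (n + a + 1) * B ^ (-(n + a + 1)) := by
  rw [integral_powMeasure]
  have hn : (0 : ℝ) ≤ n := n.cast_nonneg
  have h1 := integral_comp_abs (f := fun x : ℝ => x ^ (2 * a + 1 + (2 * n : ℕ)) * Real.exp (-B * x ^ (2 : ℝ)))
  rw [integral_rpow_mul_exp_neg_mul_rpow two_pos (by push_cast; linarith) hB] at h1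
  rw [show (2 * a + 1 + (2 * n : ℕ) + 1) / 2 = n + a + 1 by push_cast; ring,
    show -(2 * a + 1 + (2 * n : ℕ) + 1) / 2 = -(n + a + 1) by push_cast; ring] at h1
  trans 2 * (B ^ (-(n + a + 1)) * (1 / 2) * Real.Gamma (n + a + 1))
  · rw [← h1]
    refine integral_congr_ae (ae_of_all _ fun v => ?_)
    simp only [smul_eq_mul]
    rw [Real.rpow_add_of_nonneg (y := 2 * a + 1) (abs_nonneg v) (by linarith) (by positivity),
      Real.rpow_natCast, pow_mul, pow_mul, sq_abs, Real.rpow_two, sq_abs]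
    ring
  · ring

/-! ### Two series for the normalized Bessel function -/

theorem hasSum_pow_mul_descFactorial (X : ℝ) (i : ℕ) :
    HasSum (fun k : ℕ => X ^ k / k.factorial * k.descFactorial i) (X ^ i * Real.exp X) := by
  -- The first `i` terms vanish with the falling factorial; what remains is the exponential series,
  -- shifted by `i`.
  rw [← hasSum_nat_add_iff' i]
  have h0 : ∑ k ∈ Finset.range i, X ^ k / k.factorial * (k.descFactorial i : ℝ) = 0 :=
    Finset.sum_eq_zero fun k hk => by
      rw [Nat.descFactorial_eq_zero_iff_lt.2 (Finset.mem_range.1 hk)]; simp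
  rw [h0, sub_zero]
  have h := (NormedSpace.expSeries_div_hasSum_exp X).mul_left (X ^ i)
  rw [← Real.exp_eq_exp_ℝ] at h
  refine h.congr_fun fun k => ?_
  have h1 : ((k + i).factorial : ℝ) = k.factorial * (k + i).descFactorial i := by
    have := Nat.factorial_mul_descFactorial (n := k + i) (k := i) (by omega)
    rw [Nat.add_sub_cancel] at this
    exact_mod_cast this.symm
  have h2 : ((k + i).descFactorial i : ℝ) ≠ 0 := by
    have : (k + i).descFactorial i ≠ 0 := by
      rw [Ne, Nat.descFactorial_eq_zero_iff_lt]; omega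
    exact_mod_cast this
  have h3 : (k.factorial : ℝ) ≠ 0 := by positivity
  rw [h1, pow_add]
  field_simp

/-- Chu–Vandermonde for quotients of Gamma values. -/
theorem gamma_quotient_eq_sum (j : ℕ) : ∀ {a : ℝ}, -1 < a → ∀ k : ℕ,
    Real.Gamma (k + j + a + 1) = Real.Gamma (k + a + 1) *
      ∑ i ∈ Finset.range (j + 1), (j.choose i : ℝ) * k.descFactorial i *
        (Real.Gamma (j + a + 1) / Real.Gamma (i + a + 1)) := by
  induction j with
  | zero =>
    intro a ha k
    have : Real.Gamma (a + 1) ≠ 0 := (Real.Gamma_pos_of_pos (by linarith)).ne'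
    simp [this]
  | succ j ih =>
    intro a ha k
    have hk : (0 : ℝ) ≤ k := k.cast_nonneg
    -- Raising `j` is absorbed by raising `a`, which is why the induction runs over all `a`.
    -- Pascal's rule then splits the sum for `j + 1`.
    have h1 := ih (a := a + 1) (by linarith) k
    have h2 : Real.Gamma (k + (a + 1) + 1) = (k + a + 1) * Real.Gamma (k + a + 1) := by
      rw [show (k : ℝ) + (a + 1) + 1 = (k + a + 1) + 1 by ring, Real.Gamma_add_one (by linarith)]
    rw [h2, show (k : ℝ) + j + (a + 1) + 1 = k + (j + 1 : ℕ) + a + 1 by push_cast; ring] at h1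
    rw [h1, mul_comm (k + a + 1 : ℝ), mul_assoc]
    congr 1
    have h3 := Finset.sum_choose_succ_mul (fun i _ => (k.descFactorial i : ℝ) *
        (Real.Gamma ((j + 1 : ℕ) + a + 1) / Real.Gamma (i + a + 1))) j
    simp only [← mul_assoc] at h3
    rw [h3, ← Finset.sum_add_distrib, Finset.mul_sum]
    refine Finset.sum_congr rfl fun i _ => ?_
    have hi : (0 : ℝ) ≤ i := i.cast_nonneg
    have h4 : Real.Gamma ((i : ℝ) + (a + 1) + 1) = (i + a + 1) * Real.Gamma (i + a + 1) := by
      rw [show (i : ℝ) + (a + 1) + 1 = (i + a + 1) + 1 by ring, Real.Gamma_add_one (by linarith)]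
    have h5 : Real.Gamma (((i + 1 : ℕ) : ℝ) + a + 1) = (i + a + 1) * Real.Gamma (i + a + 1) := by
      rw [show ((i + 1 : ℕ) : ℝ) + a + 1 = (i + a + 1) + 1 by push_cast; ring,
        Real.Gamma_add_one (by linarith)]
    have h6 : Real.Gamma (i + a + 1) ≠ 0 := (Real.Gamma_pos_of_pos (by linarith)).ne'
    have h7 : (i : ℝ) + a + 1 ≠ 0 := by linarith
    have h8 : (k.descFactorial (i + 1) : ℝ) = (k - i) * k.descFactorial i := by
      rcases le_or_gt i k with h | h
      · rw [Nat.descFactorial_succ]; push_cast [h]; ring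
      · rw [Nat.descFactorial_eq_zero_iff_lt.2 h, Nat.descFactorial_eq_zero_iff_lt.2 (by omega)]
        simp
    rw [h4, h5, h8, show (j : ℝ) + (a + 1) + 1 = (j + 1 : ℕ) + a + 1 by push_cast; ring]
    field_simp
    ring

/-- The normalized Bessel function `∑ (z/2)^(2k) / (k! Γ(k+a+1))`. -/
def besselSeries (a z : ℝ) : ℝ :=
  ∑' k : ℕ, (z / 2) ^ (2 * k) / (k.factorial * Real.Gamma (k + a + 1))

/-- A multiple of the Dunkl kernel of the reflection group `ℤ/2`. -/
def dunklExp (a z : ℝ) : ℝ := besselSeries a z + z / 2 * besselSeries (a + 1) z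

/-- The `j`-th even moment of a Gaussian against the normalized Bessel function, relative to
`B^(-(j+a+1)) exp X` with `X = x² / (4B)`. -/
def momentPoly (a : ℝ) (j : ℕ) (X : ℝ) : ℝ :=
  ∑ i ∈ Finset.range (j + 1), (j.choose i : ℝ) *
    (Real.Gamma (j + a + 1) / Real.Gamma (i + a + 1)) * X ^ i

/-- Chu–Vandermonde writes the Gamma quotient as a combination of falling factorials of `k`, each of
which sums to `X ^ i * exp X` against the exponential weights. -/
theorem hasSum_moment {a : ℝ} (ha : -1 < a) (j : ℕ) (X : ℝ) :
    HasSum (fun k : ℕ => X ^ k / (k.factorial * Real.Gamma (k + a + 1)) *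
      Real.Gamma (k + j + a + 1)) (momentPoly a j X * Real.exp X) := by
  have h : HasSum (fun k : ℕ => ∑ i ∈ Finset.range (j + 1), (j.choose i : ℝ) *
    (Real.Gamma (j + a + 1) / Real.Gamma (i + a + 1)) * (X ^ k / k.factorial * k.descFactorial i))
      (∑ i ∈ Finset.range (j + 1), (j.choose i : ℝ) *
    (Real.Gamma (j + a + 1) / Real.Gamma (i + a + 1)) * (X ^ i * Real.exp X)) :=
    hasSum_sum fun i _ => (hasSum_pow_mul_descFactorial X i).mul_left _
  convert h using 1
  · ext k
    have h6 : Real.Gamma (k + a + 1) ≠ 0 :=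
      (Real.Gamma_pos_of_pos (by linarith [k.cast_nonneg (α := ℝ)])).ne'
    rw [gamma_quotient_eq_sum j ha k, ← mul_assoc, Finset.mul_sum]
    refine Finset.sum_congr rfl fun i _ => ?_
    field_simp
  · rw [momentPoly, Finset.sum_mul]
    exact Finset.sum_congr rfl fun i _ => by ring

theorem summable_besselSeries {a : ℝ} (ha : -1 < a) (z : ℝ) :
    Summable fun k : ℕ => (z / 2) ^ (2 * k) / (k.factorial * Real.Gamma (k + a + 1)) := by
  -- After dropping two terms the argument of Gamma is at least `2`, where Gamma is at least `1`,
  -- and the exponential series dominates.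
  rw [← summable_nat_add_iff 2]
  refine Summable.of_nonneg_of_le (fun k => ?_) (fun k => ?_)
    ((summable_nat_add_iff 2).2 (NormedSpace.expSeries_div_hasSum_exp ((z / 2) ^ 2)).summable)
  · have := Real.Gamma_pos_of_pos (s := (k + 2 : ℕ) + a + 1)
      (by push_cast; linarith [k.cast_nonneg (α := ℝ)])
    have : 0 ≤ (z / 2) ^ (2 * (k + 2)) := by rw [pow_mul]; positivity
    positivity
  · have h1 : 1 ≤ Real.Gamma ((k + 2 : ℕ) + a + 1) := by
      have h2 : (2 : ℝ) ≤ (k + 2 : ℕ) + a + 1 := by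
        push_cast; linarith [k.cast_nonneg (α := ℝ)]
      have h3 := Real.Gamma_strictMonoOn_Ici.monotoneOn (Set.mem_Ici.2 le_rfl) (Set.mem_Ici.2 h2) h2
      rwa [Real.Gamma_two] at h3
    rw [pow_mul]
    gcongr
    exact le_mul_of_one_le_right (by positivity) h1

/-! ### Gaussian integrals of the normalized Bessel function -/

theorem hasSum_integral_besselSeries {a B : ℝ} (ha : -1 / 2 ≤ a) (hB : 0 < B) (x : ℝ) (j : ℕ) :
    HasSum (fun k : ℕ => ∫ v, (x / 2) ^ (2 * k) / (k.factorial * Real.Gamma (k + a + 1)) *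
      (v ^ (2 * (k + j)) * Real.exp (-B * v ^ 2)) ∂powMeasure a)
      (B ^ (-(j + a + 1)) * (momentPoly a j (x ^ 2 / (4 * B)) * Real.exp (x ^ 2 / (4 * B)))) := by
  refine ((hasSum_moment (by linarith) j (x ^ 2 / (4 * B))).mul_left
    (B ^ (-(j + a + 1)))).congr_fun fun k => ?_
  rw [integral_const_mul, integral_even_pow_mul_gaussian ha hB, pow_mul,
    show (-(((k + j : ℕ) : ℝ) + a + 1)) = -(j + a + 1) + -(k : ℝ) by push_cast; ring,
    Real.rpow_add hB, Real.rpow_neg hB.le (k : ℝ), Real.rpow_natCast,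
    show (x ^ 2 / (4 * B)) = (x / 2) ^ 2 * B⁻¹ by field_simp; ring, mul_pow, inv_pow]
  push_cast
  ring

theorem besselTerm_nonneg {a : ℝ} (ha : -1 < a) (x : ℝ) (k : ℕ) :
    0 ≤ (x / 2) ^ (2 * k) / (k.factorial * Real.Gamma (k + a + 1)) := by
  have := Real.Gamma_pos_of_pos (s := k + a + 1) (by linarith [k.cast_nonneg (α := ℝ)])
  rw [pow_mul]
  positivity

theorem tsum_besselTerm_mul (a B x v : ℝ) (j : ℕ) :
    ∑' k : ℕ, (x / 2) ^ (2 * k) / (k.factorial * Real.Gamma (k + a + 1)) *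
      (v ^ (2 * (k + j)) * Real.exp (-B * v ^ 2)) =
    v ^ (2 * j) * Real.exp (-B * v ^ 2) * besselSeries a (x * v) := by
  rw [besselSeries, ← tsum_mul_left]
  refine tsum_congr fun k => ?_
  rw [mul_div_right_comm x v 2, mul_pow, mul_add, pow_add]
  ring

theorem integrable_besselTerm_mul {a B : ℝ} (ha : -1 / 2 ≤ a) (hB : 0 < B) (x : ℝ) (j k : ℕ) :
    Integrable (fun v => (x / 2) ^ (2 * k) / (k.factorial * Real.Gamma (k + a + 1)) *
      (v ^ (2 * (k + j)) * Real.exp (-B * v ^ 2))) (powMeasure a) :=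
  (integrable_pow_mul_gaussian ha hB _).const_mul _

theorem norm_besselTerm_mul {a : ℝ} (ha : -1 / 2 ≤ a) (B x v : ℝ) (j k : ℕ) :
    ‖(x / 2) ^ (2 * k) / (k.factorial * Real.Gamma (k + a + 1)) *
      (v ^ (2 * (k + j)) * Real.exp (-B * v ^ 2))‖ =
    (x / 2) ^ (2 * k) / (k.factorial * Real.Gamma (k + a + 1)) *
      (v ^ (2 * (k + j)) * Real.exp (-B * v ^ 2)) := by
  rw [Real.norm_of_nonneg]
  have := besselTerm_nonneg (by linarith : -1 < a) x k
  have : 0 ≤ v ^ (2 * (k + j)) := by rw [pow_mul]; positivity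
  positivity

theorem integral_gaussian_mul_besselSeries {a B : ℝ} (ha : -1 / 2 ≤ a) (hB : 0 < B) (x : ℝ)
    (j : ℕ) : ∫ v, v ^ (2 * j) * Real.exp (-B * v ^ 2) * besselSeries a (x * v) ∂powMeasure a =
      B ^ (-(j + a + 1)) * (momentPoly a j (x ^ 2 / (4 * B)) * Real.exp (x ^ 2 / (4 * B))) := by
  have h := hasSum_integral_besselSeries ha hB x j
  rw [← h.tsum_eq, integral_tsum_of_summable_integral_norm (integrable_besselTerm_mul ha hB x j)]
  · simp only [tsum_besselTerm_mul]
  · simpa only [norm_besselTerm_mul ha] using h.summable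

/-- The integral of a non-integrable function is `0` by convention, whereas the closed form just
obtained is strictly positive. -/
theorem integrable_gaussian_mul_besselSeries {a B : ℝ} (ha : -1 / 2 ≤ a) (hB : 0 < B) (x : ℝ)
    (j : ℕ) : Integrable (fun v => v ^ (2 * j) * Real.exp (-B * v ^ 2) * besselSeries a (x * v))
      (powMeasure a) := by
  by_contra hn
  have h1 := integral_gaussian_mul_besselSeries ha hB x j
  rw [integral_undef hn] at h1
  have h2 : 0 < momentPoly a j (x ^ 2 / (4 * B)) := by
    have hG : ∀ i : ℕ, 0 < Real.Gamma (i + a + 1) := fun i =>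
      Real.Gamma_pos_of_pos (by linarith [i.cast_nonneg (α := ℝ)])
    refine Finset.sum_pos' (fun i _ => ?_) ⟨0, by simp, ?_⟩
    · have := hG i; have := hG j
      positivity
    · have := hG 0; have := hG j
      simp only [Nat.choose_zero_right, pow_zero]
      positivity
  have : 0 < B ^ (-(j + a + 1)) := Real.rpow_pos_of_pos hB _
  have := Real.exp_pos (x ^ 2 / (4 * B))
  have : 0 < B ^ (-(j + a + 1)) *
    (momentPoly a j (x ^ 2 / (4 * B)) * Real.exp (x ^ 2 / (4 * B))) := by positivity
  linarith

theorem momentPoly_zero {a : ℝ} (ha : -1 / 2 ≤ a) (X : ℝ) : momentPoly a 0 X = 1 := by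
  have : Real.Gamma (a + 1) ≠ 0 := (Real.Gamma_pos_of_pos (by linarith)).ne'
  simp [momentPoly, this]

theorem momentPoly_one {a : ℝ} (ha : -1 / 2 ≤ a) (X : ℝ) : momentPoly a 1 X = X + (a + 1) := by
  have h1 : Real.Gamma (a + 1) ≠ 0 := (Real.Gamma_pos_of_pos (by linarith)).ne'
  have h2 : Real.Gamma (a + 1 + 1) = (a + 1) * Real.Gamma (a + 1) :=
    Real.Gamma_add_one (by linarith)
  have h3 : a + 1 ≠ 0 := by linarith
  simp only [momentPoly, Finset.sum_range_succ, Finset.range_zero, Finset.sum_empty]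
  push_cast
  simp only [Nat.choose_self, Nat.choose_zero_right, Nat.cast_one, zero_add, one_mul, pow_zero, pow_one, mul_one,
    show 1 + a + 1 = a + 1 + 1 by ring, h2]
  field_simp
  ring

end

section
/-! ### Laplace representation of the Dunkl kernel -/

theorem integrable_pow_of_compact {μ : Measure ℝ} [IsFiniteMeasure μ]
    (hμ : ∀ᵐ s ∂μ, |s| ≤ 1) {f : ℝ → ℝ} (hf : Continuous f) : Integrable f μ := by
  obtain ⟨C, hC⟩ := (isCompact_Icc (a := (-1 : ℝ)) (b := 1)).exists_bound_of_continuousOn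
    hf.continuousOn
  refine Integrable.of_bound hf.aestronglyMeasurable C ?_
  filter_upwards [hμ] with s hs using hC s (abs_le.1 hs)

/-- The two recurrences and the total mass determine all moments, and `m n / n!` comes out as the
`n`-th Taylor coefficient of `dunklExp a`. A representing measure thus only has to satisfy the
recurrences. -/
theorem moments_eq_of_recurrence {a : ℝ} (ha : -1 < a) {m : ℕ → ℝ}
    (h0 : m 0 = 1 / Real.Gamma (a + 1)) (h1 : ∀ k, m (2 * k + 1) = m (2 * k + 2))
    (h2 : ∀ k : ℕ, (2 * k + 1) * m (2 * k) = 2 * (k + a + 1) * m (2 * k + 2)) (k : ℕ) :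
    m (2 * k) / (2 * k).factorial = (1 / 2) ^ (2 * k) / (k.factorial * Real.Gamma (k + a + 1)) ∧
    m (2 * k + 1) / (2 * k + 1).factorial =
      (1 / 2) ^ (2 * k + 1) / (k.factorial * Real.Gamma (k + (a + 1) + 1)) := by
  have hG : ∀ k : ℕ, Real.Gamma (k + a + 1) ≠ 0 := fun k =>
    (Real.Gamma_pos_of_pos (by linarith [k.cast_nonneg (α := ℝ)])).ne'
  have hG1 : ∀ k : ℕ, Real.Gamma (k + (a + 1) + 1) = (k + a + 1) * Real.Gamma (k + a + 1) :=
    fun k => by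
      rw [show (k : ℝ) + (a + 1) + 1 = (k + a + 1) + 1 by ring,
        Real.Gamma_add_one (by linarith [k.cast_nonneg (α := ℝ)])]
  have hk : ∀ k : ℕ, (k : ℝ) + a + 1 ≠ 0 := fun k => by linarith [k.cast_nonneg (α := ℝ)]
  have even : ∀ k : ℕ, m (2 * k) / (2 * k).factorial =
      (1 / 2) ^ (2 * k) / (k.factorial * Real.Gamma (k + a + 1)) := by
    intro k
    induction k with
    | zero => simp [h0]
    | succ k ih =>
      have h3 : m (2 * k + 2) = (2 * k + 1) * m (2 * k) / (2 * (k + a + 1)) := by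
        rw [h2, mul_div_cancel_left₀ _ (mul_ne_zero two_ne_zero (hk k))]
      have h4 : m (2 * k) = (1 / 2) ^ (2 * k) / (k.factorial * Real.Gamma (k + a + 1)) *
        (2 * k).factorial := by rw [← ih, div_mul_cancel₀ _ (by positivity)]
      have h5 : Real.Gamma ((k + 1 : ℕ) + a + 1) = (k + a + 1) * Real.Gamma (k + a + 1) := by
        rw [← hG1]; push_cast; congr 1; ring
      rw [show 2 * (k + 1) = 2 * k + 2 by ring, h3, h4, h5, Nat.factorial_succ, Nat.factorial_succ,
        Nat.factorial_succ]
      have := hG k; have := hk k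
      push_cast
      field_simp
      ring
  refine ⟨even k, ?_⟩
  have h4 : m (2 * k) = (1 / 2) ^ (2 * k) / (k.factorial * Real.Gamma (k + a + 1)) *
    (2 * k).factorial := by rw [← even k, div_mul_cancel₀ _ (by positivity)]
  have h3 : m (2 * k + 2) = (2 * k + 1) * m (2 * k) / (2 * (k + a + 1)) := by
    rw [h2, mul_div_cancel_left₀ _ (mul_ne_zero two_ne_zero (hk k))]
  rw [h1, h3, h4, hG1, Nat.factorial_succ]
  have := hG k; have := hk k
  push_cast
  field_simp
  ring

theorem hasSum_dunklExp {a : ℝ} (ha : -1 < a) {m : ℕ → ℝ}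
    (h0 : m 0 = 1 / Real.Gamma (a + 1)) (h1 : ∀ k, m (2 * k + 1) = m (2 * k + 2))
    (h2 : ∀ k : ℕ, (2 * k + 1) * m (2 * k) = 2 * (k + a + 1) * m (2 * k + 2)) (z : ℝ) :
    HasSum (fun n => z ^ n / n.factorial * m n) (dunklExp a z) := by
  have hm := moments_eq_of_recurrence ha h0 h1 h2
  refine HasSum.even_add_odd ?_ ?_
  · refine (summable_besselSeries ha z).hasSum.congr_fun fun k => ?_
    rw [div_mul_eq_mul_div, mul_div_assoc, (hm k).1]
    ring
  · refine ((summable_besselSeries (a := a + 1) (by linarith) z).hasSum.mul_left (z / 2)).congr_fun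
      fun k => ?_
    rw [div_mul_eq_mul_div, mul_div_assoc, (hm k).2]
    ring

theorem dunklExp_eq_integral_of_moments {a : ℝ} (ha : -1 < a) {μ : Measure ℝ} [IsFiniteMeasure μ]
    (hμ : ∀ᵐ s ∂μ, |s| ≤ 1) (h0 : ∫ _, 1 ∂μ = 1 / Real.Gamma (a + 1))
    (h1 : ∀ k : ℕ, ∫ s, s ^ (2 * k + 1) ∂μ = ∫ s, s ^ (2 * k + 2) ∂μ)
    (h2 : ∀ k : ℕ, (2 * k + 1) * ∫ s, s ^ (2 * k) ∂μ = 2 * (k + a + 1) * ∫ s, s ^ (2 * k + 2) ∂μ)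
    (z : ℝ) : dunklExp a z = ∫ s, Real.exp (z * s) ∂μ := by
  have h := hasSum_dunklExp ha (m := fun n => ∫ s, s ^ n ∂μ) (by simpa using h0) h1 h2 z
  have hs : ∀ s : ℝ, HasSum (fun n : ℕ => z ^ n / n.factorial * s ^ n) (Real.exp (z * s)) := by
    intro s
    have := NormedSpace.expSeries_div_hasSum_exp (z * s)
    rw [← Real.exp_eq_exp_ℝ] at this
    refine this.congr_fun fun n => ?_
    rw [mul_pow]; ring
  have h3 : HasSum (fun n : ℕ => ∫ s, z ^ n / n.factorial * s ^ n ∂μ)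
      (∫ s, Real.exp (z * s) ∂μ) := by
    have h4 := hasSum_integral_of_summable_integral_norm (μ := μ)
      (F := fun (n : ℕ) (s : ℝ) => z ^ n / n.factorial * s ^ n)
      (fun n => integrable_pow_of_compact hμ (by fun_prop)) ?_
    · simpa only [fun s => (hs s).tsum_eq] using h4
    · refine Summable.of_nonneg_of_le (fun n => integral_nonneg fun _ => norm_nonneg _)
        (fun n => ?_) ((NormedSpace.expSeries_div_hasSum_exp |z|).summable.mul_right (μ.real Set.univ))
      have h5 : ∀ᵐ s ∂μ, ‖z ^ n / n.factorial * s ^ n‖ ≤ |z| ^ n / n.factorial := by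
        filter_upwards [hμ] with s hs
        rw [norm_mul, norm_div, norm_pow, norm_pow, Real.norm_eq_abs, Real.norm_eq_abs,
          Nat.abs_cast]
        exact mul_le_of_le_one_right (by positivity) (pow_le_one₀ (abs_nonneg _) hs)
      refine (integral_mono_ae (integrable_pow_of_compact hμ (by fun_prop)) (integrable_const _)
        h5).trans ?_
      rw [integral_const, smul_eq_mul, mul_comm]
  simp only [integral_const_mul] at h3
  exact h.unique h3

/-- On `[0, 1]` the factorization `(1 - s)^b (1 + s)^b` leaves a singularity at `1` only; the other
half follows by reflection. -/
theorem intervalIntegrable_one_sub_sq_rpow {b : ℝ} (hb : -1 < b) :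
    IntervalIntegrable (fun s : ℝ => (1 - s ^ 2) ^ b) volume (-1) 1 := by
  have key : IntervalIntegrable (fun s : ℝ => (1 - s ^ 2) ^ b) volume 0 1 := by
    have h1 : IntervalIntegrable (fun s : ℝ => (1 - s) ^ b) volume 0 1 := by
      have := (intervalIntegral.intervalIntegrable_rpow' (a := 0) (b := 1) hb).comp_sub_left 1
      simpa using this.symm
    have h2 : ContinuousOn (fun s : ℝ => (1 + s) ^ b) (Set.uIcc 0 1) := by
      refine ContinuousOn.rpow_const (by fun_prop) fun s hs => Or.inl ?_
      rw [Set.uIcc_of_le zero_le_one] at hs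
      linarith [hs.1]
    refine (h1.mul_continuousOn h2).congr ?_
    intro s hs
    rw [Set.uIoc_of_le zero_le_one] at hs
    simp only
    rw [← Real.mul_rpow (by linarith [hs.2]) (by linarith [hs.1])]
    ring_nf
  have key2 : IntervalIntegrable (fun s : ℝ => (1 - s ^ 2) ^ b) volume (-1) 0 := by
    have := key.comp_mul_left (c := -1)
    simpa using this.symm
  exact key2.trans key

/-- Integrate the derivative of `(1 - s²)^(b+1) s^(2k+1)`; the boundary terms vanish because `b + 1
> 0`. -/
theorem integral_one_sub_sq_rpow_recurrence {b : ℝ} (hb : -1 < b) (k : ℕ) :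
    (2 * k + 1) * ∫ s in (-1 : ℝ)..1, (1 - s ^ 2) ^ b * s ^ (2 * k) =
      (2 * k + 2 * b + 3) * ∫ s in (-1 : ℝ)..1, (1 - s ^ 2) ^ b * s ^ (2 * k + 2) := by
  have hi : ∀ n : ℕ, IntervalIntegrable (fun s : ℝ => (1 - s ^ 2) ^ b * s ^ n) volume (-1) 1 :=
    fun n => (intervalIntegrable_one_sub_sq_rpow hb).mul_continuousOn (by fun_prop)
  have h := intervalIntegral.integral_eq_sub_of_hasDerivAt_of_le (a := -1) (b := 1)
    (f := fun s : ℝ => (1 - s ^ 2) ^ (b + 1) * s ^ (2 * k + 1))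
    (f' := fun s => (2 * k + 1) * ((1 - s ^ 2) ^ b * s ^ (2 * k)) -
      (2 * k + 2 * b + 3) * ((1 - s ^ 2) ^ b * s ^ (2 * k + 2))) (by norm_num)
    ((ContinuousOn.rpow_const (by fun_prop) fun s hs => Or.inr (by linarith)).mul (by fun_prop))
    (fun s hs => ?_) (((hi _).const_mul _).sub ((hi _).const_mul _))
  · rw [intervalIntegral.integral_sub ((hi _).const_mul _) ((hi _).const_mul _),
      intervalIntegral.integral_const_mul, intervalIntegral.integral_const_mul] at h
    have h0 : (0 : ℝ) ^ (b + 1) = 0 := Real.zero_rpow (by linarith)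
    simp [h0] at h
    linarith
  · have hs' : 0 < 1 - s ^ 2 := by nlinarith [hs.1, hs.2]
    have h1 := ((((hasDerivAt_id s).pow 2).const_sub 1).rpow_const (p := b + 1)
      (Or.inl hs'.ne')).mul ((hasDerivAt_id s).pow (2 * k + 1))
    refine h1.congr_deriv ?_
    simp only [id, Pi.pow_apply, add_sub_cancel_right, Real.rpow_add_one hs'.ne']
    push_cast
    ring

/-- The representing density is a multiple of `(1 - s²)^(a - 1/2) (1 + s)`, which is nonnegative on
the interval and integrable for `a > -1/2`. At `a = -1/2` it degenerates to a point mass at `1`, the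
kernel then being a multiple of the exponential function. Positivity and compact support of the
measure are what later estimates use. -/
theorem exists_measure_dunklExp_eq_integral {a : ℝ} (ha : -1 / 2 ≤ a) :
    ∃ μ : Measure ℝ, IsFiniteMeasure μ ∧ (∀ᵐ s ∂μ, |s| ≤ 1) ∧
      ∀ z, dunklExp a z = ∫ s, Real.exp (z * s) ∂μ := by
  have ha' : -1 < a := by linarith
  have hG : 0 < Real.Gamma (a + 1) := Real.Gamma_pos_of_pos (by linarith)
  rcases ha.eq_or_lt with rfl | ha
  · let μ : Measure ℝ := ENNReal.ofReal (1 / Real.Gamma (-1 / 2 + 1)) • Measure.dirac 1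
    have hμ : ∀ f : ℝ → ℝ, ∫ s, f s ∂μ = 1 / Real.Gamma (-1 / 2 + 1) * f 1 := fun f => by
      simp only [μ, integral_smul_measure, integral_dirac, smul_eq_mul]
      rw [ENNReal.toReal_ofReal (by positivity)]
    have : IsFiniteMeasure μ := Measure.smul_finite _ ENNReal.ofReal_ne_top
    have h1 : ∀ᵐ s ∂μ, |s| ≤ 1 := by
      refine Measure.ae_smul_measure ?_ _
      rw [ae_dirac_iff (measurableSet_le (by fun_prop) (by fun_prop))]
      simp
    refine ⟨μ, this, h1, dunklExp_eq_integral_of_moments ha' h1 ?_ ?_ ?_⟩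
    · rw [hμ, mul_one]
    · intro k; rw [hμ, hμ]; simp
    · intro k; rw [hμ, hμ]; simp only [one_pow]; ring
  · set b := a - 1 / 2 with hb
    have hb1 : -1 < b := by linarith
    have hi : ∀ n : ℕ, IntervalIntegrable (fun s : ℝ => (1 - s ^ 2) ^ b * s ^ n) volume (-1) 1 :=
      fun n => (intervalIntegrable_one_sub_sq_rpow hb1).mul_continuousOn (by fun_prop)
    have hodd : ∀ k : ℕ, ∫ s in (-1 : ℝ)..1, (1 - s ^ 2) ^ b * s ^ (2 * k + 1) = 0 := fun k => by
      have := intervalIntegral.integral_comp_neg (a := -1) (b := 1)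
        (fun s : ℝ => (1 - s ^ 2) ^ b * s ^ (2 * k + 1))
      simp only [neg_sq, neg_neg, Odd.neg_pow (⟨k, rfl⟩ : Odd (2 * k + 1)), mul_neg,
        intervalIntegral.integral_neg] at this
      linarith
    have hpos : 0 < ∫ s in (-1 : ℝ)..1, (1 - s ^ 2) ^ b := by
      refine intervalIntegral.intervalIntegral_pos_of_pos_on
        (intervalIntegrable_one_sub_sq_rpow hb1) (fun s hs => ?_) (by norm_num)
      exact Real.rpow_pos_of_pos (by nlinarith [hs.1, hs.2]) _
    set I := ∫ s in (-1 : ℝ)..1, (1 - s ^ 2) ^ b with hI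
    -- Odd moments of the even weight vanish, so the factor `1 + s` makes the moments of orders `2k
    -- + 1` and `2k + 2` coincide. The constant normalizes the mass to `1 / Γ(a + 1)`.
    let ρ : ℝ → ℝ := fun s => 1 / (I * Real.Gamma (a + 1)) * ((1 - s ^ 2) ^ b * (1 + s))
    have hρm : Measurable ρ := by fun_prop
    have hρ0 : ∀ s ∈ Set.Ioc (-1 : ℝ) 1, 0 ≤ ρ s := fun s hs => by
      have h1 : 0 ≤ 1 - s ^ 2 := by nlinarith [hs.1, hs.2]
      have h2 : 0 ≤ 1 + s := by linarith [hs.1]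
      positivity
    let μ : Measure ℝ := (volume.restrict (Set.Ioc (-1) 1)).withDensity
      fun s => ENNReal.ofReal (ρ s)
    have hμ : ∀ n : ℕ, ∫ s, s ^ n ∂μ = 1 / (I * Real.Gamma (a + 1)) *
        ((∫ s in (-1 : ℝ)..1, (1 - s ^ 2) ^ b * s ^ n) +
          ∫ s in (-1 : ℝ)..1, (1 - s ^ 2) ^ b * s ^ (n + 1)) := fun n => by
      rw [integral_withDensity_eq_integral_toReal_smul hρm.ennreal_ofReal
        (ae_of_all _ fun _ => ENNReal.ofReal_lt_top), ← intervalIntegral.integral_add (hi _) (hi _),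
        ← intervalIntegral.integral_const_mul, intervalIntegral.integral_of_le (by norm_num)]
      refine setIntegral_congr_fun measurableSet_Ioc fun s hs => ?_
      simp only [ENNReal.toReal_ofReal (hρ0 s hs), smul_eq_mul, ρ]
      ring
    have hfin : IsFiniteMeasure μ := by
      refine isFiniteMeasure_withDensity_ofReal ?_
      have h1 : IntegrableOn ρ (Set.Ioc (-1) 1) := by
        rw [← intervalIntegrable_iff_integrableOn_Ioc_of_le (by norm_num)]
        refine (((hi 0).add (hi 1)).const_mul (1 / (I * Real.Gamma (a + 1)))).congr
          fun s _ => ?_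
        simp only [ρ]
        ring
      exact h1.2
    have h1 : ∀ᵐ s ∂μ, |s| ≤ 1 := by
      refine (withDensity_absolutelyContinuous _ _).ae_le ?_
      filter_upwards [ae_restrict_mem measurableSet_Ioc] with s hs
      exact abs_le.2 ⟨hs.1.le, hs.2⟩
    refine ⟨μ, hfin, h1, dunklExp_eq_integral_of_moments ha' h1 ?_ ?_ ?_⟩
    · have h2 := hμ 0
      have h3 := hodd 0
      simp only [pow_zero, mul_one, zero_add, mul_zero] at h2 h3
      rw [h2, h3, add_zero, ← hI]
      field_simp
    · intro k
      rw [hμ, hμ, hodd, show 2 * k + 2 + 1 = 2 * (k + 1) + 1 by ring, hodd]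
      ring
    · intro k
      have h2 := integral_one_sub_sq_rpow_recurrence hb1 k
      rw [hμ, hμ, hodd, show 2 * k + 2 + 1 = 2 * (k + 1) + 1 by ring, hodd, add_zero, add_zero,
        mul_left_comm, h2, hb]
      ring

theorem besselSeries_neg (a z : ℝ) : besselSeries a (-z) = besselSeries a z := by
  simp only [besselSeries, neg_div, Even.neg_pow (even_two_mul _)]

theorem dunklExp_add_dunklExp_neg (a z : ℝ) :
    dunklExp a z + dunklExp a (-z) = 2 * besselSeries a z := by
  simp only [dunklExp, besselSeries_neg]
  ring

theorem continuous_dunklExp {a : ℝ} (ha : -1 / 2 ≤ a) : Continuous (dunklExp a) := by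
  obtain ⟨μ, hfin, hμ, h⟩ := exists_measure_dunklExp_eq_integral ha
  rw [funext h, continuous_iff_continuousAt]
  intro z
  refine continuousAt_of_dominated (bound := fun _ => Real.exp (|z| + 1))
    (Filter.Eventually.of_forall fun y => by fun_prop) ?_ (integrable_const _)
    (ae_of_all _ fun s => by fun_prop)
  filter_upwards [Metric.ball_mem_nhds z one_pos] with y hy
  filter_upwards [hμ] with s hs
  rw [Real.norm_eq_abs, Real.abs_exp, Real.exp_le_exp]
  have h1 : |y| ≤ |z| + 1 := by
    have := abs_sub_abs_le_abs_sub y z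
    rw [Metric.mem_ball, Real.dist_eq] at hy
    linarith
  calc y * s ≤ |y * s| := le_abs_self _
    _ = |y| * |s| := abs_mul _ _
    _ ≤ |y| := mul_le_of_le_one_right (abs_nonneg _) hs
    _ ≤ |z| + 1 := h1

theorem continuous_besselSeries {a : ℝ} (ha : -1 / 2 ≤ a) : Continuous (besselSeries a) := by
  have h := continuous_dunklExp ha
  have : besselSeries a = fun z => (dunklExp a z + dunklExp a (-z)) / 2 := by
    ext z; rw [dunklExp_add_dunklExp_neg]; ring
  rw [this]
  fun_prop

theorem dunklExp_nonneg {a : ℝ} (ha : -1 / 2 ≤ a) (z : ℝ) : 0 ≤ dunklExp a z := by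
  obtain ⟨μ, hfin, hμ, h⟩ := exists_measure_dunklExp_eq_integral ha
  rw [h]
  exact integral_nonneg fun s => (Real.exp_pos _).le

/-! ### Gaussian integrals of the Dunkl kernel -/

theorem integrable_odd_gaussian_mul_besselSeries {a B : ℝ} (ha : -1 / 2 ≤ a) (hB : 0 < B)
    (x : ℝ) : Integrable (fun v => v * Real.exp (-B * v ^ 2) * besselSeries a (x * v))
      (powMeasure a) := by
  have h0 := integrable_gaussian_mul_besselSeries ha hB x 0
  have h1 := integrable_gaussian_mul_besselSeries ha hB x 1
  refine (h0.norm.add h1.norm).mono' ?_ (ae_of_all _ fun v => ?_)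
  · have := continuous_besselSeries ha
    exact Continuous.aestronglyMeasurable (by fun_prop)
  · simp only [Pi.add_apply, mul_zero, pow_zero, one_mul, mul_one, norm_mul, norm_pow]
    have h2 : ‖v‖ ≤ 1 + ‖v‖ ^ 2 := by nlinarith [sq_nonneg (‖v‖ - 1)]
    calc _ ≤ (1 + ‖v‖ ^ 2) * ‖Real.exp (-B * v ^ 2)‖ * ‖besselSeries a (x * v)‖ := by gcongr
      _ = _ := by ring

theorem integrable_even_gaussian_mul_succ {a B : ℝ} (ha : -1 / 2 ≤ a) (hB : 0 < B)
    (x : ℝ) : Integrable (fun v => v ^ 2 * Real.exp (-B * v ^ 2) * besselSeries (a + 1) (x * v))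
      (powMeasure a) := by
  have h0 := integrable_gaussian_mul_besselSeries (a := a + 1) (by linarith) hB x 0
  rw [integrable_powMeasure_succ ha] at h0
  refine h0.congr (ae_of_all _ fun v => ?_)
  simp only [mul_zero, pow_zero]
  ring

theorem integrable_cube_gaussian_mul_succ {a B : ℝ} (ha : -1 / 2 ≤ a) (hB : 0 < B)
    (x : ℝ) : Integrable (fun v => v ^ 3 * Real.exp (-B * v ^ 2) * besselSeries (a + 1) (x * v))
      (powMeasure a) := by
  have h0 := integrable_odd_gaussian_mul_besselSeries (a := a + 1) (by linarith) hB x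
  rw [integrable_powMeasure_succ ha] at h0
  refine h0.congr (ae_of_all _ fun v => ?_)
  simp only
  ring

/-- The function `besselSeries (a + 1)` is naturally integrated against the weight of order `a + 1`,
that is, with a factor `v ^ 2`. A single factor `v` is dominated by `v ^ 2` where `|v| ≥ 1`, and by
continuity of the series on the compact rest. -/
theorem integrable_odd_gaussian_mul_succ {a B : ℝ} (ha : -1 / 2 ≤ a) (hB : 0 < B)
    (x : ℝ) : Integrable (fun v => v * Real.exp (-B * v ^ 2) * besselSeries (a + 1) (x * v))
      (powMeasure a) := by
  obtain ⟨C, hC⟩ := (isCompact_Icc (a := (-1 : ℝ)) (b := 1)).exists_bound_of_continuousOn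
    (f := fun v => besselSeries (a + 1) (x * v))
    ((continuous_besselSeries (a := a + 1) (by linarith)).comp (by fun_prop)).continuousOn
  have h0 := integrable_even_gaussian_mul_succ ha hB x
  have h1 := ((integrable_pow_mul_gaussian ha hB 0).const_mul C)
  refine (h0.norm.add h1).mono' ?_ (ae_of_all _ fun v => ?_)
  · have := continuous_besselSeries (a := a + 1) (by linarith)
    exact Continuous.aestronglyMeasurable (by fun_prop)
  · simp only [Pi.add_apply, pow_zero, one_mul, norm_mul, norm_pow]
    have hC0 : 0 ≤ C := (norm_nonneg _).trans (hC 0 (by simp))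
    rw [Real.norm_eq_abs (Real.exp _), Real.abs_exp]
    have he := Real.exp_pos (-B * v ^ 2)
    rcases le_total |v| 1 with h | h
    · have h2 := hC v (abs_le.1 h)
      have h3 : ‖v‖ * Real.exp (-B * v ^ 2) * ‖besselSeries (a + 1) (x * v)‖ ≤
          1 * Real.exp (-B * v ^ 2) * C := by
        rw [Real.norm_eq_abs v]
        gcongr
      have : 0 ≤ ‖v‖ ^ 2 * Real.exp (-B * v ^ 2) * ‖besselSeries (a + 1) (x * v)‖ := by positivity
      linarith
    · have h3 : ‖v‖ * Real.exp (-B * v ^ 2) * ‖besselSeries (a + 1) (x * v)‖ ≤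
          ‖v‖ ^ 2 * Real.exp (-B * v ^ 2) * ‖besselSeries (a + 1) (x * v)‖ := by
        rw [Real.norm_eq_abs v]
        gcongr
        nlinarith
      have : 0 ≤ C * Real.exp (-B * v ^ 2) := by positivity
      linarith

theorem integrable_gaussian_mul_dunklExp {a B : ℝ} (ha : -1 / 2 ≤ a) (hB : 0 < B) (x : ℝ) :
    Integrable (fun v => Real.exp (-B * v ^ 2) * dunklExp a (x * v)) (powMeasure a) := by
  refine ((integrable_gaussian_mul_besselSeries ha hB x 0).add
    ((integrable_odd_gaussian_mul_succ ha hB x).const_mul (x / 2))).congr (ae_of_all _ fun v => ?_)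
  simp only [dunklExp, Pi.add_apply, mul_zero, pow_zero]
  ring

/-- For this and the next two moments, only the half of `dunklExp` with the parity of the power of
`v` survives. The even half is evaluated at order `a`, the odd half at order `a + 1`. -/
theorem integral_gaussian_mul_dunklExp {a B : ℝ} (ha : -1 / 2 ≤ a) (hB : 0 < B) (x : ℝ) :
    ∫ v, Real.exp (-B * v ^ 2) * dunklExp a (x * v) ∂powMeasure a =
      B ^ (-(a + 1)) * Real.exp (x ^ 2 / (4 * B)) := by
  have h1 := integrable_gaussian_mul_besselSeries ha hB x 0
  have h2 := (integrable_odd_gaussian_mul_succ ha hB x).const_mul (x / 2)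
  have h3 := integral_gaussian_mul_besselSeries ha hB x 0
  rw [momentPoly_zero ha] at h3
  have h4 := integral_odd_powMeasure a
    (f := fun v => v * Real.exp (-B * v ^ 2) * besselSeries (a + 1) (x * v))
    fun v => by rw [mul_neg, besselSeries_neg]; ring_nf
  trans ∫ v, (v ^ (2 * 0) * Real.exp (-B * v ^ 2) * besselSeries a (x * v) +
    x / 2 * (v * Real.exp (-B * v ^ 2) * besselSeries (a + 1) (x * v))) ∂powMeasure a
  · refine integral_congr_ae (ae_of_all _ fun v => ?_)
    simp only [dunklExp, mul_zero, pow_zero]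
    ring
  · rw [integral_add h1 h2, integral_const_mul, h3, h4]
    simp

theorem integrable_mul_gaussian_mul_dunklExp {a B : ℝ} (ha : -1 / 2 ≤ a) (hB : 0 < B) (x : ℝ) :
    Integrable (fun v => v * (Real.exp (-B * v ^ 2) * dunklExp a (x * v))) (powMeasure a) := by
  refine ((integrable_odd_gaussian_mul_besselSeries ha hB x).add
    ((integrable_even_gaussian_mul_succ ha hB x).const_mul (x / 2))).congr (ae_of_all _ fun v => ?_)
  simp only [dunklExp, Pi.add_apply]
  ring

theorem integral_mul_gaussian_mul_dunklExp {a B : ℝ} (ha : -1 / 2 ≤ a) (hB : 0 < B) (x : ℝ) :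
    ∫ v, v * (Real.exp (-B * v ^ 2) * dunklExp a (x * v)) ∂powMeasure a =
      x / (2 * B) * (B ^ (-(a + 1)) * Real.exp (x ^ 2 / (4 * B))) := by
  have h1 := integrable_odd_gaussian_mul_besselSeries ha hB x
  have h2 := (integrable_even_gaussian_mul_succ ha hB x).const_mul (x / 2)
  have h3 := integral_gaussian_mul_besselSeries (a := a + 1) (by linarith) hB x 0
  rw [momentPoly_zero (by linarith), integral_powMeasure_succ ha] at h3
  have h4 := integral_odd_powMeasure a
    (f := fun v => v * Real.exp (-B * v ^ 2) * besselSeries a (x * v))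
    fun v => by rw [mul_neg, besselSeries_neg]; ring_nf
  trans ∫ v, (v * Real.exp (-B * v ^ 2) * besselSeries a (x * v) +
    x / 2 * (v ^ 2 * Real.exp (-B * v ^ 2) * besselSeries (a + 1) (x * v))) ∂powMeasure a
  · refine integral_congr_ae (ae_of_all _ fun v => ?_)
    simp only [dunklExp]
    ring
  · rw [integral_add h1 h2, integral_const_mul, h4]
    simp only [mul_zero, pow_zero, one_mul, ← mul_assoc] at h3
    rw [h3, show (-((0 : ℕ) + (a + 1) + 1) : ℝ) = -(a + 1) - 1 by push_cast; ring,
      Real.rpow_sub_one hB.ne']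
    field_simp
    ring

theorem integrable_sq_gaussian_mul_dunklExp {a B : ℝ} (ha : -1 / 2 ≤ a) (hB : 0 < B) (x : ℝ) :
    Integrable (fun v => v ^ 2 * (Real.exp (-B * v ^ 2) * dunklExp a (x * v))) (powMeasure a) := by
  refine ((integrable_gaussian_mul_besselSeries ha hB x 1).add
    ((integrable_cube_gaussian_mul_succ ha hB x).const_mul (x / 2))).congr (ae_of_all _ fun v => ?_)
  simp only [dunklExp, Pi.add_apply]
  ring

theorem integral_sq_gaussian_mul_dunklExp {a B : ℝ} (ha : -1 / 2 ≤ a) (hB : 0 < B) (x : ℝ) :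
    ∫ v, v ^ 2 * (Real.exp (-B * v ^ 2) * dunklExp a (x * v)) ∂powMeasure a =
      (x ^ 2 / (4 * B) + (a + 1)) / B * (B ^ (-(a + 1)) * Real.exp (x ^ 2 / (4 * B))) := by
  have h1 := integrable_gaussian_mul_besselSeries ha hB x 1
  have h2 := (integrable_cube_gaussian_mul_succ ha hB x).const_mul (x / 2)
  have h3 := integral_gaussian_mul_besselSeries ha hB x 1
  rw [momentPoly_one ha] at h3
  have h4 := integral_odd_powMeasure a
    (f := fun v => v ^ 3 * Real.exp (-B * v ^ 2) * besselSeries (a + 1) (x * v))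
    fun v => by rw [mul_neg, besselSeries_neg]; ring_nf
  trans ∫ v, (v ^ (2 * 1) * Real.exp (-B * v ^ 2) * besselSeries a (x * v) +
    x / 2 * (v ^ 3 * Real.exp (-B * v ^ 2) * besselSeries (a + 1) (x * v))) ∂powMeasure a
  · refine integral_congr_ae (ae_of_all _ fun v => ?_)
    simp only [dunklExp]
    ring
  · rw [integral_add h1 h2, integral_const_mul, h3, h4,
      show (-((1 : ℕ) + a + 1) : ℝ) = -(a + 1) - 1 by push_cast; ring, Real.rpow_sub_one hB.ne']
    field_simp
    ring

end

section
/-! ### The one-dimensional Mehler kernel -/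

/-- The Mehler kernel of the one-dimensional Dunkl harmonic oscillator at time `s / 2`. -/
def mehler (a s u v : ℝ) : ℝ :=
  (2 * Real.sinh s) ^ (-(a + 1)) *
    Real.exp (-(Real.cosh s / (2 * Real.sinh s)) * (u ^ 2 + v ^ 2)) *
    dunklExp a (u * v / Real.sinh s)

theorem mehler_comm (a s u v : ℝ) : mehler a s u v = mehler a s v u := by
  rw [mehler, mehler, mul_comm u v, add_comm (u ^ 2)]

theorem mehler_nonneg {a s : ℝ} (ha : -1 / 2 ≤ a) (hs : 0 < s) (u v : ℝ) :
    0 ≤ mehler a s u v := by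
  have := dunklExp_nonneg ha (u * v / Real.sinh s)
  have := Real.sinh_pos_iff.2 hs
  unfold mehler
  positivity

theorem continuous_mehler {a : ℝ} (ha : -1 / 2 ≤ a) (s : ℝ) :
    Continuous fun p : ℝ × ℝ => mehler a s p.1 p.2 := by
  have := continuous_dunklExp ha
  unfold mehler
  fun_prop

theorem mehler_eq (a s u v : ℝ) :
    mehler a s u v = (2 * Real.sinh s) ^ (-(a + 1)) *
      Real.exp (-(Real.cosh s / (2 * Real.sinh s)) * u ^ 2) *
      (Real.exp (-(Real.cosh s / (2 * Real.sinh s)) * v ^ 2) *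
        dunklExp a (u / Real.sinh s * v)) := by
  rw [mehler, mul_add, Real.exp_add, div_mul_eq_mul_div]
  ring

theorem coth_half_pos {s : ℝ} (hs : 0 < s) : 0 < Real.cosh s / (2 * Real.sinh s) := by
  have := Real.sinh_pos_iff.2 hs
  have := Real.cosh_pos s
  positivity

theorem coth_half_rpow {a s : ℝ} (hs : 0 < s) :
    (2 * Real.sinh s) ^ (-(a + 1)) * (Real.cosh s / (2 * Real.sinh s)) ^ (-(a + 1)) =
      Real.cosh s ^ (-(a + 1)) := by
  have h1 := Real.sinh_pos_iff.2 hs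
  have h2 := Real.cosh_pos s
  rw [← Real.mul_rpow (by positivity) (by positivity), mul_div_cancel₀ _ (by positivity)]

/-- This is `1 / (sinh s cosh s) = coth s - tanh s`. The `coth` part cancels the Gaussian in front
of the kernel, and the `tanh` part is the decay left in the total mass. -/
theorem coth_half_exponent {s : ℝ} (hs : 0 < s) (x : ℝ) :
    (x / Real.sinh s) ^ 2 / (4 * (Real.cosh s / (2 * Real.sinh s))) =
      Real.cosh s / (2 * Real.sinh s) * x ^ 2 -
        Real.sinh s / (2 * Real.cosh s) * x ^ 2 := by
  have h1 := (Real.sinh_pos_iff.2 hs).ne'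
  have h2 := (Real.cosh_pos s).ne'
  have h3 := Real.cosh_sq s
  field_simp
  rw [h3]; ring

/-- The total mass of the Mehler kernel. -/
def mehlerMass (a s u : ℝ) : ℝ :=
  Real.cosh s ^ (-(a + 1)) * Real.exp (-(Real.sinh s / (2 * Real.cosh s)) * u ^ 2)

theorem mehlerMass_eq {a s : ℝ} (hs : 0 < s) (u : ℝ) :
    (2 * Real.sinh s) ^ (-(a + 1)) * Real.exp (-(Real.cosh s / (2 * Real.sinh s)) * u ^ 2) *
      ((Real.cosh s / (2 * Real.sinh s)) ^ (-(a + 1)) *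
        Real.exp ((u / Real.sinh s) ^ 2 / (4 * (Real.cosh s / (2 * Real.sinh s))))) =
      mehlerMass a s u := by
  rw [mehlerMass, coth_half_exponent hs, ← coth_half_rpow hs, mul_mul_mul_comm, ← Real.exp_add]
  congr 2
  ring

theorem mehlerMass_le {a s : ℝ} (hs : 0 < s) (u : ℝ) :
    mehlerMass a s u ≤ Real.cosh s ^ (-(a + 1)) := by
  have h1 := Real.sinh_pos_iff.2 hs
  have h2 := Real.cosh_pos s
  refine mul_le_of_le_one_right (by positivity) (Real.exp_le_one_iff.2 ?_)
  have : 0 ≤ Real.sinh s / (2 * Real.cosh s) * u ^ 2 := by positivity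
  linarith

theorem cosh_rpow_le_one {a : ℝ} (ha : -1 / 2 ≤ a) (s : ℝ) : Real.cosh s ^ (-(a + 1)) ≤ 1 :=
  Real.rpow_le_one_of_one_le_of_nonpos (Real.one_le_cosh s) (by linarith)

theorem integrable_mehler {a s : ℝ} (ha : -1 / 2 ≤ a) (hs : 0 < s) (u : ℝ) :
    Integrable (fun v => mehler a s u v) (powMeasure a) := by
  simp only [mehler_eq]
  exact (integrable_gaussian_mul_dunklExp ha (coth_half_pos hs) _).const_mul _

theorem integral_mehler {a s : ℝ} (ha : -1 / 2 ≤ a) (hs : 0 < s) (u : ℝ) :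
    ∫ v, mehler a s u v ∂powMeasure a = mehlerMass a s u := by
  simp only [mehler_eq]
  rw [integral_const_mul, integral_gaussian_mul_dunklExp ha (coth_half_pos hs), mehlerMass_eq hs]

theorem integral_mehler_le_one {a s : ℝ} (ha : -1 / 2 ≤ a) (hs : 0 < s) (u : ℝ) :
    ∫ v, mehler a s u v ∂powMeasure a ≤ 1 :=
  (integral_mehler ha hs u).trans_le ((mehlerMass_le hs u).trans (cosh_rpow_le_one ha s))

theorem integrable_sq_sub_mul_mehler {a s : ℝ} (ha : -1 / 2 ≤ a) (hs : 0 < s) (u : ℝ) :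
    Integrable (fun v => (u - v) ^ 2 * mehler a s u v) (powMeasure a) := by
  have hB := coth_half_pos hs
  have h0 := integrable_gaussian_mul_dunklExp ha hB (u / Real.sinh s)
  have h1 := integrable_mul_gaussian_mul_dunklExp ha hB (u / Real.sinh s)
  have h2 := integrable_sq_gaussian_mul_dunklExp ha hB (u / Real.sinh s)
  refine ((((h0.const_mul (u ^ 2)).sub (h1.const_mul (2 * u))).add h2).const_mul
    ((2 * Real.sinh s) ^ (-(a + 1)) *
      Real.exp (-(Real.cosh s / (2 * Real.sinh s)) * u ^ 2))).congr (ae_of_all _ fun v => ?_)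
  simp only [mehler_eq, Pi.add_apply, Pi.sub_apply]
  ring

/-- Relative to the total mass, `v` has mean `u / cosh s` and variance `2 (a + 1) tanh s`; the two
summands are the squared drift and the variance. -/
theorem integral_sq_sub_mul_mehler {a s : ℝ} (ha : -1 / 2 ≤ a) (hs : 0 < s) (u : ℝ) :
    ∫ v, (u - v) ^ 2 * mehler a s u v ∂powMeasure a =
      (u ^ 2 * (1 - 1 / Real.cosh s) ^ 2 + 2 * (a + 1) * (Real.sinh s / Real.cosh s)) *
        mehlerMass a s u := by
  have hB := coth_half_pos hs
  have h0 := integrable_gaussian_mul_dunklExp ha hB (u / Real.sinh s)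
  have h1 := integrable_mul_gaussian_mul_dunklExp ha hB (u / Real.sinh s)
  have h2 := integrable_sq_gaussian_mul_dunklExp ha hB (u / Real.sinh s)
  have hS := (Real.sinh_pos_iff.2 hs).ne'
  have hC := (Real.cosh_pos s).ne'
  trans ∫ v, (2 * Real.sinh s) ^ (-(a + 1)) *
      Real.exp (-(Real.cosh s / (2 * Real.sinh s)) * u ^ 2) *
      ((u ^ 2 * (Real.exp (-(Real.cosh s / (2 * Real.sinh s)) * v ^ 2) *
        dunklExp a (u / Real.sinh s * v)) - 2 * u * (v *
        (Real.exp (-(Real.cosh s / (2 * Real.sinh s)) * v ^ 2) *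
        dunklExp a (u / Real.sinh s * v)))) + v ^ 2 *
        (Real.exp (-(Real.cosh s / (2 * Real.sinh s)) * v ^ 2) *
        dunklExp a (u / Real.sinh s * v))) ∂powMeasure a
  · refine integral_congr_ae (ae_of_all _ fun v => ?_)
    simp only [mehler_eq]
    ring
  · have h3 : Integrable (fun v =>
        u ^ 2 * (Real.exp (-(Real.cosh s / (2 * Real.sinh s)) * v ^ 2) *
        dunklExp a (u / Real.sinh s * v)) - 2 * u * (v *
        (Real.exp (-(Real.cosh s / (2 * Real.sinh s)) * v ^ 2) *
        dunklExp a (u / Real.sinh s * v)))) (powMeasure a) :=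
      (h0.const_mul _).sub (h1.const_mul _)
    rw [integral_const_mul, integral_add h3 h2,
      integral_sub (h0.const_mul _) (h1.const_mul _), integral_const_mul, integral_const_mul,
      integral_gaussian_mul_dunklExp ha hB, integral_mul_gaussian_mul_dunklExp ha hB,
      integral_sq_gaussian_mul_dunklExp ha hB, ← mehlerMass_eq hs]
    field_simp
    ring

/-- The drift `u (1 - 1 / cosh s)` is unbounded in `u`, but the mass decays like `exp(-(tanh s) u² /
2)`, so `tanh s * u²` times the mass is at most `2`. Together with `1 - 1 / cosh s ≤ tanh² s` and
`tanh s ≤ 1`, both the drift and the variance are of order `tanh s`, which is at most `2 * s`. -/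
theorem integral_sq_sub_mul_mehler_le {a s : ℝ} (ha : -1 / 2 ≤ a) (hs : 0 < s) (u : ℝ) :
    ∫ v, (u - v) ^ 2 * mehler a s u v ∂powMeasure a ≤ (2 * a + 4) * (2 * s) := by
  rw [integral_sq_sub_mul_mehler ha hs]
  have hS := Real.sinh_pos_iff.2 hs
  have hC := Real.cosh_pos s
  have hC1 := Real.one_le_cosh s
  set T := Real.sinh s / Real.cosh s with hT
  have hT0 : 0 < T := by positivity
  have hTs : T ≤ 2 * s := by
    rw [hT, div_le_iff₀ hC, Real.sinh_eq, Real.cosh_eq]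
    have h1 := Real.add_one_le_exp (-(2 * s))
    have h2 : Real.exp (-s) = Real.exp (-(2 * s)) * Real.exp s := by
      rw [← Real.exp_add]; ring_nf
    have h3 : (-(2 * s) + 1) * Real.exp s ≤ Real.exp (-s) := by rw [h2]; gcongr
    have h4 : 0 ≤ s * Real.exp (-s) := by positivity
    linarith
  have hT2 : T ^ 2 = (1 - 1 / Real.cosh s) * (1 + 1 / Real.cosh s) := by
    rw [hT, div_pow, Real.sinh_sq]
    field_simp
    ring
  have hq : 0 ≤ 1 - 1 / Real.cosh s := by
    rw [sub_nonneg, div_le_one hC]; exact hC1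
  have hq1 : 1 - 1 / Real.cosh s ≤ T ^ 2 := by
    rw [hT2]
    exact le_mul_of_one_le_right hq (by linarith [one_div_pos.2 hC])
  have hT1 : T ≤ 1 := by
    rw [hT, div_le_one hC]; exact (Real.sinh_lt_cosh s).le
  have hM0 : 0 ≤ mehlerMass a s u := by unfold mehlerMass; positivity
  have hM1 : mehlerMass a s u ≤ 1 := (mehlerMass_le hs u).trans (cosh_rpow_le_one ha s)
  have hM2 : T * u ^ 2 * mehlerMass a s u ≤ 2 := by
    have h1 : mehlerMass a s u ≤ Real.exp (-(T / 2 * u ^ 2)) := by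
      rw [mehlerMass, hT]
      refine (mul_le_of_le_one_left (Real.exp_pos _).le (cosh_rpow_le_one ha s)).trans_eq ?_
      congr 1
      field_simp
    have h2 := Real.add_one_le_exp (T / 2 * u ^ 2)
    have h3 : T / 2 * u ^ 2 * Real.exp (-(T / 2 * u ^ 2)) ≤ 1 := by
      rw [Real.exp_neg, ← div_eq_mul_inv, div_le_one (Real.exp_pos _)]
      linarith
    have h4 : T * u ^ 2 * mehlerMass a s u ≤ T * u ^ 2 * Real.exp (-(T / 2 * u ^ 2)) := by gcongr
    linarith
  have h5 : u ^ 2 * (1 - 1 / Real.cosh s) ^ 2 * mehlerMass a s u ≤ 2 * T := by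
    have h6 : (1 - 1 / Real.cosh s) ^ 2 ≤ T ^ 2 := by
      have : T ^ 2 * T ^ 2 ≤ T ^ 2 * 1 := by gcongr; nlinarith
      calc _ ≤ (T ^ 2) ^ 2 := by gcongr
        _ ≤ _ := by nlinarith
    calc _ ≤ u ^ 2 * T ^ 2 * mehlerMass a s u := by gcongr
      _ = T * (T * u ^ 2 * mehlerMass a s u) := by ring
      _ ≤ T * 2 := by gcongr
      _ = _ := by ring
  have h7 : 2 * (a + 1) * T * mehlerMass a s u ≤ 2 * (a + 1) * T :=
    mul_le_of_le_one_right (by have : 0 ≤ a + 1 := by linarith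
                               positivity) hM1
  calc _ ≤ 2 * T + 2 * (a + 1) * T := by linarith
    _ = (2 * a + 4) * T := by ring
    _ ≤ _ := mul_le_mul_of_nonneg_left hTs (by linarith)

/-! ### Regularity of the Mehler kernel -/

theorem abs_exp_sub_exp_le (x y : ℝ) :
    |Real.exp x - Real.exp y| ≤ |x - y| * (Real.exp x + Real.exp y) := by
  wlog h : y ≤ x generalizing x y
  · rw [abs_sub_comm, abs_sub_comm x y, add_comm]
    exact this y x (le_of_not_ge h)
  rw [abs_of_nonneg (sub_nonneg.2 (Real.exp_le_exp.2 h)), abs_of_nonneg (sub_nonneg.2 h)]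
  have h1 := Real.add_one_le_exp (y - x)
  have h2 : Real.exp y = Real.exp (y - x) * Real.exp x := by rw [← Real.exp_add]; ring_nf
  have h3 := Real.exp_pos x
  have h4 : (y - x + 1) * Real.exp x ≤ Real.exp y := by rw [h2]; gcongr
  nlinarith [mul_nonneg (sub_nonneg.2 h) (Real.exp_pos y).le]

theorem mul_abs_le_exp_add_exp (k y : ℝ) :
    k * |y| ≤ Real.exp (k * y) + Real.exp (-(k * y)) := by
  have h1 := Real.add_one_le_exp (k * y)
  have h2 := Real.add_one_le_exp (-(k * y))
  have h3 := Real.exp_pos (k * y)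
  have h4 := Real.exp_pos (-(k * y))
  rcases abs_cases y with ⟨h, _⟩ | ⟨h, _⟩ <;> rw [h] <;> linarith

/-- Under the Laplace representation the difference is one of exponentials whose exponents differ by
`(u - u') * Y` up to sign. The factor `κ * |Y|` is traded for `exp (κ Y) + exp (-κ Y)`, and
multiplying by these only shifts the argument by `∓κ`. The majorant is again Gaussian times Dunkl
kernel, hence explicitly integrable. -/
theorem abs_gaussian_dunklExp_sub_le {a : ℝ} (ha : -1 / 2 ≤ a) {c κ : ℝ} (hκ : 0 < κ) (S u u' v : ℝ) :
    |Real.exp (-c * u ^ 2) * dunklExp a (u / S * v) -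
        Real.exp (-c * u' ^ 2) * dunklExp a (u' / S * v)| ≤
      |u - u'| / κ *
        ((Real.exp (κ * c * (u + u') - c * u ^ 2) * dunklExp a ((u - κ) / S * v) +
          Real.exp (κ * c * (u + u') - c * u' ^ 2) * dunklExp a ((u' - κ) / S * v)) +
        (Real.exp (-(κ * c * (u + u')) - c * u ^ 2) * dunklExp a ((u + κ) / S * v) +
          Real.exp (-(κ * c * (u + u')) - c * u' ^ 2) * dunklExp a ((u' + κ) / S * v))) := by
  obtain ⟨μ, hfin, hμ, h⟩ := exists_measure_dunklExp_eq_integral ha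
  have hi : ∀ x y : ℝ, Integrable (fun s => Real.exp x * Real.exp (y * s)) μ := fun x y =>
    integrable_pow_of_compact hμ (by fun_prop)
  have hi2 : ∀ x y x' y' : ℝ, Integrable
      (fun s => Real.exp x * Real.exp (y * s) + Real.exp x' * Real.exp (y' * s)) μ :=
    fun _ _ _ _ => (hi _ _).add (hi _ _)
  have hm : ∀ x y : ℝ, Real.exp x * dunklExp a y = ∫ s, Real.exp x * Real.exp (y * s) ∂μ :=
    fun x y => by rw [integral_const_mul, h]
  simp only [hm]
  rw [← integral_sub (hi _ _) (hi _ _), ← integral_add (hi _ _) (hi _ _),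
    ← integral_add (hi _ _) (hi _ _), ← integral_add (hi2 _ _ _ _) (hi2 _ _ _ _),
    ← integral_const_mul]
  refine (abs_integral_le_integral_abs).trans
    (integral_mono ((hi _ _).sub (hi _ _)).abs
      ((((hi _ _).add (hi _ _)).add ((hi _ _).add (hi _ _))).const_mul _) fun s => ?_)
  simp only [← Real.exp_add]
  have h1 := abs_exp_sub_exp_le (-c * u ^ 2 + u / S * v * s) (-c * u' ^ 2 + u' / S * v * s)
  refine h1.trans ?_
  set Y := c * (u + u') - v * s / S with hY
  have h2 : -c * u ^ 2 + u / S * v * s - (-c * u' ^ 2 + u' / S * v * s) = -((u - u') * Y) := by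
    rw [hY]; ring
  have h3 := mul_abs_le_exp_add_exp κ Y
  rw [h2, abs_neg, abs_mul, mul_assoc |u - u'| |Y|, div_mul_eq_mul_div |u - u'| κ, mul_div_assoc |u - u'|]
  refine mul_le_mul_of_nonneg_left ?_ (abs_nonneg (u - u'))
  rw [le_div_iff₀ hκ]
  have he : 0 ≤ Real.exp (-c * u ^ 2 + u / S * v * s) + Real.exp (-c * u' ^ 2 + u' / S * v * s) := by
    positivity
  calc _ = κ * |Y| * (Real.exp (-c * u ^ 2 + u / S * v * s) +
        Real.exp (-c * u' ^ 2 + u' / S * v * s)) := by ring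
    _ ≤ (Real.exp (κ * Y) + Real.exp (-(κ * Y))) * (Real.exp (-c * u ^ 2 + u / S * v * s) +
        Real.exp (-c * u' ^ 2 + u' / S * v * s)) := by gcongr
    _ = _ := by
      rw [add_mul, mul_add, mul_add, ← Real.exp_add, ← Real.exp_add, ← Real.exp_add,
        ← Real.exp_add, hY]
      congr 3 <;> ring

/-- With `κ² = tanh s` one has `c κ² = 1 / 2`. Completing squares leaves an exponent of at most `e κ
c (u + u' - 2w) + c κ²`, where `|u + u' - 2w| = |u - u'| ≤ κ`. It is thus at most `1`, and `exp 1 ≤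
3`. -/
theorem integral_shifted_le {a s : ℝ} (ha : -1 / 2 ≤ a) (hs : 0 < s) {κ e : ℝ}
    (hκ2 : κ ^ 2 = Real.sinh s / Real.cosh s) (he : e ^ 2 = 1) {u u' w : ℝ} (hu : |u - u'| ≤ κ)
    (hw : w = u ∨ w = u') :
    (2 * Real.sinh s) ^ (-(a + 1)) * ∫ v,
      Real.exp (-(Real.cosh s / (2 * Real.sinh s)) * v ^ 2) *
      (Real.exp (e * (κ * (Real.cosh s / (2 * Real.sinh s)) * (u + u')) -
        Real.cosh s / (2 * Real.sinh s) * w ^ 2) *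
        dunklExp a ((w - e * κ) / Real.sinh s * v)) ∂powMeasure a ≤
      Real.cosh s ^ (-(a + 1)) * 3 := by
  have hB := coth_half_pos hs
  have hS := Real.sinh_pos_iff.2 hs
  have hC := Real.cosh_pos s
  have hκ : 0 ≤ κ := (abs_nonneg _).trans hu
  set c := Real.cosh s / (2 * Real.sinh s) with hc
  have hcκ : c * κ ^ 2 = 1 / 2 := by rw [hκ2, hc]; field_simp
  have h1 : ∀ v, Real.exp (-c * v ^ 2) * (Real.exp (e * (κ * c * (u + u')) - c * w ^ 2) *
        dunklExp a ((w - e * κ) / Real.sinh s * v)) =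
      Real.exp (e * (κ * c * (u + u')) - c * w ^ 2) * (Real.exp (-c * v ^ 2) *
        dunklExp a ((w - e * κ) / Real.sinh s * v)) := fun v => by ring
  simp only [h1]
  rw [integral_const_mul, integral_gaussian_mul_dunklExp ha hB, hc, coth_half_exponent hs,
    ← coth_half_rpow (a := a) hs, ← hc]
  have h2 : e * (κ * c * (u + u')) - c * w ^ 2 + (c * (w - e * κ) ^ 2 -
      Real.sinh s / (2 * Real.cosh s) * (w - e * κ) ^ 2) ≤ 1 := by
    have h3 : 0 ≤ Real.sinh s / (2 * Real.cosh s) * (w - e * κ) ^ 2 := by positivity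
    have h4 : e * (κ * c * (u + u')) - c * w ^ 2 + c * (w - e * κ) ^ 2 =
        e * (κ * c * (u + u' - 2 * w)) + c * κ ^ 2 * e ^ 2 := by ring
    have h5 : |e * (κ * c * (u + u' - 2 * w))| ≤ 1 / 2 := by
      have he1 : |e| = 1 := by
        rw [← sq_abs] at he
        nlinarith [abs_nonneg e]
      have h6 : |u + u' - 2 * w| ≤ κ := by
        rcases hw with rfl | rfl
        · rw [abs_sub_comm] at hu
          convert hu using 2; ring
        · convert hu using 2; ring
      rw [abs_mul, he1, one_mul, abs_mul, abs_of_nonneg (by positivity : 0 ≤ κ * c)]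
      calc κ * c * |u + u' - 2 * w| ≤ κ * c * κ := by gcongr
        _ = 1 / 2 := by rw [← hcκ]; ring
    have := le_abs_self (e * (κ * c * (u + u' - 2 * w)))
    rw [he, hcκ] at h4
    linarith
  have h7 : Real.exp (e * (κ * c * (u + u')) - c * w ^ 2) * Real.exp (c * (w - e * κ) ^ 2 -
      Real.sinh s / (2 * Real.cosh s) * (w - e * κ) ^ 2) ≤ 3 := by
    rw [← Real.exp_add]
    exact (Real.exp_le_exp.2 h2).trans (Real.exp_one_lt_d9.le.trans (by norm_num))
  calc _ = (2 * Real.sinh s) ^ (-(a + 1)) * c ^ (-(a + 1)) *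
      (Real.exp (e * (κ * c * (u + u')) - c * w ^ 2) * Real.exp (c * (w - e * κ) ^ 2 -
      Real.sinh s / (2 * Real.cosh s) * (w - e * κ) ^ 2)) := by ring
    _ ≤ _ := by gcongr

/-- The natural scale is `κ = √(tanh s)`. Below it the shifted kernels apply: four terms of size `3`
give the constant `12`. The passage from `κ` to `√s` uses `a + 1 ≥ 1/2`, so that the mass
contributes `cosh^(-1/2)`, and `√(cosh s) * κ = √(sinh s) ≥ √s`. -/
theorem integral_abs_mehler_sub_le {a s : ℝ} (ha : -1 / 2 ≤ a) (hs : 0 < s) (u u' : ℝ) :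
    ∫ v, |mehler a s u v - mehler a s u' v| ∂powMeasure a ≤ 12 * |u - u'| / √s := by
  have hB := coth_half_pos hs
  have hS := Real.sinh_pos_iff.2 hs
  have hC := Real.cosh_pos s
  have hC1 := Real.one_le_cosh s
  set κ := √(Real.sinh s / Real.cosh s) with hκ
  have hκ0 : 0 < κ := Real.sqrt_pos.2 (by positivity)
  have hκ2 : κ ^ 2 = Real.sinh s / Real.cosh s := Real.sq_sqrt (by positivity)
  have hfinal : Real.cosh s ^ (-(a + 1)) / κ ≤ 1 / √s := by
    have h1 : Real.cosh s ^ (-(a + 1)) ≤ Real.cosh s ^ (-(1 / 2) : ℝ) :=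
      Real.rpow_le_rpow_of_exponent_le hC1 (by linarith)
    have h2 : Real.cosh s ^ (-(1 / 2) : ℝ) = 1 / √(Real.cosh s) := by
      rw [Real.rpow_neg hC.le, Real.sqrt_eq_rpow, one_div, one_div]
    have h3 : √s ≤ √(Real.cosh s) * κ := by
      rw [hκ, ← Real.sqrt_mul hC.le, mul_div_cancel₀ _ hC.ne']
      exact Real.sqrt_le_sqrt (Real.self_le_sinh_iff.2 hs.le)
    have hs0 : 0 < √s := Real.sqrt_pos.2 hs
    have hC0 : 0 < √(Real.cosh s) := Real.sqrt_pos.2 hC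
    calc _ ≤ 1 / √(Real.cosh s) / κ := by rw [← h2]; gcongr
      _ = 1 / (√(Real.cosh s) * κ) := by rw [div_div]
      _ ≤ _ := by gcongr
  have hint : Integrable (fun v => |mehler a s u v - mehler a s u' v|) (powMeasure a) :=
    ((integrable_mehler ha hs u).sub (integrable_mehler ha hs u')).abs
  suffices h : ∫ v, |mehler a s u v - mehler a s u' v| ∂powMeasure a ≤
      12 * |u - u'| * (Real.cosh s ^ (-(a + 1)) / κ) by
    have h1 := mul_le_mul_of_nonneg_left hfinal (by positivity : 0 ≤ 12 * |u - u'|)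
    rw [mul_one_div] at h1
    exact h.trans h1
  rcases le_or_gt |u - u'| κ with hle | hgt
  · set c := Real.cosh s / (2 * Real.sinh s) with hc
    let g : ℝ → ℝ → ℝ → ℝ := fun e w v => Real.exp (-c * v ^ 2) *
      (Real.exp (e * (κ * c * (u + u')) - c * w ^ 2) *
        dunklExp a ((w - e * κ) / Real.sinh s * v))
    have hgi : ∀ e w, Integrable (g e w) (powMeasure a) := fun e w => by
      refine ((integrable_gaussian_mul_dunklExp ha hB ((w - e * κ) / Real.sinh s)).const_mul
        (Real.exp (e * (κ * c * (u + u')) - c * w ^ 2))).congr (ae_of_all _ fun v => ?_)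
      simp only [g]
      ring
    have hA : 0 ≤ (2 * Real.sinh s) ^ (-(a + 1)) := by positivity
    have hpt : ∀ v, |mehler a s u v - mehler a s u' v| ≤ |u - u'| / κ *
        ((2 * Real.sinh s) ^ (-(a + 1)) *
          ((g 1 u v + g 1 u' v) + (g (-1) u v + g (-1) u' v))) := fun v => by
      have h1 := abs_gaussian_dunklExp_sub_le ha (c := c) hκ0 (Real.sinh s) u u' v
      have h2 : mehler a s u v - mehler a s u' v = (2 * Real.sinh s) ^ (-(a + 1)) *
          Real.exp (-c * v ^ 2) * (Real.exp (-c * u ^ 2) * dunklExp a (u / Real.sinh s * v) -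
        Real.exp (-c * u' ^ 2) * dunklExp a (u' / Real.sinh s * v)) := by
        rw [mehler_eq, mehler_eq]; ring
      rw [h2, abs_mul, abs_of_nonneg (by positivity)]
      refine (mul_le_mul_of_nonneg_left h1 (by positivity)).trans_eq ?_
      simp only [g, one_mul, sub_neg_eq_add, neg_mul]
      ring
    refine (integral_mono hint ((((hgi _ _).add (hgi _ _)).add
      ((hgi _ _).add (hgi _ _))).const_mul _ |>.const_mul _) hpt).trans ?_
    simp only [Pi.add_apply]
    have hg2 : ∀ e w e' w', Integrable (fun v => g e w v + g e' w' v) (powMeasure a) :=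
      fun _ _ _ _ => (hgi _ _).add (hgi _ _)
    rw [integral_const_mul, integral_const_mul, integral_add (hg2 _ _ _ _) (hg2 _ _ _ _),
      integral_add (hgi _ _) (hgi _ _), integral_add (hgi _ _) (hgi _ _)]
    have h1 := integral_shifted_le ha hs hκ2 (e := 1) (by norm_num) hle (Or.inl rfl)
    have h2 := integral_shifted_le ha hs hκ2 (e := 1) (by norm_num) hle (Or.inr rfl)
    have h3 := integral_shifted_le ha hs hκ2 (e := -1) (by norm_num) hle (Or.inl rfl)
    have h4 := integral_shifted_le ha hs hκ2 (e := -1) (by norm_num) hle (Or.inr rfl)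
    calc _ ≤ |u - u'| / κ * (12 * Real.cosh s ^ (-(a + 1))) := by
          refine mul_le_mul_of_nonneg_left ?_ (by positivity : 0 ≤ |u - u'| / κ)
          rw [mul_add, mul_add, mul_add]
          linarith
      _ = _ := by ring
  -- Beyond the scale `κ` nothing is gained from the difference: twice the total mass suffices
  -- because `|u - u'| / κ ≥ 1`.
  · have h1 : ∫ v, |mehler a s u v - mehler a s u' v| ∂powMeasure a ≤
        2 * Real.cosh s ^ (-(a + 1)) := by
      refine (integral_mono hint ((integrable_mehler ha hs u).add (integrable_mehler ha hs u'))
        fun v => ?_).trans ?_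
      · refine (abs_sub _ _).trans_eq ?_
        rw [abs_of_nonneg (mehler_nonneg ha hs _ _), abs_of_nonneg (mehler_nonneg ha hs _ _)]
        rfl
      · rw [integral_add' (integrable_mehler ha hs u) (integrable_mehler ha hs u'),
          integral_mehler ha hs, integral_mehler ha hs]
        linarith [mehlerMass_le (a := a) hs u, mehlerMass_le (a := a) hs u']
    refine h1.trans ?_
    have h2 : 1 ≤ |u - u'| / κ := by rw [one_le_div hκ0]; exact hgt.le
    have h3 : 0 ≤ Real.cosh s ^ (-(a + 1)) := by positivity
    calc _ ≤ 12 * (|u - u'| / κ) * Real.cosh s ^ (-(a + 1)) := by gcongr; linarith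
      _ = _ := by ring

end

section
/-! ### Laguerre polynomials against Gaussians -/

/-- Choosing an `i`-set inside a `k`-set amounts to choosing the `i`-set first; the remaining sum is
the binomial theorem. -/
theorem sum_choose_mul_choose_mul_pow {m i : ℕ} (hi : i ≤ m) (z : ℝ) :
    ∑ k ∈ Finset.range (m + 1), (m.choose k : ℝ) * k.choose i * z ^ k =
      m.choose i * z ^ i * (1 + z) ^ (m - i) := by
  rw [Finset.range_eq_Ico, ← Finset.sum_Ico_consecutive _ (Nat.zero_le i) (by omega : i ≤ m + 1)]
  have h0 : ∑ k ∈ Finset.Ico 0 i, (m.choose k : ℝ) * k.choose i * z ^ k = 0 :=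
    Finset.sum_eq_zero fun k hk => by
      rw [Nat.choose_eq_zero_of_lt (Finset.mem_Ico.1 hk).2]; simp
  rw [h0, zero_add, Finset.sum_Ico_eq_sum_range, show m + 1 - i = m - i + 1 by omega, add_comm 1 z,
    add_pow, Finset.mul_sum]
  refine Finset.sum_congr rfl fun j hj => ?_
  have hj' : j ≤ m - i := Nat.lt_succ_iff.1 (Finset.mem_range.1 hj)
  have h1 : m.choose (i + j) * (i + j).choose i = m.choose i * (m - i).choose j := by
    rw [Nat.choose_mul (by omega), Nat.add_sub_cancel_left]
  have h2 : (m.choose (i + j) : ℝ) * (i + j).choose i = m.choose i * (m - i).choose j := by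
    exact_mod_cast h1
  rw [h2, one_pow, pow_add]
  ring

theorem laguerre_eq_choose (a : ℝ) (m : ℕ) (x : ℝ) :
    laguerre a m x = Real.Gamma (m + a + 1) / m.factorial *
      ∑ k ∈ Finset.range (m + 1), (m.choose k : ℝ) * ((-x) ^ k / Real.Gamma (k + a + 1)) := by
  rw [laguerre, Finset.mul_sum]
  refine Finset.sum_congr rfl fun k hk => ?_
  have hk' : k ≤ m := Nat.lt_succ_iff.1 (Finset.mem_range.1 hk)
  rw [Nat.cast_choose ℝ hk']
  field_simp

/-- The binomial transform of `momentPoly` is a Laguerre sum. -/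
theorem sum_choose_mul_momentPoly {a : ℝ} (ha : -1 / 2 ≤ a) (m : ℕ) (z X : ℝ) :
    ∑ k ∈ Finset.range (m + 1), (m.choose k : ℝ) * (z ^ k / Real.Gamma (k + a + 1)) *
      momentPoly a k X =
    ∑ i ∈ Finset.range (m + 1), (m.choose i : ℝ) *
      ((z * X) ^ i / Real.Gamma (i + a + 1)) * (1 + z) ^ (m - i) := by
  have hG : ∀ k : ℕ, Real.Gamma (k + a + 1) ≠ 0 := fun k =>
    (Real.Gamma_pos_of_pos (by linarith [k.cast_nonneg (α := ℝ)])).ne'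
  have h1 : ∀ k ∈ Finset.range (m + 1), (m.choose k : ℝ) * (z ^ k / Real.Gamma (k + a + 1)) *
      momentPoly a k X = ∑ i ∈ Finset.range (m + 1), (X ^ i / Real.Gamma (i + a + 1)) *
        ((m.choose k : ℝ) * k.choose i * z ^ k) := fun k hk => by
    have h2 : momentPoly a k X = ∑ i ∈ Finset.range (m + 1), (k.choose i : ℝ) *
        (Real.Gamma (k + a + 1) / Real.Gamma (i + a + 1)) * X ^ i := by
      refine Finset.sum_subset (Finset.range_mono (Finset.mem_range.1 hk)) fun i _ hi => ?_
      rw [Nat.choose_eq_zero_of_lt (by simpa using hi)]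
      simp
    rw [h2, Finset.mul_sum]
    refine Finset.sum_congr rfl fun i _ => ?_
    have := hG k
    field_simp
  rw [Finset.sum_congr rfl h1, Finset.sum_comm]
  refine Finset.sum_congr rfl fun i hi => ?_
  rw [← Finset.mul_sum, sum_choose_mul_choose_mul_pow (Nat.lt_succ_iff.1 (Finset.mem_range.1 hi)),
    mul_pow]
  ring

theorem integral_laguerre_mul_gaussian_mul_besselSeries {a B : ℝ} (ha : -1 / 2 ≤ a) (hB : 0 < B)
    (x : ℝ) (m : ℕ) :
    ∫ v, laguerre a m (v ^ 2) * (Real.exp (-B * v ^ 2) * besselSeries a (x * v)) ∂powMeasure a =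
      B ^ (-(a + 1)) * Real.exp (x ^ 2 / (4 * B)) * (Real.Gamma (m + a + 1) / m.factorial *
      ∑ k ∈ Finset.range (m + 1), (m.choose k : ℝ) *
        ((-B⁻¹) ^ k / Real.Gamma (k + a + 1)) * momentPoly a k (x ^ 2 / (4 * B))) := by
  have h1 : ∀ v : ℝ, laguerre a m (v ^ 2) * (Real.exp (-B * v ^ 2) * besselSeries a (x * v)) =
      ∑ k ∈ Finset.range (m + 1), Real.Gamma (m + a + 1) / m.factorial * (m.choose k : ℝ) *
        ((-1) ^ k / Real.Gamma (k + a + 1)) *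
        (v ^ (2 * k) * Real.exp (-B * v ^ 2) * besselSeries a (x * v)) := fun v => by
    rw [laguerre_eq_choose, Finset.mul_sum, Finset.sum_mul]
    refine Finset.sum_congr rfl fun k _ => ?_
    rw [neg_eq_neg_one_mul, mul_pow, pow_mul]
    ring
  simp only [h1]
  rw [integral_finsetSum _ fun k _ => (integrable_gaussian_mul_besselSeries ha hB x k).const_mul _]
  rw [Finset.mul_sum, Finset.mul_sum]
  refine Finset.sum_congr rfl fun k _ => ?_
  rw [integral_const_mul, integral_gaussian_mul_besselSeries ha hB,
    show -((k : ℝ) + a + 1) = -(a + 1) + -(k : ℝ) by ring, Real.rpow_add hB, Real.rpow_neg hB.le (k : ℝ),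
    Real.rpow_natCast, neg_eq_neg_one_mul B⁻¹, mul_pow, inv_pow]
  ring

/-! ### Hermite functions as eigenfunctions of the Mehler kernel -/

/-- The even part of the Mehler kernel. -/
def mehlerEven (a s u v : ℝ) : ℝ :=
  (2 * Real.sinh s) ^ (-(a + 1)) *
    Real.exp (-(Real.cosh s / (2 * Real.sinh s)) * (u ^ 2 + v ^ 2)) *
    besselSeries a (u * v / Real.sinh s)

/-- The odd part of the kernel is `u * v` times the even kernel of order `a + 1`, in parallel with
`hermite1_odd`. Eigenfunction statements therefore need proof for even indices only. -/
theorem mehler_eq_even_add_odd {s : ℝ} (hs : 0 < s) (a u v : ℝ) :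
    mehler a s u v = mehlerEven a s u v + u * v * mehlerEven (a + 1) s u v := by
  have hS := Real.sinh_pos_iff.2 hs
  rw [mehler, mehlerEven, mehlerEven, dunklExp, show -(a + 1 + 1) = -(a + 1) - 1 by ring,
    Real.rpow_sub_one (by positivity)]
  field_simp

theorem mehlerEven_neg (a s u v : ℝ) : mehlerEven a s u (-v) = mehlerEven a s u v := by
  simp only [mehlerEven, mul_neg, neg_div, besselSeries_neg, neg_sq]

theorem mehlerEven_eq (a s u v : ℝ) :
    mehlerEven a s u v = (2 * Real.sinh s) ^ (-(a + 1)) *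
      Real.exp (-(Real.cosh s / (2 * Real.sinh s)) * u ^ 2) *
      (Real.exp (-(Real.cosh s / (2 * Real.sinh s)) * v ^ 2) *
        besselSeries a (u / Real.sinh s * v)) := by
  rw [mehlerEven, mul_add, Real.exp_add, div_mul_eq_mul_div]
  ring

/-- The unnormalized even Hermite function `exp(-x²/2) L_m^a(x²)`. -/
def laguerreFun (a : ℝ) (m : ℕ) (x : ℝ) : ℝ := Real.exp (-x ^ 2 / 2) * laguerre a m (x ^ 2)

theorem laguerreFun_neg (a : ℝ) (m : ℕ) (x : ℝ) : laguerreFun a m (-x) = laguerreFun a m x := by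
  simp only [laguerreFun, neg_sq]

/-- The two Gaussians combine to rate `B = exp s / (2 sinh s)`. With `z = -1 / B` the binomial
transform has `1 + z = exp (-2s)` and `z X = -u² exp (-2s)`. Every term carries the same factor `exp
(-2s)^m`, and the Laguerre sum at `u²` reappears. -/
theorem integral_mehlerEven_mul_laguerreFun {a s : ℝ} (ha : -1 / 2 ≤ a) (hs : 0 < s) (u : ℝ)
    (m : ℕ) : ∫ v, mehlerEven a s u v * laguerreFun a m v ∂powMeasure a =
      Real.exp (-s * (2 * m + a + 1)) * laguerreFun a m u := by
  have hS := Real.sinh_pos_iff.2 hs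
  have hc := coth_half_pos hs
  have hE : Real.exp s = Real.cosh s + Real.sinh s := (Real.cosh_add_sinh s).symm
  have hE' : Real.exp (-s) = Real.cosh s - Real.sinh s := (Real.cosh_sub_sinh s).symm
  have hEp := Real.exp_pos s
  have hEE : Real.exp (-s) * Real.exp s = 1 := by rw [← Real.exp_add]; simp
  set B := Real.exp s / (2 * Real.sinh s) with hB
  have hB0 : 0 < B := by positivity
  have hBc : B = Real.cosh s / (2 * Real.sinh s) + 1 / 2 := by
    rw [hB, hE]; field_simp
  have h1 : ∀ v, mehlerEven a s u v * laguerreFun a m v = (2 * Real.sinh s) ^ (-(a + 1)) *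
      Real.exp (-(Real.cosh s / (2 * Real.sinh s)) * u ^ 2) *
      (laguerre a m (v ^ 2) * (Real.exp (-B * v ^ 2) * besselSeries a (u / Real.sinh s * v))) :=
    fun v => by
      rw [mehlerEven_eq, laguerreFun, hBc, show -(Real.cosh s / (2 * Real.sinh s) + 1 / 2) * v ^ 2 =
        -(Real.cosh s / (2 * Real.sinh s)) * v ^ 2 + -v ^ 2 / 2 by ring, Real.exp_add]
      ring
  simp only [h1]
  rw [integral_const_mul, integral_laguerre_mul_gaussian_mul_besselSeries ha hB0,
    sum_choose_mul_momentPoly ha]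
  have hz : 1 + -B⁻¹ = Real.exp (-(2 * s)) := by
    rw [show -(2 * s) = -s + -s by ring, Real.exp_add, hB, inv_div]
    have : 2 * Real.sinh s = Real.exp s - Real.exp (-s) := by rw [hE, hE']; ring
    rw [this, sub_div, div_self hEp.ne', Real.exp_neg]
    field_simp
    ring
  have hzX : -B⁻¹ * ((u / Real.sinh s) ^ 2 / (4 * B)) = -u ^ 2 * Real.exp (-(2 * s)) := by
    rw [show -(2 * s) = -s + -s by ring, Real.exp_add, hB, inv_div, Real.exp_neg]
    field_simp
    ring
  have hexp : Real.exp (-(Real.cosh s / (2 * Real.sinh s)) * u ^ 2) *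
      Real.exp ((u / Real.sinh s) ^ 2 / (4 * B)) = Real.exp (-u ^ 2 / 2) := by
    rw [← Real.exp_add]
    congr 1
    have h2 : 1 / Real.exp s = Real.cosh s - Real.sinh s := by rw [← hE', Real.exp_neg, one_div]
    have h3 : (u / Real.sinh s) ^ 2 / (4 * B) = u ^ 2 / (2 * Real.sinh s) * (1 / Real.exp s) := by
      rw [hB]; field_simp; ring
    rw [h3, h2]
    field_simp
    ring
  have hpow : (2 * Real.sinh s) ^ (-(a + 1)) * B ^ (-(a + 1)) = Real.exp (-s * (a + 1)) := by
    rw [← Real.mul_rpow (by positivity) hB0.le, hB, mul_div_cancel₀ _ (by positivity),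
      ← Real.exp_mul]
    congr 1; ring
  rw [hz, hzX]
  have hsum : ∑ i ∈ Finset.range (m + 1), (m.choose i : ℝ) *
      ((-u ^ 2 * Real.exp (-(2 * s))) ^ i / Real.Gamma (i + a + 1)) *
        Real.exp (-(2 * s)) ^ (m - i) = Real.exp (-(2 * s)) ^ m *
      ∑ i ∈ Finset.range (m + 1), (m.choose i : ℝ) * ((-u ^ 2) ^ i / Real.Gamma (i + a + 1)) := by
    rw [Finset.mul_sum]
    refine Finset.sum_congr rfl fun i hi => ?_
    have : Real.exp (-(2 * s)) ^ m = Real.exp (-(2 * s)) ^ i * Real.exp (-(2 * s)) ^ (m - i) := by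
      rw [← pow_add, Nat.add_sub_cancel' (Nat.lt_succ_iff.1 (Finset.mem_range.1 hi))]
    rw [this, mul_pow]
    ring
  rw [hsum, laguerreFun, laguerre_eq_choose, ← hexp,
    show -s * (2 * m + a + 1) = -s * (a + 1) + m * (-(2 * s)) by ring, Real.exp_add, ← hpow,
    Real.exp_nat_mul]
  ring

theorem hermite1_even (a : ℝ) (m : ℕ) (x : ℝ) :
    hermite1 a (2 * m) x =
      (-1) ^ m * √(Real.Gamma (m + 1) / Real.Gamma (m + a + 1)) * laguerreFun a m x := by
  simp only [hermite1, even_two_mul, if_true, laguerreFun]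
  rw [Nat.mul_div_cancel_left _ two_pos]
  ring

theorem hermite1_odd (a : ℝ) (m : ℕ) (x : ℝ) :
    hermite1 a (2 * m + 1) x = x * hermite1 (a + 1) (2 * m) x := by
  rw [hermite1_even]
  simp only [hermite1, show ¬ Even (2 * m + 1) by simp, if_false, laguerreFun]
  rw [show (2 * m + 1) / 2 = m by omega, show (m : ℝ) + (a + 1) + 1 = m + a + 2 by ring]
  ring

theorem mehlerEven_eq_half {s : ℝ} (hs : 0 < s) (a u v : ℝ) :
    mehlerEven a s u v = (mehler a s u v + mehler a s u (-v)) / 2 := by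
  rw [mehler_eq_even_add_odd hs, mehler_eq_even_add_odd hs, mehlerEven_neg, mehlerEven_neg]
  ring

/-- The Laplace representation gives `dunklExp a z ≤ C exp |z|`. Completing the square absorbs this
into half of the Gaussian, whence the rate `c / 2`. -/
theorem exists_mehler_le {a s : ℝ} (ha : -1 / 2 ≤ a) (hs : 0 < s) (u : ℝ) :
    ∃ M B : ℝ, 0 < B ∧ ∀ v, |mehler a s u v| ≤ M * Real.exp (-B * v ^ 2) := by
  obtain ⟨μ, hfin, hμ, h⟩ := exists_measure_dunklExp_eq_integral ha
  have hS := Real.sinh_pos_iff.2 hs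
  have hc := coth_half_pos hs
  set c := Real.cosh s / (2 * Real.sinh s) with hc'
  have hd : ∀ z, dunklExp a z ≤ μ.real Set.univ * Real.exp |z| := fun z => by
    rw [h]
    have h1 : ∀ᵐ s ∂μ, Real.exp (z * s) ≤ Real.exp |z| := by
      filter_upwards [hμ] with s hs
      rw [Real.exp_le_exp]
      calc z * s ≤ |z * s| := le_abs_self _
        _ = |z| * |s| := abs_mul _ _
        _ ≤ |z| := mul_le_of_le_one_right (abs_nonneg _) hs
    refine (integral_mono_ae (integrable_pow_of_compact hμ (by fun_prop)) (integrable_const _)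
      h1).trans_eq ?_
    rw [integral_const, smul_eq_mul]
  set x := |u / Real.sinh s| with hx
  refine ⟨(2 * Real.sinh s) ^ (-(a + 1)) * Real.exp (-c * u ^ 2) * (μ.real Set.univ *
    Real.exp (x ^ 2 / (2 * c))), c / 2, by positivity, fun v => ?_⟩
  rw [abs_of_nonneg (mehler_nonneg ha hs _ _), mehler_eq, ← hc', mul_assoc _ (μ.real _ * _)]
  refine mul_le_mul_of_nonneg_left ?_ (by positivity)
  refine (mul_le_mul_of_nonneg_left (hd _) (Real.exp_pos _).le).trans ?_
  rw [mul_left_comm, mul_assoc, ← Real.exp_add, ← Real.exp_add]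
  refine mul_le_mul_of_nonneg_left (Real.exp_le_exp.2 ?_) measureReal_nonneg
  rw [abs_mul, ← hx]
  have h1 : x * |v| ≤ x ^ 2 / (2 * c) + c / 2 * v ^ 2 := by
    have h2 : x ^ 2 / (2 * c) + c / 2 * v ^ 2 - x * |v| = (x - c * |v|) ^ 2 / (2 * c) := by
      rw [← sq_abs v]; field_simp; ring
    have : 0 ≤ (x - c * |v|) ^ 2 / (2 * c) := by positivity
    linarith
  linarith

theorem integrable_poly_mul_gaussian_pow {a B : ℝ} (ha : -1 / 2 ≤ a) (hB : 0 < B)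
    (p : Polynomial ℝ) :
    Integrable (fun v => p.eval v * Real.exp (-B * v ^ 2)) (powMeasure a) := by
  induction p using Polynomial.induction_on' with
  | add p q hp hq =>
    refine (hp.add hq).congr (ae_of_all _ fun x => ?_)
    simp [add_mul]
  | monomial k c =>
    refine ((integrable_pow_mul_gaussian ha hB k).const_mul c).congr (ae_of_all _ fun x => ?_)
    simp [mul_assoc]

theorem integrable_poly_mul_hermite1 {a : ℝ} (ha : -1 / 2 ≤ a) (b : ℝ) (p : Polynomial ℝ) (n : ℕ) :
    Integrable (fun v => p.eval v * hermite1 b n v) (powMeasure a) := by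
  obtain ⟨q, hq⟩ := hermite1_poly b n
  refine (integrable_poly_mul_gaussian_pow ha one_half_pos (p * q)).congr
    (ae_of_all _ fun v => ?_)
  simp only [hq, Polynomial.eval_mul]
  ring_nf

theorem integrable_mehler_mul_of_integrable {a s : ℝ} (ha : -1 / 2 ≤ a) (hs : 0 < s) (u : ℝ)
    {f : ℝ → ℝ} (hf : Integrable f (powMeasure a)) :
    Integrable (fun v => mehler a s u v * f v) (powMeasure a) ∧
      Integrable (fun v => mehler a s u (-v) * f v) (powMeasure a) := by
  obtain ⟨M, B, hB, hM⟩ := exists_mehler_le ha hs u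
  have hM' : ∀ v, ‖mehler a s u v‖ ≤ M := fun v => by
    have h1 := hM v
    have hM0 : 0 ≤ M := by
      have := (abs_nonneg _).trans (hM 0)
      simpa using this
    refine h1.trans (mul_le_of_le_one_right hM0 (Real.exp_le_one_iff.2 ?_))
    nlinarith [sq_nonneg v]
  have hc : Continuous fun v => mehler a s u v :=
    (continuous_mehler ha s).comp (by fun_prop : Continuous fun v : ℝ => (u, v))
  exact ⟨hf.bdd_mul hc.aestronglyMeasurable (ae_of_all _ hM'),
    hf.bdd_mul (hc.comp continuous_neg).aestronglyMeasurable (ae_of_all _ fun v => hM' (-v))⟩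

theorem integrable_mehlerEven_mul_of_integrable {a s : ℝ} (ha : -1 / 2 ≤ a) (hs : 0 < s) (u : ℝ)
    {f : ℝ → ℝ} (hf : Integrable f (powMeasure a)) :
    Integrable (fun v => mehlerEven a s u v * f v) (powMeasure a) ∧
      Integrable (fun v => u * v * mehlerEven (a + 1) s u v * f v) (powMeasure a) := by
  obtain ⟨h1, h2⟩ := integrable_mehler_mul_of_integrable ha hs u hf
  have h3 : Integrable (fun v => mehlerEven a s u v * f v) (powMeasure a) := by
    refine ((h1.add h2).const_mul (1 / 2)).congr (ae_of_all _ fun v => ?_)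
    simp only [mehlerEven_eq_half hs, Pi.add_apply]
    ring
  refine ⟨h3, (h1.sub h3).congr (ae_of_all _ fun v => ?_)⟩
  simp only [mehler_eq_even_add_odd hs, Pi.sub_apply]
  ring

theorem integral_mehler_mul {a s : ℝ} (ha : -1 / 2 ≤ a) (hs : 0 < s) (u : ℝ)
    {f : ℝ → ℝ} (hf : Integrable f (powMeasure a)) :
    ∫ v, mehler a s u v * f v ∂powMeasure a = ∫ v, mehlerEven a s u v * f v ∂powMeasure a +
      ∫ v, u * v * mehlerEven (a + 1) s u v * f v ∂powMeasure a := by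
  obtain ⟨h1, h2⟩ := integrable_mehlerEven_mul_of_integrable ha hs u hf
  rw [← integral_add h1 h2]
  refine integral_congr_ae (ae_of_all _ fun v => ?_)
  simp only [mehler_eq_even_add_odd hs]
  ring

theorem hermite1_even_neg (a : ℝ) (m : ℕ) (x : ℝ) :
    hermite1 a (2 * m) (-x) = hermite1 a (2 * m) x := by
  rw [hermite1_even, hermite1_even, laguerreFun_neg]

theorem integrable_hermite1 {a : ℝ} (ha : -1 / 2 ≤ a) (n : ℕ) :
    Integrable (hermite1 a n) (powMeasure a) := by
  simpa using integrable_poly_mul_hermite1 ha a 1 n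

theorem integral_mehlerEven_mul_hermite1 {a s : ℝ} (ha : -1 / 2 ≤ a) (hs : 0 < s) (u : ℝ)
    (m : ℕ) : ∫ v, mehlerEven a s u v * hermite1 a (2 * m) v ∂powMeasure a =
      Real.exp (-s * (2 * m + a + 1)) * hermite1 a (2 * m) u := by
  simp only [hermite1_even, mul_left_comm (mehlerEven a s u _)]
  rw [integral_const_mul, integral_mehlerEven_mul_laguerreFun ha hs]
  ring

theorem integral_mehler_mul_hermite1 {a s : ℝ} (ha : -1 / 2 ≤ a) (hs : 0 < s) (u : ℝ) (n : ℕ) :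
    ∫ v, mehler a s u v * hermite1 a n v ∂powMeasure a =
      Real.exp (-s * (n + a + 1)) * hermite1 a n u := by
  rw [integral_mehler_mul ha hs u (integrable_hermite1 ha n)]
  obtain ⟨m, rfl | rfl⟩ := n.even_or_odd'
  · rw [integral_mehlerEven_mul_hermite1 ha hs, integral_odd_powMeasure, add_zero]
    · push_cast; rfl
    · intro v; rw [mehlerEven_neg, hermite1_even_neg]; ring
  · have h1 := integral_mehlerEven_mul_hermite1 (a := a + 1) (by linarith) hs u m
    rw [integral_powMeasure_succ ha] at h1
    rw [integral_odd_powMeasure, zero_add]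
    · simp only [hermite1_odd]
      have h2 : ∀ v, u * v * mehlerEven (a + 1) s u v * (v * hermite1 (a + 1) (2 * m) v) =
          u * (v ^ 2 * (mehlerEven (a + 1) s u v * hermite1 (a + 1) (2 * m) v)) := fun v => by ring
      simp only [h2]
      rw [integral_const_mul, h1]
      push_cast
      ring_nf
    · intro v; rw [mehlerEven_neg, hermite1_odd, hermite1_odd, hermite1_even_neg]; ring

/-! ### Orthonormality of the Hermite functions on the line -/

/-- After Chu–Vandermonde, the alternating sum over the Laguerre coefficients is the binomial
transform at `z = -1`, so it carries `0 ^ (m - i)`. Only `i = m` can survive, which forces `k = m`.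
-/
theorem integral_pow_mul_laguerre_mul_gaussian {a : ℝ} (ha : -1 / 2 ≤ a) {k m : ℕ} (hk : k ≤ m) :
    ∫ v, v ^ (2 * k) * (laguerre a m (v ^ 2) * Real.exp (-1 * v ^ 2)) ∂powMeasure a =
      if k = m then (-1) ^ m * Real.Gamma (m + a + 1) else 0 := by
  have hG : ∀ k : ℕ, Real.Gamma (k + a + 1) ≠ 0 := fun k =>
    (Real.Gamma_pos_of_pos (by linarith [k.cast_nonneg (α := ℝ)])).ne'
  have h1 : ∀ v : ℝ, v ^ (2 * k) * (laguerre a m (v ^ 2) * Real.exp (-1 * v ^ 2)) =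
      ∑ j ∈ Finset.range (m + 1), Real.Gamma (m + a + 1) / m.factorial * (m.choose j : ℝ) *
        ((-1) ^ j / Real.Gamma (j + a + 1)) * (v ^ (2 * (j + k)) * Real.exp (-1 * v ^ 2)) :=
    fun v => by
      rw [laguerre_eq_choose, Finset.mul_sum, Finset.sum_mul, Finset.mul_sum]
      refine Finset.sum_congr rfl fun j _ => ?_
      rw [neg_eq_neg_one_mul, mul_pow, mul_add 2 j k, pow_add, pow_mul v 2 j]
      ring
  simp only [h1]
  rw [integral_finsetSum _ fun j _ => (integrable_pow_mul_gaussian ha one_pos _).const_mul _]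
  have h2 : ∀ j ∈ Finset.range (m + 1), ∫ v, Real.Gamma (m + a + 1) / m.factorial *
      (m.choose j : ℝ) * ((-1) ^ j / Real.Gamma (j + a + 1)) *
        (v ^ (2 * (j + k)) * Real.exp (-1 * v ^ 2)) ∂powMeasure a =
      ∑ i ∈ Finset.range (k + 1), Real.Gamma (m + a + 1) / m.factorial * ((k.choose i : ℝ) *
        (Real.Gamma (k + a + 1) / Real.Gamma (i + a + 1)) * i.factorial) *
        ((m.choose j : ℝ) * j.choose i * (-1) ^ j) := fun j _ => by
    rw [integral_const_mul, integral_even_pow_mul_gaussian ha one_pos, Real.one_rpow, mul_one]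
    push_cast
    rw [gamma_quotient_eq_sum k (by linarith : -1 < a) j, Finset.mul_sum, Finset.mul_sum]
    refine Finset.sum_congr rfl fun i _ => ?_
    rw [Nat.descFactorial_eq_factorial_mul_choose]
    push_cast
    have := hG j
    field_simp
  rw [Finset.sum_congr rfl h2, Finset.sum_comm]
  have h3 : ∀ i ∈ Finset.range (k + 1), ∑ j ∈ Finset.range (m + 1),
      Real.Gamma (m + a + 1) / m.factorial * ((k.choose i : ℝ) *
        (Real.Gamma (k + a + 1) / Real.Gamma (i + a + 1)) * i.factorial) *
        ((m.choose j : ℝ) * j.choose i * (-1) ^ j) =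
      if i = m then (-1) ^ m * Real.Gamma (m + a + 1) else 0 := fun i hi => by
    have hik : i ≤ k := Nat.lt_succ_iff.1 (Finset.mem_range.1 hi)
    rw [← Finset.mul_sum, sum_choose_mul_choose_mul_pow (hik.trans hk), add_neg_cancel]
    split_ifs with him
    · subst him
      obtain rfl : k = i := le_antisymm hk hik
      have := hG k
      simp
      field_simp
    · rw [zero_pow (by omega), mul_zero, mul_zero]
  rw [Finset.sum_congr rfl h3, Finset.sum_ite_eq']
  have : m ∈ Finset.range (k + 1) ↔ k = m := by rw [Finset.mem_range]; omega
  simp only [this]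

/-- Expand the factor of lower degree: its powers below `m` integrate to zero against the other, so
only a leading coefficient contributes. -/
theorem integral_laguerreFun_mul_laguerreFun {a : ℝ} (ha : -1 / 2 ≤ a) {m n : ℕ} (h : n ≤ m) :
    ∫ v, laguerreFun a n v * laguerreFun a m v ∂powMeasure a =
      if n = m then Real.Gamma (m + a + 1) / m.factorial else 0 := by
  have hG : ∀ k : ℕ, Real.Gamma (k + a + 1) ≠ 0 := fun k =>
    (Real.Gamma_pos_of_pos (by linarith [k.cast_nonneg (α := ℝ)])).ne'
  have h1 : ∀ v : ℝ, laguerreFun a n v * laguerreFun a m v =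
      ∑ k ∈ Finset.range (n + 1), Real.Gamma (n + a + 1) / n.factorial * (n.choose k : ℝ) *
        ((-1) ^ k / Real.Gamma (k + a + 1)) *
        (v ^ (2 * k) * (laguerre a m (v ^ 2) * Real.exp (-1 * v ^ 2))) := fun v => by
    rw [laguerreFun, laguerreFun, show -1 * v ^ 2 = -v ^ 2 / 2 + -v ^ 2 / 2 by ring, Real.exp_add,
      laguerre_eq_choose a n, Finset.mul_sum, Finset.mul_sum, Finset.sum_mul]
    refine Finset.sum_congr rfl fun k _ => ?_
    rw [neg_eq_neg_one_mul (v ^ 2), mul_pow, pow_mul v 2 k]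
    ring
  simp only [h1]
  rw [integral_finsetSum]
  · have h2 : ∀ k ∈ Finset.range (n + 1), ∫ v, Real.Gamma (n + a + 1) / n.factorial *
        (n.choose k : ℝ) * ((-1) ^ k / Real.Gamma (k + a + 1)) *
        (v ^ (2 * k) * (laguerre a m (v ^ 2) * Real.exp (-1 * v ^ 2))) ∂powMeasure a =
        if k = m then Real.Gamma (n + a + 1) / n.factorial * (n.choose m : ℝ) else 0 :=
      fun k hk => by
        rw [integral_const_mul, integral_pow_mul_laguerre_mul_gaussian ha
          ((Nat.lt_succ_iff.1 (Finset.mem_range.1 hk)).trans h)]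
        split_ifs with hkm
        · subst hkm
          have := hG k
          have h4 : ((-1 : ℝ) ^ k) * (-1) ^ k = 1 := by rw [← mul_pow]; simp
          field_simp
          linear_combination (n.choose k : ℝ) * Real.Gamma (n + a + 1) * h4
        · rw [mul_zero]
    rw [Finset.sum_congr rfl h2, Finset.sum_ite_eq']
    have : m ∈ Finset.range (n + 1) ↔ n = m := by rw [Finset.mem_range]; omega
    simp only [this]
    split_ifs with hnm
    · subst hnm; simp
    · rfl
  · intro k _
    refine Integrable.const_mul ?_ _
    obtain ⟨p, hp⟩ := laguerre_poly a m
    refine (integrable_poly_mul_gaussian_pow ha one_pos (Polynomial.X ^ (2 * k) * p)).congr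
      (ae_of_all _ fun v => ?_)
    simp only [hp, Polynomial.eval_mul, Polynomial.eval_pow, Polynomial.eval_X]
    ring

theorem integral_hermite1_even_mul {a : ℝ} (ha : -1 / 2 ≤ a) (m n : ℕ) :
    ∫ v, hermite1 a (2 * m) v * hermite1 a (2 * n) v ∂powMeasure a = if m = n then 1 else 0 := by
  wlog h : m ≤ n generalizing m n
  · have := this n m (le_of_not_ge h)
    simp only [mul_comm (hermite1 a (2 * m) _), eq_comm (a := m)]
    exact this
  have h1 : ∀ v, hermite1 a (2 * m) v * hermite1 a (2 * n) v =
      (-1) ^ m * √(Real.Gamma (m + 1) / Real.Gamma (m + a + 1)) *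
      ((-1) ^ n * √(Real.Gamma (n + 1) / Real.Gamma (n + a + 1))) *
      (laguerreFun a m v * laguerreFun a n v) := fun v => by
    rw [hermite1_even, hermite1_even]; ring
  simp only [h1]
  rw [integral_const_mul, integral_laguerreFun_mul_laguerreFun ha h]
  split_ifs with hmn
  · subst hmn
    have hG : 0 < Real.Gamma (m + a + 1) :=
      Real.Gamma_pos_of_pos (by linarith [m.cast_nonneg (α := ℝ)])
    rw [mul_mul_mul_comm, ← mul_pow, Real.mul_self_sqrt (by rw [Real.Gamma_nat_eq_factorial]; positivity),
      Real.Gamma_nat_eq_factorial]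
    have : (m.factorial : ℝ) ≠ 0 := by positivity
    field_simp
    simp
  · rw [mul_zero]

theorem integral_hermite1_mul {a : ℝ} (ha : -1 / 2 ≤ a) (m n : ℕ) :
    ∫ v, hermite1 a m v * hermite1 a n v ∂powMeasure a = if m = n then 1 else 0 := by
  obtain ⟨k, rfl | rfl⟩ := m.even_or_odd' <;> obtain ⟨l, rfl | rfl⟩ := n.even_or_odd'
  · rw [integral_hermite1_even_mul ha]
    simp
  · rw [integral_odd_powMeasure, if_neg (by omega)]
    intro v; rw [hermite1_odd, hermite1_odd, hermite1_even_neg, hermite1_even_neg]; ring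
  · rw [integral_odd_powMeasure, if_neg (by omega)]
    intro v; rw [hermite1_odd, hermite1_odd, hermite1_even_neg, hermite1_even_neg]; ring
  · have h := integral_hermite1_even_mul (a := a + 1) (by linarith) k l
    rw [integral_powMeasure_succ ha] at h
    have h1 : ∀ v, hermite1 a (2 * k + 1) v * hermite1 a (2 * l + 1) v =
        v ^ 2 * (hermite1 (a + 1) (2 * k) v * hermite1 (a + 1) (2 * l) v) := fun v => by
      rw [hermite1_odd, hermite1_odd]; ring
    simp only [h1, h]
    simp

/-! ### Polynomials times Gaussians are spanned by Hermite functions -/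

/-- The expansion of Hermite functions in monomials times the Gaussian is triangular with nonzero
diagonal, so it can be inverted recursively. -/
theorem even_monomial_mem_span {a : ℝ} (ha : -1 / 2 ≤ a) (m : ℕ) :
    (fun v : ℝ => v ^ (2 * m) * Real.exp (-v ^ 2 / 2)) ∈
      Submodule.span ℝ (Set.range fun n => hermite1 a (2 * n)) := by
  induction m using Nat.strong_induction_on with
  | _ m ih =>
    have hG : ∀ k : ℕ, 0 < Real.Gamma (k + a + 1) := fun k =>
      Real.Gamma_pos_of_pos (by linarith [k.cast_nonneg (α := ℝ)])
    set N := (-1 : ℝ) ^ m * √(Real.Gamma (m + 1) / Real.Gamma (m + a + 1)) with hN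
    have hN0 : N ≠ 0 := by
      have := hG m
      have h1 : 0 < Real.Gamma (m + 1) := Real.Gamma_pos_of_pos (by positivity)
      exact mul_ne_zero (pow_ne_zero _ (by norm_num)) (Real.sqrt_pos.2 (by positivity)).ne'
    let c : ℕ → ℝ := fun k => Real.Gamma (m + a + 1) / m.factorial *
      ((m.choose k : ℝ) * ((-1) ^ k / Real.Gamma (k + a + 1)))
    have hc : c m ≠ 0 := by
      have := (hG m).ne'
      have h1 : (m.factorial : ℝ) ≠ 0 := by positivity
      simp only [c, Nat.choose_self]
      have h2 : (-1 : ℝ) ^ m ≠ 0 := pow_ne_zero _ (by norm_num)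
      positivity
    have h1 : (fun v : ℝ => v ^ (2 * m) * Real.exp (-v ^ 2 / 2)) = (c m)⁻¹ • (N⁻¹ • hermite1 a (2 * m) -
        ∑ k ∈ Finset.range m, c k • fun v : ℝ => v ^ (2 * k) * Real.exp (-v ^ 2 / 2)) := by
      ext v
      have h2 : N⁻¹ * hermite1 a (2 * m) v =
          ∑ k ∈ Finset.range (m + 1), c k * (v ^ (2 * k) * Real.exp (-v ^ 2 / 2)) := by
        rw [hermite1_even, ← hN, inv_mul_cancel_left₀ hN0, laguerreFun, laguerre_eq_choose,
          Finset.mul_sum, Finset.mul_sum]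
        refine Finset.sum_congr rfl fun k _ => ?_
        rw [neg_eq_neg_one_mul (v ^ 2), mul_pow, pow_mul v 2 k]
        simp only [c]
        ring
      rw [Finset.sum_range_succ] at h2
      simp only [Pi.smul_apply, Pi.sub_apply, Finset.sum_apply, smul_eq_mul]
      rw [h2, add_sub_cancel_left, inv_mul_cancel_left₀ hc]
    rw [h1]
    refine Submodule.smul_mem _ _ (Submodule.sub_mem _ (Submodule.smul_mem _ _
      (Submodule.subset_span ⟨m, rfl⟩)) (Submodule.sum_mem _ fun k hk =>
        Submodule.smul_mem _ _ (ih k (Finset.mem_range.1 hk))))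

theorem monomial_mem_span {a : ℝ} (ha : -1 / 2 ≤ a) (m : ℕ) :
    (fun v : ℝ => v ^ m * Real.exp (-v ^ 2 / 2)) ∈
      Submodule.span ℝ (Set.range (hermite1 a)) := by
  obtain ⟨k, rfl | rfl⟩ := m.even_or_odd'
  · refine Submodule.span_mono ?_ (even_monomial_mem_span ha k)
    rintro _ ⟨n, rfl⟩
    exact ⟨2 * n, rfl⟩
  · have h := Submodule.mem_map_of_mem (f := LinearMap.mulLeft ℝ (fun v : ℝ => v))
      (even_monomial_mem_span (a := a + 1) (by linarith) k)
    rw [Submodule.map_span] at h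
    have h2 : (fun v : ℝ => v ^ (2 * k + 1) * Real.exp (-v ^ 2 / 2)) =
        LinearMap.mulLeft ℝ (fun v : ℝ => v)
          (fun v : ℝ => v ^ (2 * k) * Real.exp (-v ^ 2 / 2)) := by
      ext v
      simp only [LinearMap.mulLeft_apply, Pi.mul_apply]
      ring
    rw [h2]
    refine Submodule.span_mono ?_ h
    rintro _ ⟨_, ⟨n, rfl⟩, rfl⟩
    refine ⟨2 * n + 1, ?_⟩
    ext v
    rw [hermite1_odd]
    rfl

end

section
/-! ### Product structure of the weighted measure -/

theorem lintegral_pi_prod : ∀ {d : ℕ} (ν : Fin d → Measure ℝ) [∀ j, SigmaFinite (ν j)]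
    {f : Fin d → ℝ → ℝ≥0∞}, (∀ j, Measurable (f j)) →
    ∫⁻ x, ∏ j, f j (x j) ∂Measure.pi ν = ∏ j, ∫⁻ v, f j v ∂ν j
  | 0, ν, _, f, _ => by simp
  | d + 1, ν, _, f, hf => by
    have h := (measurePreserving_piFinSuccAbove ν 0).symm
    have hm : Measurable fun x : Fin (d + 1) → ℝ => ∏ j, f j (x j) :=
      Finset.measurable_prod _ fun j _ => (hf j).comp (measurable_pi_apply j)
    rw [← h.lintegral_comp hm]
    have h1 : ∀ p : ℝ × (Fin d → ℝ),
        ∏ j, f j (((MeasurableEquiv.piFinSuccAbove (fun _ => ℝ) 0).symm p) j) =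
          f 0 p.1 * ∏ j : Fin d, f j.succ (p.2 j) := fun p => by
      rw [Fin.prod_univ_succ]
      simp [MeasurableEquiv.piFinSuccAbove]
    simp only [h1]
    have hm2 : Measurable fun x : Fin d → ℝ => ∏ j : Fin d, f j.succ (x j) :=
      Finset.measurable_prod _ fun j _ => (hf _).comp (measurable_pi_apply j)
    rw [lintegral_prod_mul (f := f 0) (g := fun x : Fin d → ℝ => ∏ j : Fin d, f j.succ (x j))
      (hf 0).aemeasurable hm2.aemeasurable, Fin.prod_univ_succ]
    congr 1
    exact lintegral_pi_prod (fun j => ν j.succ) fun j => hf _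

theorem pi_withDensity {d : ℕ} (ν : Fin d → Measure ℝ) [∀ j, SigmaFinite (ν j)]
    {f : Fin d → ℝ → ℝ≥0∞} (hf : ∀ j, Measurable (f j))
    [∀ j, SigmaFinite ((ν j).withDensity (f j))] :
    Measure.pi (fun j => (ν j).withDensity (f j)) =
      (Measure.pi ν).withDensity fun x => ∏ j, f j (x j) := by
  refine Measure.pi_eq fun s hs => ?_
  rw [withDensity_apply _ (MeasurableSet.univ_pi hs), Measure.restrict_pi_pi,
    lintegral_pi_prod _ hf]
  refine Finset.prod_congr rfl fun j _ => ?_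
  rw [withDensity_apply _ (hs j)]

variable {d : ℕ}

/-- The weight factorizes over the coordinates. Hence integrals of tensor products reduce to
products of integrals over the line. -/
theorem measurePreserving_toLp (α : Fin d → ℝ) :
    MeasurePreserving (MeasurableEquiv.toLp 2 (Fin d → ℝ))
      (Measure.pi fun j => powMeasure (α j)) (weightMeasure α) := by
  refine ⟨(MeasurableEquiv.toLp 2 (Fin d → ℝ)).measurable, ?_⟩
  have h0 := PiLp.volume_preserving_toLp (Fin d)
  unfold powMeasure
  have : ∀ j : Fin d, SigmaFinite ((volume : Measure ℝ).withDensity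
      fun v => ENNReal.ofReal (|v| ^ (2 * α j + 1))) := fun j =>
    inferInstanceAs (SigmaFinite (powMeasure (α j)))
  rw [pi_withDensity _ fun j => measurable_powDensity (α j)]
  ext s hs
  rw [Measure.map_apply (MeasurableEquiv.toLp 2 (Fin d → ℝ)).measurable hs,
    withDensity_apply _ ((MeasurableEquiv.toLp 2 (Fin d → ℝ)).measurable hs), weightMeasure,
    withDensity_apply _ hs]
  rw [← h0.setLIntegral_comp_preimage hs (measurable_weight α).ennreal_ofReal]
  refine lintegral_congr fun x => ?_
  rw [weight, ENNReal.ofReal_prod_of_nonneg fun j _ => by positivity]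

theorem integral_weightMeasure_prod {𝕜 : Type*} [RCLike 𝕜] (α : Fin d → ℝ) (f : Fin d → ℝ → 𝕜) :
    ∫ x, ∏ j, f j (x j) ∂weightMeasure α = ∏ j, ∫ v, f j v ∂powMeasure (α j) := by
  rw [← (measurePreserving_toLp α).integral_comp (MeasurableEquiv.measurableEmbedding _)]
  exact integral_fintype_prod_eq_prod (𝕜 := 𝕜) f

theorem integrable_weightMeasure_prod {𝕜 : Type*} [RCLike 𝕜] {α : Fin d → ℝ}
    {f : Fin d → ℝ → 𝕜} (hf : ∀ j, Integrable (f j) (powMeasure (α j))) :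
    Integrable (fun x : EuclideanSpace ℝ (Fin d) => ∏ j, f j (x j)) (weightMeasure α) := by
  rw [← (measurePreserving_toLp α).integrable_comp_emb (MeasurableEquiv.measurableEmbedding _)]
  exact Integrable.fintype_prod hf

instance (α : Fin d → ℝ) : SigmaFinite (weightMeasure α) := by
  rw [← (measurePreserving_toLp α).map_eq]
  exact (MeasurableEquiv.toLp 2 (Fin d → ℝ)).sigmaFinite_map

/-! ### The Mehler kernel in several variables -/

/-- The Mehler kernel of the Dunkl harmonic oscillator at time `s / 2`. -/
def mehlerKernel (α : Fin d → ℝ) (s : ℝ) (x y : EuclideanSpace ℝ (Fin d)) : ℝ :=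
  ∏ j, mehler (α j) s (x j) (y j)

variable {α : Fin d → ℝ}

theorem mehlerKernel_comm (s : ℝ) (x y : EuclideanSpace ℝ (Fin d)) :
    mehlerKernel α s x y = mehlerKernel α s y x :=
  Finset.prod_congr rfl fun _ _ => mehler_comm _ _ _ _

theorem mehlerKernel_nonneg (hα : ∀ j, -1 / 2 ≤ α j) {s : ℝ} (hs : 0 < s)
    (x y : EuclideanSpace ℝ (Fin d)) : 0 ≤ mehlerKernel α s x y :=
  Finset.prod_nonneg fun j _ => mehler_nonneg (hα j) hs _ _

theorem continuous_mehlerKernel (hα : ∀ j, -1 / 2 ≤ α j) (s : ℝ) :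
    Continuous fun p : EuclideanSpace ℝ (Fin d) × EuclideanSpace ℝ (Fin d) =>
      mehlerKernel α s p.1 p.2 := by
  unfold mehlerKernel
  refine continuous_finsetProd _ fun j _ => ?_
  exact (continuous_mehler (hα j) s).comp
    (by fun_prop : Continuous fun p : EuclideanSpace ℝ (Fin d) × EuclideanSpace ℝ (Fin d) =>
      ((p.1 j, p.2 j) : ℝ × ℝ))

theorem continuous_mehlerKernel_right (hα : ∀ j, -1 / 2 ≤ α j) (s : ℝ)
    (x : EuclideanSpace ℝ (Fin d)) : Continuous fun y => mehlerKernel α s x y :=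
  (continuous_mehlerKernel hα s).comp₂ continuous_const continuous_id'

theorem integrable_mehlerKernel (hα : ∀ j, -1 / 2 ≤ α j) {s : ℝ} (hs : 0 < s)
    (x : EuclideanSpace ℝ (Fin d)) :
    Integrable (fun y => mehlerKernel α s x y) (weightMeasure α) :=
  integrable_weightMeasure_prod fun j => integrable_mehler (hα j) hs (x j)

/-- Made for tensor products with one distinguished factor. The exponent `d` instead of `d - 1` is
harmless since `b ≥ 1`. -/
theorem prod_ite_le {A B : Fin d → ℝ} {b : ℝ} (hb : 1 ≤ b) (hB : ∀ i, 0 ≤ B i)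
    (hBb : ∀ i, B i ≤ b) (j : Fin d) (hA : 0 ≤ A j) :
    ∏ i, (if i = j then A i else B i) ≤ A j * b ^ d := by
  rw [← Finset.mul_prod_erase _ _ (Finset.mem_univ j), if_pos rfl]
  refine mul_le_mul_of_nonneg_left ?_ hA
  have h1 : ∏ i ∈ Finset.univ.erase j, (if i = j then A i else B i) =
      ∏ i ∈ Finset.univ.erase j, B i :=
    Finset.prod_congr rfl fun i hi => if_neg (Finset.ne_of_mem_erase hi)
  rw [h1]
  refine (Finset.prod_le_prod (fun i _ => hB i) fun i _ => hBb i).trans ?_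
  rw [Finset.prod_const]
  refine pow_le_pow_right₀ hb ?_
  exact (Finset.card_le_univ _).trans_eq (Fintype.card_fin d)

/-- The squared norm is a sum over coordinates. Each summand gives a tensor product with one factor
a second moment and the others total masses, at most `1`. -/
theorem integral_sq_norm_sub_mul_mehlerKernel_le (hα : ∀ j, -1 / 2 ≤ α j) {s : ℝ} (hs : 0 < s)
    (x : EuclideanSpace ℝ (Fin d)) :
    Integrable (fun y => ‖x - y‖ ^ 2 * mehlerKernel α s x y) (weightMeasure α) ∧
    ∫ y, ‖x - y‖ ^ 2 * mehlerKernel α s x y ∂weightMeasure α ≤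
      (∑ j, (2 * α j + 4) * 2) * s := by
  let f : Fin d → Fin d → ℝ → ℝ := fun j i v =>
    if i = j then (x i - v) ^ 2 * mehler (α i) s (x i) v else mehler (α i) s (x i) v
  have hf : ∀ j i, Integrable (f j i) (powMeasure (α i)) := fun j i => by
    by_cases h : i = j
    · simp only [f, if_pos h]; exact integrable_sq_sub_mul_mehler (hα i) hs _
    · simp only [f, if_neg h]; exact integrable_mehler (hα i) hs _
  have h1 : (fun y : EuclideanSpace ℝ (Fin d) => ‖x - y‖ ^ 2 * mehlerKernel α s x y) =
      fun y => ∑ j, ∏ i, f j i (y i) := by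
    funext y
    rw [EuclideanSpace.real_norm_sq_eq, Finset.sum_mul]
    refine Finset.sum_congr rfl fun j _ => ?_
    rw [mehlerKernel, ← Finset.mul_prod_erase _ _ (Finset.mem_univ j),
      ← Finset.mul_prod_erase _ (fun i => f j i (y i)) (Finset.mem_univ j)]
    have h2 : ∏ i ∈ Finset.univ.erase j, f j i (y i) =
        ∏ i ∈ Finset.univ.erase j, mehler (α i) s (x i) (y i) :=
      Finset.prod_congr rfl fun i hi => if_neg (Finset.ne_of_mem_erase hi)
    rw [h2]
    simp only [f, if_true, PiLp.sub_apply]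
    ring
  rw [h1]
  refine ⟨integrable_finsetSum _ fun j _ => integrable_weightMeasure_prod (hf j), ?_⟩
  rw [integral_finsetSum _ fun j _ => integrable_weightMeasure_prod (hf j), Finset.sum_mul]
  refine Finset.sum_le_sum fun j _ => ?_
  rw [integral_weightMeasure_prod α (f j)]
  have h3 : ∀ i, ∫ v, f j i v ∂powMeasure (α i) = if i = j then
      ∫ v, (x i - v) ^ 2 * mehler (α i) s (x i) v ∂powMeasure (α i) else
      ∫ v, mehler (α i) s (x i) v ∂powMeasure (α i) := fun i => by
    by_cases h : i = j
    · simp only [f, if_pos h]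
    · simp only [f, if_neg h]
  simp only [h3]
  have h4 : 0 ≤ ∫ v, (x j - v) ^ 2 * mehler (α j) s (x j) v ∂powMeasure (α j) :=
    integral_nonneg fun v => mul_nonneg (sq_nonneg _) (mehler_nonneg (hα j) hs _ _)
  have h5 := prod_ite_le
    (A := fun i => ∫ v, (x i - v) ^ 2 * mehler (α i) s (x i) v ∂powMeasure (α i)) le_rfl
    (fun i => integral_nonneg fun v => mehler_nonneg (hα i) hs (x i) v)
    (fun i => integral_mehler_le_one (hα i) hs (x i)) j h4
  rw [one_pow, mul_one] at h5
  have h6 := integral_sq_sub_mul_mehler_le (hα j) hs (x j)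
  rw [mul_assoc]
  exact h5.trans h6

/-- Telescoping. All factors other than the difference are enlarged to `a i + b i`, so that each
summand on the right stays a tensor product. -/
theorem abs_prod_sub_prod_le {ι : Type*} [DecidableEq ι] (s : Finset ι) {a b : ι → ℝ}
    (ha : ∀ i, 0 ≤ a i) (hb : ∀ i, 0 ≤ b i) :
    |∏ i ∈ s, a i - ∏ i ∈ s, b i| ≤
      ∑ j ∈ s, ∏ i ∈ s, (if i = j then |a i - b i| else a i + b i) := by
  induction s using Finset.induction_on with
  | empty => simp
  | insert k s hk ih =>
    rw [Finset.prod_insert hk, Finset.prod_insert hk, Finset.sum_insert hk]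
    have h1 : ∏ i ∈ s, a i ≤ ∏ i ∈ s, (a i + b i) :=
      Finset.prod_le_prod (fun i _ => ha i) fun i _ => by linarith [hb i]
    have h2 : ∏ i ∈ insert k s, (if i = k then |a i - b i| else a i + b i) =
        |a k - b k| * ∏ i ∈ s, (a i + b i) := by
      rw [Finset.prod_insert hk, if_pos rfl]
      congr 1
      exact Finset.prod_congr rfl fun i hi => if_neg (by rintro rfl; exact hk hi)
    have h3 : ∑ j ∈ s, ∏ i ∈ insert k s, (if i = j then |a i - b i| else a i + b i) =
        (a k + b k) * ∑ j ∈ s, ∏ i ∈ s, (if i = j then |a i - b i| else a i + b i) := by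
      rw [Finset.mul_sum]
      refine Finset.sum_congr rfl fun j hj => ?_
      rw [Finset.prod_insert hk, if_neg (by rintro rfl; exact hk hj)]
    rw [h2, h3]
    have h4 : a k * ∏ i ∈ s, a i - b k * ∏ i ∈ s, b i =
        (a k - b k) * ∏ i ∈ s, a i + b k * (∏ i ∈ s, a i - ∏ i ∈ s, b i) := by ring
    rw [h4]
    refine (abs_add_le _ _).trans ?_
    rw [abs_mul, abs_mul, abs_of_nonneg (hb k), abs_of_nonneg (Finset.prod_nonneg fun i _ => ha i)]
    have h5 : b k ≤ a k + b k := by linarith [ha k]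
    gcongr
    exact add_nonneg (ha k) (hb k)

theorem integral_abs_mehlerKernel_sub_le (hα : ∀ j, -1 / 2 ≤ α j) {s : ℝ} (hs : 0 < s)
    (x x' : EuclideanSpace ℝ (Fin d)) :
    ∫ y, |mehlerKernel α s x y - mehlerKernel α s x' y| ∂weightMeasure α ≤
      (12 * d * 2 ^ d) * ‖x - x'‖ / √s := by
  let f : Fin d → Fin d → ℝ → ℝ := fun j i v =>
    if i = j then |mehler (α i) s (x i) v - mehler (α i) s (x' i) v|
      else mehler (α i) s (x i) v + mehler (α i) s (x' i) v
  have hf : ∀ j i, Integrable (f j i) (powMeasure (α i)) := fun j i => by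
    have h1 := integrable_mehler (hα i) hs (x i)
    have h2 := integrable_mehler (hα i) hs (x' i)
    by_cases h : i = j
    · simp only [f, if_pos h]; exact (h1.sub h2).abs
    · simp only [f, if_neg h]; exact h1.add h2
  have h1 : ∀ y : EuclideanSpace ℝ (Fin d), |mehlerKernel α s x y - mehlerKernel α s x' y| ≤
      ∑ j, ∏ i, f j i (y i) := fun y =>
    abs_prod_sub_prod_le _ (fun i => mehler_nonneg (hα i) hs _ _)
      fun i => mehler_nonneg (hα i) hs _ _
  refine (integral_mono ((integrable_mehlerKernel hα hs x).sub
    (integrable_mehlerKernel hα hs x')).abs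
    (integrable_finsetSum _ fun j _ => integrable_weightMeasure_prod (hf j)) h1).trans ?_
  rw [integral_finsetSum _ fun j _ => integrable_weightMeasure_prod (hf j)]
  -- The undistinguished factors are sums of two masses, each at most `1`; hence `2 ^ d`.
  have h2 : ∀ j, ∫ y : EuclideanSpace ℝ (Fin d), ∏ i, f j i (y i) ∂weightMeasure α ≤
      12 * ‖x - x'‖ / √s * 2 ^ d := fun j => by
    rw [integral_weightMeasure_prod α (f j)]
    have h3 : ∀ i, ∫ v, f j i v ∂powMeasure (α i) = if i = j then
        ∫ v, |mehler (α i) s (x i) v - mehler (α i) s (x' i) v| ∂powMeasure (α i) else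
        ∫ v, (mehler (α i) s (x i) v + mehler (α i) s (x' i) v) ∂powMeasure (α i) := fun i => by
      by_cases h : i = j
      · simp only [f, if_pos h]
      · simp only [f, if_neg h]
    simp only [h3]
    refine (prod_ite_le one_le_two (fun i => integral_nonneg fun v =>
      add_nonneg (mehler_nonneg (hα i) hs _ _) (mehler_nonneg (hα i) hs _ _)) (fun i => ?_) j
      (integral_nonneg fun v => abs_nonneg _)).trans ?_
    · rw [integral_add (integrable_mehler (hα i) hs _) (integrable_mehler (hα i) hs _)]
      linarith [integral_mehler_le_one (hα i) hs (x i), integral_mehler_le_one (hα i) hs (x' i)]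
    · refine mul_le_mul_of_nonneg_right ?_ (by positivity)
      refine (integral_abs_mehler_sub_le (hα j) hs _ _).trans ?_
      have := PiLp.norm_apply_le (x - x') j
      rw [PiLp.sub_apply, Real.norm_eq_abs] at this
      gcongr
  refine (Finset.sum_le_sum fun j _ => h2 j).trans_eq ?_
  rw [Finset.sum_const, Finset.card_univ, Fintype.card_fin, nsmul_eq_mul]
  ring

theorem integral_mehlerKernel_mul_hermiteFun (hα : ∀ j, -1 / 2 ≤ α j) {s : ℝ} (hs : 0 < s)
    (x : EuclideanSpace ℝ (Fin d)) (n : Fin d → ℕ) :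
    ∫ y, mehlerKernel α s x y * hermiteFun α n y ∂weightMeasure α =
      Real.exp (-(s / 2) * eigenvalue α n) * hermiteFun α n x := by
  simp only [mehlerKernel, hermiteFun, ← Finset.prod_mul_distrib]
  rw [integral_weightMeasure_prod α fun j v => mehler (α j) s (x j) v * hermite1 (α j) (n j) v]
  simp only [integral_mehler_mul_hermite1 (hα _) hs]
  rw [Finset.prod_mul_distrib, ← Real.exp_sum, ← Finset.mul_sum]
  congr 2
  rw [eigenvalue, Finset.sum_add_distrib, Finset.sum_add_distrib, Finset.sum_const,
    Finset.card_univ, Fintype.card_fin, nsmul_eq_mul]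
  ring

theorem memLp_mehlerKernel (hα : ∀ j, -1 / 2 ≤ α j) {s : ℝ} (hs : 0 < s)
    (x : EuclideanSpace ℝ (Fin d)) :
    MemLp (fun y => (mehlerKernel α s x y : ℂ)) 2 (weightMeasure α) := by
  have hc : Continuous fun y => (mehlerKernel α s x y : ℂ) :=
    Complex.continuous_ofReal.comp (continuous_mehlerKernel_right hα s x)
  rw [memLp_two_iff_integrable_sq_norm hc.aestronglyMeasurable]
  have h := integrable_weightMeasure_prod (α := α) fun j =>
    (integrable_mehler_mul_of_integrable (hα j) hs (x j) (integrable_mehler (hα j) hs (x j))).1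
  refine h.congr (ae_of_all _ fun y => ?_)
  simp only [Complex.norm_real, Real.norm_eq_abs, sq_abs]
  rw [mehlerKernel, sq, ← Finset.prod_mul_distrib]

/-! ### Orthonormality -/

theorem integral_hermiteFun_mul (hα : ∀ j, -1 / 2 ≤ α j) (m n : Fin d → ℕ) :
    ∫ x, hermiteFun α m x * hermiteFun α n x ∂weightMeasure α = if m = n then 1 else 0 := by
  simp only [hermiteFun, ← Finset.prod_mul_distrib]
  rw [integral_weightMeasure_prod α fun j v => hermite1 (α j) (m j) v * hermite1 (α j) (n j) v]
  simp only [integral_hermite1_mul (hα _), Finset.prod_ite_zero, Finset.prod_const_one]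
  congr 1
  simp [funext_iff]

theorem inner_toLp {X : Type*} [MeasurableSpace X] {μ : Measure X} {f g : X → ℂ}
    (hf : MemLp f 2 μ) (hg : MemLp g 2 μ) :
    inner ℂ (hf.toLp f) (hg.toLp g) = ∫ x, (starRingEnd ℂ) (f x) * g x ∂μ := by
  rw [L2.inner_def]
  refine integral_congr_ae ?_
  filter_upwards [hf.coeFn_toLp, hg.coeFn_toLp] with x h1 h2
  rw [h1, h2, RCLike.inner_apply, mul_comm]

theorem inner_toLp_left {X : Type*} [MeasurableSpace X] {μ : Measure X} {f : X → ℂ}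
    (hf : MemLp f 2 μ) (g : Lp ℂ 2 μ) :
    inner ℂ (hf.toLp f) g = ∫ x, (starRingEnd ℂ) (f x) * g x ∂μ := by
  rw [L2.inner_def]
  refine integral_congr_ae ?_
  filter_upwards [hf.coeFn_toLp] with x h1
  rw [h1, RCLike.inner_apply, mul_comm]

theorem orthonormal_hermiteLp (hα : ∀ j, -1 / 2 ≤ α j) : Orthonormal ℂ (hermiteLp hα) := by
  rw [orthonormal_iff_ite]
  intro m n
  rw [hermiteLp, hermiteLp, inner_toLp]
  have h := integral_hermiteFun_mul hα m n
  simp only [Complex.conj_ofReal, ← Complex.ofReal_mul]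
  rw [integral_complex_ofReal, h]
  split_ifs <;> simp

end

section
/-! ### Completeness of the Hermite functions -/

/-- Uniqueness of the Fourier transform, reduced to finite positive measures: for real `g`, the
positive and negative parts are densities of two measures with equal characteristic functions, so
they agree almost everywhere. -/
theorem ae_eq_zero_of_integral_exp_inner_eq_zero {E : Type*} [NormedAddCommGroup E]
    [InnerProductSpace ℝ E] [MeasurableSpace E] [BorelSpace E] [SecondCountableTopology E]
    [CompleteSpace E] {μ : Measure E} {G : E → ℂ} (hG : Integrable G μ)
    (h : ∀ t : E, ∫ x, Complex.exp ((inner ℝ x t : ℝ) * Complex.I) * G x ∂μ = 0) :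
    G =ᵐ[μ] 0 := by
  have real_case : ∀ g : E → ℝ, Integrable g μ →
      (∀ t : E, ∫ x, Complex.exp ((inner ℝ x t : ℝ) * Complex.I) * (g x : ℂ) ∂μ = 0) →
      g =ᵐ[μ] 0 := by
    intro g hg hgt
    have hfin : ∀ g : E → ℝ, Integrable g μ →
        IsFiniteMeasure (μ.withDensity fun x => ENNReal.ofReal (g x)) := fun g hg =>
      isFiniteMeasure_withDensity_ofReal hg.2
    have hmk : ∀ g : E → ℝ, Integrable g μ → ∀ t : E,
        charFun (μ.withDensity fun x => ENNReal.ofReal (g x)) t =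
          ∫ x, Complex.exp ((inner ℝ x t : ℝ) * Complex.I) * ((max (g x) 0 : ℝ) : ℂ) ∂μ :=
      fun g hg t => by
        rw [charFun_apply, integral_withDensity_eq_integral_toReal_smul₀
          hg.aestronglyMeasurable.aemeasurable.ennreal_ofReal
          (ae_of_all _ fun _ => ENNReal.ofReal_lt_top)]
        refine integral_congr_ae (ae_of_all _ fun x => ?_)
        simp only [ENNReal.toReal_ofReal', Complex.real_smul]
        rw [mul_comm]
    have hint : ∀ g : E → ℝ, Integrable g μ → ∀ t : E, Integrable
        (fun x => Complex.exp ((inner ℝ x t : ℝ) * Complex.I) * ((max (g x) 0 : ℝ) : ℂ)) μ :=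
      fun g hg t => by
        refine (hg.pos_part.ofReal (𝕜 := ℂ)).bdd_mul (c := 1)
          (Continuous.aestronglyMeasurable (by fun_prop)) (ae_of_all _ fun x => ?_)
        rw [Complex.norm_exp_ofReal_mul_I]
    have := hfin g hg
    have := hfin _ hg.neg
    have heq : (μ.withDensity fun x => ENNReal.ofReal (g x)) =
        μ.withDensity fun x => ENNReal.ofReal ((-g) x) := by
      refine Measure.ext_of_charFun (funext fun t => ?_)
      rw [hmk g hg, hmk _ hg.neg, ← sub_eq_zero, ← integral_sub (hint g hg t) (hint _ hg.neg t),
        ← hgt t]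
      refine integral_congr_ae (ae_of_all _ fun x => ?_)
      simp only [← mul_sub, ← Complex.ofReal_sub, Pi.neg_apply]
      congr 2
      exact max_zero_sub_max_neg_zero_eq_self (g x)
    rw [withDensity_eq_iff hg.aestronglyMeasurable.aemeasurable.ennreal_ofReal
      hg.neg.aestronglyMeasurable.aemeasurable.ennreal_ofReal] at heq
    · filter_upwards [heq] with x hx
      simp only [Pi.neg_apply] at hx
      rcases le_total (g x) 0 with h0 | h0
      · rw [ENNReal.ofReal_of_nonpos h0, eq_comm, ENNReal.ofReal_eq_zero] at hx
        simp only [Pi.zero_apply]; linarith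
      · rw [ENNReal.ofReal_of_nonpos (by linarith : -g x ≤ 0), ENNReal.ofReal_eq_zero] at hx
        exact le_antisymm hx h0
    · exact hg.lintegral_lt_top.ne
  have hconj : ∀ t : E,
      ∫ x, Complex.exp ((inner ℝ x t : ℝ) * Complex.I) * (starRingEnd ℂ) (G x) ∂μ = 0 := fun t => by
    -- Conjugating at `-t` shows that the transform of the conjugate of `G` vanishes too, and with
    -- it those of the real and imaginary parts.
    have h1 := congrArg (starRingEnd ℂ) (h (-t))
    rw [← integral_conj, map_zero] at h1
    rw [← h1]
    refine integral_congr_ae (ae_of_all _ fun x => ?_)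
    simp only [map_mul, ← Complex.exp_conj, Complex.conj_I, inner_neg_right, Complex.ofReal_neg,
      map_neg, Complex.conj_ofReal, neg_mul_neg]
  have hb : ∀ (t : E) {F : E → ℂ}, Integrable F μ →
      Integrable (fun x => Complex.exp ((inner ℝ x t : ℝ) * Complex.I) * F x) μ := fun t F hF =>
    hF.bdd_mul (c := 1) (Continuous.aestronglyMeasurable (by fun_prop)) (ae_of_all _ fun x => by
      rw [Complex.norm_exp_ofReal_mul_I])
  have hGc : Integrable (fun x => (starRingEnd ℂ) (G x)) μ := by
    refine hG.norm.mono' ?_ (ae_of_all _ fun x => by simp)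
    exact Complex.continuous_conj.comp_aestronglyMeasurable hG.aestronglyMeasurable
  have hre := real_case (fun x => (G x).re) hG.re fun t => by
    have h1 : ∀ x, Complex.exp ((inner ℝ x t : ℝ) * Complex.I) * ((G x).re : ℂ) =
        1 / 2 * (Complex.exp ((inner ℝ x t : ℝ) * Complex.I) * G x +
          Complex.exp ((inner ℝ x t : ℝ) * Complex.I) * (starRingEnd ℂ) (G x)) := fun x => by
      rw [← mul_add, Complex.add_conj]; push_cast; ring
    simp only [h1]
    rw [integral_const_mul, integral_add (hb t hG) (hb t hGc), h, hconj]; simp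
  have him := real_case (fun x => (G x).im) hG.im fun t => by
    have h1 : ∀ x, Complex.exp ((inner ℝ x t : ℝ) * Complex.I) * ((G x).im : ℂ) =
        1 / (2 * Complex.I) * (Complex.exp ((inner ℝ x t : ℝ) * Complex.I) * G x -
          Complex.exp ((inner ℝ x t : ℝ) * Complex.I) * (starRingEnd ℂ) (G x)) := fun x => by
      rw [← mul_sub, Complex.sub_conj]
      have := Complex.I_ne_zero
      push_cast; field_simp
    simp only [h1]
    rw [integral_const_mul, integral_sub (hb t hG) (hb t hGc), h, hconj]; simp
  filter_upwards [hre, him] with x h1 h2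
  exact Complex.ext h1 h2

variable {d : ℕ} {α : Fin d → ℝ}

theorem prod_mem_hermite_span (hα : ∀ j, -1 / 2 ≤ α j) (k : Fin d → ℕ) :
    ∃ (s : Finset (Fin d → ℕ)) (c : (Fin d → ℕ) → ℝ), ∀ x : EuclideanSpace ℝ (Fin d),
      (∏ j, x j ^ k j) * Real.exp (-‖x‖ ^ 2 / 2) = ∑ n ∈ s, c n * hermiteFun α n x := by
  have h := fun j => Finsupp.mem_span_range_iff_exists_finsupp.1 (monomial_mem_span (hα j) (k j))
  choose c hc using h
  refine ⟨Fintype.piFinset fun j => (c j).support, fun n => ∏ j, c j (n j), fun x => ?_⟩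
  have h1 : Real.exp (-‖x‖ ^ 2 / 2) = ∏ j, Real.exp (-x j ^ 2 / 2) := by
    rw [← Real.exp_sum, EuclideanSpace.real_norm_sq_eq, ← Finset.sum_div, Finset.sum_neg_distrib]
  rw [h1, ← Finset.prod_mul_distrib]
  have h2 : ∀ j, x j ^ k j * Real.exp (-x j ^ 2 / 2) =
      ∑ i ∈ (c j).support, c j i * hermite1 (α j) i (x j) := fun j => by
    have := congrFun (hc j) (x j)
    rw [← this, Finsupp.sum, Finset.sum_apply]
    rfl
  simp only [h2]
  rw [Finset.prod_univ_sum]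
  exact Finset.sum_congr rfl fun n _ => by rw [Finset.prod_mul_distrib, hermiteFun]

theorem memLp_exp_norm_mul_gaussian (hα : ∀ j, -1 / 2 ≤ α j) (c : ℝ) :
    MemLp (fun x : EuclideanSpace ℝ (Fin d) => Real.exp (c * ‖x‖) * Real.exp (-‖x‖ ^ 2 / 2)) 2
      (weightMeasure α) := by
  have hcont : Continuous fun x : EuclideanSpace ℝ (Fin d) =>
      Real.exp (c * ‖x‖) * Real.exp (-‖x‖ ^ 2 / 2) := by fun_prop
  rw [memLp_two_iff_integrable_sq hcont.aestronglyMeasurable]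
  -- The constant comes from `2c‖x‖ ≤ 2c² + ‖x‖² / 2`, which spends half of the squared Gaussian on
  -- the exponential.
  have h := (integrable_weightMeasure_prod (α := α) fun j =>
    integrable_pow_mul_gaussian (hα j) one_half_pos 0).const_mul (Real.exp (2 * c ^ 2))
  refine h.mono' (hcont.pow 2).aestronglyMeasurable (ae_of_all _ fun x => ?_)
  rw [Real.norm_of_nonneg (by positivity), ← Real.exp_add, ← Real.exp_nat_mul]
  simp only [pow_zero, one_mul]
  rw [← Real.exp_sum, ← Finset.mul_sum, ← EuclideanSpace.real_norm_sq_eq, ← Real.exp_add,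
    Real.exp_le_exp]
  push_cast
  nlinarith [sq_nonneg (2 * c - ‖x‖)]

theorem integrable_exp_norm_mul_gaussian_mul (hα : ∀ j, -1 / 2 ≤ α j) (c : ℝ)
    {f : EuclideanSpace ℝ (Fin d) → ℂ} (hf : MemLp f 2 (weightMeasure α)) :
    Integrable (fun x => Real.exp (c * ‖x‖) * Real.exp (-‖x‖ ^ 2 / 2) * ‖f x‖)
      (weightMeasure α) :=
  (memLp_exp_norm_mul_gaussian hα c).integrable_mul hf.norm

theorem integrable_hermiteFun_mul (hα : ∀ j, -1 / 2 ≤ α j) (n : Fin d → ℕ)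
    {f : EuclideanSpace ℝ (Fin d) → ℂ} (hf : MemLp f 2 (weightMeasure α)) :
    Integrable (fun x => (hermiteFun α n x : ℂ) * f x) (weightMeasure α) :=
  (memLp_hermiteFun hα n).integrable_mul hf

theorem integral_monomial_gaussian_eq_zero (hα : ∀ j, -1 / 2 ≤ α j)
    {f : EuclideanSpace ℝ (Fin d) → ℂ} (hf : MemLp f 2 (weightMeasure α))
    (h : ∀ n, ∫ x, (hermiteFun α n x : ℂ) * f x ∂weightMeasure α = 0) (k : Fin d → ℕ) :
    Integrable (fun x : EuclideanSpace ℝ (Fin d) =>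
      (((∏ j, x j ^ k j) * Real.exp (-‖x‖ ^ 2 / 2) : ℝ) : ℂ) * f x) (weightMeasure α) ∧
    ∫ x : EuclideanSpace ℝ (Fin d),
      (((∏ j, x j ^ k j) * Real.exp (-‖x‖ ^ 2 / 2) : ℝ) : ℂ) * f x ∂weightMeasure α = 0 := by
  obtain ⟨s, c, hsc⟩ := prod_mem_hermite_span hα k
  have h1 : (fun x : EuclideanSpace ℝ (Fin d) =>
      (((∏ j, x j ^ k j) * Real.exp (-‖x‖ ^ 2 / 2) : ℝ) : ℂ) * f x) =
      fun x => ∑ n ∈ s, (c n : ℂ) * ((hermiteFun α n x : ℂ) * f x) := by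
    funext x
    rw [hsc, Complex.ofReal_sum, Finset.sum_mul]
    refine Finset.sum_congr rfl fun n _ => ?_
    push_cast; ring
  rw [h1]
  refine ⟨integrable_finsetSum _ fun n _ => (integrable_hermiteFun_mul hα n hf).const_mul _, ?_⟩
  rw [integral_finsetSum _ fun n _ => (integrable_hermiteFun_mul hα n hf).const_mul _]
  refine Finset.sum_eq_zero fun n _ => ?_
  rw [integral_const_mul, h, mul_zero]

theorem integral_inner_pow_gaussian_eq_zero (hα : ∀ j, -1 / 2 ≤ α j)
    {f : EuclideanSpace ℝ (Fin d) → ℂ} (hf : MemLp f 2 (weightMeasure α))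
    (h : ∀ n, ∫ x, (hermiteFun α n x : ℂ) * f x ∂weightMeasure α = 0) (m : ℕ)
    (t : EuclideanSpace ℝ (Fin d)) :
    ∫ x : EuclideanSpace ℝ (Fin d),
      (inner ℝ x t : ℂ) ^ m * ((Real.exp (-‖x‖ ^ 2 / 2) : ℂ) * f x) ∂weightMeasure α = 0 := by
  have h1 : ∀ x : EuclideanSpace ℝ (Fin d),
      (inner ℝ x t : ℂ) ^ m * ((Real.exp (-‖x‖ ^ 2 / 2) : ℂ) * f x) =
      ∑ k ∈ Finset.univ.piAntidiag m, ((Nat.multinomial Finset.univ k : ℂ) * ∏ i, (t i : ℂ) ^ k i) *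
        ((((∏ j, x j ^ k j) * Real.exp (-‖x‖ ^ 2 / 2) : ℝ) : ℂ) * f x) := fun x => by
    have h2 : (inner ℝ x t : ℝ) = ∑ j, x j * t j := by
      rw [PiLp.inner_apply]
      exact Finset.sum_congr rfl fun j _ => by simp [mul_comm]
    rw [h2, Complex.ofReal_sum, Finset.sum_pow_eq_sum_piAntidiag, Finset.sum_mul]
    refine Finset.sum_congr rfl fun k _ => ?_
    push_cast
    simp only [mul_pow, Finset.prod_mul_distrib]
    ring
  simp only [h1]
  rw [integral_finsetSum _ fun k _ =>
    (integral_monomial_gaussian_eq_zero hα hf h k).1.const_mul _]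
  refine Finset.sum_eq_zero fun k _ => ?_
  rw [integral_const_mul, (integral_monomial_gaussian_eq_zero hα hf h k).2, mul_zero]

/-- The classical completeness argument. The Fourier integral of `exp(-‖x‖²/2) f` expands into a
power series, justified by the majorant `exp(‖t‖ ‖x‖) exp(-‖x‖²/2) |f|`. Each term integrates a
polynomial times the Gaussian against `f`, and these are combinations of Hermite functions, so all
terms vanish. -/
theorem ae_eq_zero_of_integral_hermiteFun_eq_zero (hα : ∀ j, -1 / 2 ≤ α j)
    {f : EuclideanSpace ℝ (Fin d) → ℂ} (hf : MemLp f 2 (weightMeasure α))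
    (h : ∀ n, ∫ x, (hermiteFun α n x : ℂ) * f x ∂weightMeasure α = 0) :
    f =ᵐ[weightMeasure α] 0 := by
  have hm : AEStronglyMeasurable
      (fun x : EuclideanSpace ℝ (Fin d) => (Real.exp (-‖x‖ ^ 2 / 2) : ℂ) * f x) (weightMeasure α) :=
    (Continuous.aestronglyMeasurable (by fun_prop)).mul hf.1
  have hG : Integrable (fun x : EuclideanSpace ℝ (Fin d) =>
      (Real.exp (-‖x‖ ^ 2 / 2) : ℂ) * f x) (weightMeasure α) := by
    refine (integrable_exp_norm_mul_gaussian_mul hα 0 hf).mono' hm (ae_of_all _ fun x => ?_)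
    rw [norm_mul, Complex.norm_real, Real.norm_eq_abs, Real.abs_exp]
    simp
  have h0 := ae_eq_zero_of_integral_exp_inner_eq_zero hG fun t => by
    have hs := hasSum_integral_of_dominated_convergence (μ := weightMeasure α)
      (F := fun (m : ℕ) (x : EuclideanSpace ℝ (Fin d)) =>
        (((inner ℝ x t : ℝ) * Complex.I) ^ m / m.factorial) *
          ((Real.exp (-‖x‖ ^ 2 / 2) : ℂ) * f x))
      (f := fun x => Complex.exp ((inner ℝ x t : ℝ) * Complex.I) *
        ((Real.exp (-‖x‖ ^ 2 / 2) : ℂ) * f x))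
      (fun m x => (‖t‖ * ‖x‖) ^ m / m.factorial * (Real.exp (-‖x‖ ^ 2 / 2) * ‖f x‖))
      (fun m => (Continuous.aestronglyMeasurable (by fun_prop)).mul hm)
      (fun m => ae_of_all _ fun x => ?_)
      (ae_of_all _ fun x => ?_) ?_ (ae_of_all _ fun x => ?_)
    · refine hs.unique ?_
      convert hasSum_zero with m
      have h1 := integral_inner_pow_gaussian_eq_zero hα hf h m t
      have h2 : ∀ x : EuclideanSpace ℝ (Fin d), (((inner ℝ x t : ℝ) : ℂ) * Complex.I) ^ m /
          m.factorial * ((Real.exp (-‖x‖ ^ 2 / 2) : ℂ) * f x) =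
          Complex.I ^ m / m.factorial * (((inner ℝ x t : ℝ) : ℂ) ^ m *
            ((Real.exp (-‖x‖ ^ 2 / 2) : ℂ) * f x)) := fun x => by ring
      simp only [h2]
      rw [integral_const_mul, h1, mul_zero]
    · rw [norm_mul, norm_mul, norm_div, norm_pow, norm_mul, Complex.norm_I, mul_one,
        Complex.norm_real, Complex.norm_real, Complex.norm_natCast, Real.norm_eq_abs (Real.exp _),
        Real.abs_exp]
      have h1 : ‖(inner ℝ x t : ℝ)‖ ≤ ‖t‖ * ‖x‖ := by
        rw [mul_comm]; exact norm_inner_le_norm x t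
      gcongr
    · exact (NormedSpace.expSeries_div_hasSum_exp (‖t‖ * ‖x‖)).summable.mul_right _
    · refine (integrable_exp_norm_mul_gaussian_mul hα ‖t‖ hf).congr (ae_of_all _ fun x => ?_)
      simp only
      rw [tsum_mul_right, (NormedSpace.expSeries_div_hasSum_exp (‖t‖ * ‖x‖)).tsum_eq,
        ← Real.exp_eq_exp_ℝ, mul_assoc]
    · have := NormedSpace.expSeries_div_hasSum_exp ((inner ℝ x t : ℝ) * Complex.I)
      rw [← Complex.exp_eq_exp_ℂ] at this
      exact this.mul_right _
  filter_upwards [h0] with x hx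
  have h1 : (Real.exp (-‖x‖ ^ 2 / 2) : ℂ) ≠ 0 := by
    exact_mod_cast (Real.exp_pos _).ne'
  exact (mul_eq_zero.1 hx).resolve_left h1

theorem span_hermiteLp_orthogonal (hα : ∀ j, -1 / 2 ≤ α j) :
    (Submodule.span ℂ (Set.range (hermiteLp hα)))ᗮ = ⊥ := by
  rw [Submodule.eq_bot_iff]
  intro f hf
  rw [Lp.eq_zero_iff_ae_eq_zero]
  refine ae_eq_zero_of_integral_hermiteFun_eq_zero hα (Lp.memLp f) fun n => ?_
  have h1 := (Submodule.mem_orthogonal _ _).1 hf _ (Submodule.subset_span ⟨n, rfl⟩)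
  rw [hermiteLp, inner_toLp_left] at h1
  simpa only [Complex.conj_ofReal] using h1

/-- The Hermite functions as a Hilbert basis. -/
def hermiteBasis (hα : ∀ j, -1 / 2 ≤ α j) :
    HilbertBasis (Fin d → ℕ) ℂ (Lp ℂ 2 (weightMeasure α)) :=
  HilbertBasis.mkOfOrthogonalEqBot (orthonormal_hermiteLp hα) (span_hermiteLp_orthogonal hα)

theorem hermiteBasis_apply (hα : ∀ j, -1 / 2 ≤ α j) (n : Fin d → ℕ) :
    hermiteBasis hα n = hermiteLp hα n := by
  rw [hermiteBasis, HilbertBasis.coe_mkOfOrthogonalEqBot]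

end

section
/-! ### The imaginary powers on `L²` -/

section Multiplier

variable {ι H : Type*} [NormedAddCommGroup H] [InnerProductSpace ℂ H]

theorem memℓp_multiplier (b : HilbertBasis ι ℂ H) {m : ι → ℂ} (hm : ∀ i, ‖m i‖ ≤ 1) (f : H) :
    Memℓp (fun i => m i * inner ℂ (b i) f) 2 := by
  refine Memℓp.mono' (lp.memℓp (b.repr f)) fun i => ?_
  rw [HilbertBasis.repr_apply_apply, norm_mul]
  exact mul_le_of_le_one_left (norm_nonneg _) (hm i)

/-- The operator which multiplies the coefficients in a Hilbert basis by a bounded sequence. -/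
def multiplierFun (b : HilbertBasis ι ℂ H) {m : ι → ℂ} (hm : ∀ i, ‖m i‖ ≤ 1) (f : H) : H :=
  b.repr.symm ⟨_, memℓp_multiplier b hm f⟩

theorem hasSum_multiplierFun (b : HilbertBasis ι ℂ H) {m : ι → ℂ} (hm : ∀ i, ‖m i‖ ≤ 1) (f : H) :
    HasSum (fun i => (m i * inner ℂ (b i) f) • b i) (multiplierFun b hm f) :=
  b.hasSum_repr_symm ⟨_, memℓp_multiplier b hm f⟩

theorem norm_multiplierFun_le (b : HilbertBasis ι ℂ H) {m : ι → ℂ} (hm : ∀ i, ‖m i‖ ≤ 1) (f : H) :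
    ‖multiplierFun b hm f‖ ≤ ‖f‖ := by
  rw [multiplierFun, LinearIsometryEquiv.norm_map, ← b.repr.norm_map f]
  refine lp.norm_mono two_ne_zero fun i => ?_
  rw [HilbertBasis.repr_apply_apply]
  refine (norm_mul _ _).trans_le ?_
  exact mul_le_of_le_one_left (norm_nonneg _) (hm i)

theorem inner_multiplierFun (b : HilbertBasis ι ℂ H) {m : ι → ℂ} (hm : ∀ i, ‖m i‖ ≤ 1) (f : H)
    (i : ι) : inner ℂ (b i) (multiplierFun b hm f) = m i * inner ℂ (b i) f := by
  rw [← HilbertBasis.repr_apply_apply, multiplierFun, LinearIsometryEquiv.apply_symm_apply]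

theorem hasSum_inner_multiplierFun (b : HilbertBasis ι ℂ H) {m : ι → ℂ} (hm : ∀ i, ‖m i‖ ≤ 1)
    (g f : H) : HasSum (fun i => m i * (inner ℂ g (b i) * inner ℂ (b i) f))
      (inner ℂ g (multiplierFun b hm f)) := by
  have h := b.hasSum_inner_mul_inner g (multiplierFun b hm f)
  simp only [inner_multiplierFun] at h
  exact h.congr_fun fun i => by ring

end Multiplier

variable {d : ℕ} {α : Fin d → ℝ}

/-- Since `|α| ≥ -d / 2`, the eigenvalue is at least `2d - d = d ≥ 1`. -/
theorem one_le_eigenvalue (hd : 0 < d) (hα : ∀ j, -1 / 2 ≤ α j) (n : Fin d → ℕ) :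
    1 ≤ eigenvalue α n := by
  have h1 : ∑ _j : Fin d, (-1 / 2 : ℝ) ≤ ∑ j, α j := Finset.sum_le_sum fun j _ => hα j
  rw [Finset.sum_const, Finset.card_univ, Fintype.card_fin, nsmul_eq_mul] at h1
  have h2 : 0 ≤ ∑ j, (n j : ℝ) := Finset.sum_nonneg fun j _ => Nat.cast_nonneg _
  have h3 : (1 : ℝ) ≤ d := by exact_mod_cast hd
  rw [eigenvalue]
  linarith

theorem norm_eigenvalue_cpow (hd : 0 < d) (hα : ∀ j, -1 / 2 ≤ α j) (γ : ℝ) (n : Fin d → ℕ) :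
    ‖((eigenvalue α n : ℝ) : ℂ) ^ (-(Complex.I * (γ : ℂ)))‖ = 1 := by
  rw [Complex.norm_cpow_eq_rpow_re_of_pos (by linarith [one_le_eigenvalue hd hα n])]
  simp

theorem imaginaryPower_eq (hd : 0 < d) (hα : ∀ j, -1 / 2 ≤ α j) (γ : ℝ)
    (f : Lp ℂ 2 (weightMeasure α)) :
    HasSum (spectralTerm hα γ f)
      (multiplierFun (hermiteBasis hα) (fun n => (norm_eigenvalue_cpow hd hα γ n).le) f) := by
  have h := hasSum_multiplierFun (hermiteBasis hα)
    (fun n => (norm_eigenvalue_cpow hd hα γ n).le) f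
  simp only [hermiteBasis_apply] at h
  exact h

theorem hasSum_spectralTerm (hd : 0 < d) (hα : ∀ j, -1 / 2 ≤ α j) (γ : ℝ)
    (f : Lp ℂ 2 (weightMeasure α)) :
    HasSum (spectralTerm hα γ f) (imaginaryPower hα γ f) :=
  (imaginaryPower_eq hd hα γ f).summable.hasSum

theorem norm_imaginaryPower_le (hd : 0 < d) (hα : ∀ j, -1 / 2 ≤ α j) (γ : ℝ)
    (f : Lp ℂ 2 (weightMeasure α)) : ‖imaginaryPower hα γ f‖ ≤ ‖f‖ := by
  rw [(hasSum_spectralTerm hd hα γ f).unique (imaginaryPower_eq hd hα γ f)]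
  exact norm_multiplierFun_le _ _ f

theorem imaginaryPower_add (hd : 0 < d) (hα : ∀ j, -1 / 2 ≤ α j) (γ : ℝ)
    (f g : Lp ℂ 2 (weightMeasure α)) :
    imaginaryPower hα γ (f + g) = imaginaryPower hα γ f + imaginaryPower hα γ g := by
  refine (hasSum_spectralTerm hd hα γ (f + g)).unique ?_
  refine ((hasSum_spectralTerm hd hα γ f).add (hasSum_spectralTerm hd hα γ g)).congr_fun fun n => ?_
  simp only [spectralTerm, inner_add_right, mul_add, add_smul]

theorem imaginaryPower_smul (hd : 0 < d) (hα : ∀ j, -1 / 2 ≤ α j) (γ : ℝ) (c : ℂ)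
    (f : Lp ℂ 2 (weightMeasure α)) :
    imaginaryPower hα γ (c • f) = c • imaginaryPower hα γ f := by
  refine (hasSum_spectralTerm hd hα γ (c • f)).unique ?_
  refine ((hasSum_spectralTerm hd hα γ f).const_smul c).congr_fun fun n => ?_
  simp only [spectralTerm, inner_smul_right, smul_smul]
  congr 1
  ring

/-- The imaginary power as a bounded operator on `L²`. -/
def imaginaryPowerL (hd : 0 < d) (hα : ∀ j, -1 / 2 ≤ α j) (γ : ℝ) :
    Lp ℂ 2 (weightMeasure α) →L[ℂ] Lp ℂ 2 (weightMeasure α) :=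
  LinearMap.mkContinuous
    { toFun := imaginaryPower hα γ
      map_add' := imaginaryPower_add hd hα γ
      map_smul' := imaginaryPower_smul hd hα γ } 1
    fun f => by rw [one_mul]; exact norm_imaginaryPower_le hd hα γ f

theorem imaginaryPowerL_apply (hd : 0 < d) (hα : ∀ j, -1 / 2 ≤ α j) (γ : ℝ)
    (f : Lp ℂ 2 (weightMeasure α)) : imaginaryPowerL hd hα γ f = imaginaryPower hα γ f := rfl

theorem hasSum_inner_imaginaryPower (hd : 0 < d) (hα : ∀ j, -1 / 2 ≤ α j) (γ : ℝ)
    (g f : Lp ℂ 2 (weightMeasure α)) :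
    HasSum (fun n => ((eigenvalue α n : ℝ) : ℂ) ^ (-(Complex.I * (γ : ℂ))) *
      (inner ℂ g (hermiteLp hα n) * inner ℂ (hermiteLp hα n) f))
      (inner ℂ g (imaginaryPower hα γ f)) := by
  have h := hasSum_inner_multiplierFun (hermiteBasis hα)
    (fun n => (norm_eigenvalue_cpow hd hα γ n).le) g f
  rw [← (hasSum_spectralTerm hd hα γ f).unique (imaginaryPower_eq hd hα γ f)] at h
  simp only [hermiteBasis_apply] at h
  exact h

/-- For a positive base, conjugating `λ ^ (iγ)` gives `λ ^ (-iγ)`. Duality thus stays within the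
same family of operators. -/
theorem inner_imaginaryPower_right (hd : 0 < d) (hα : ∀ j, -1 / 2 ≤ α j) (γ : ℝ)
    (g f : Lp ℂ 2 (weightMeasure α)) :
    inner ℂ g (imaginaryPower hα γ f) = inner ℂ (imaginaryPower hα (-γ) g) f := by
  refine (hasSum_inner_imaginaryPower hd hα γ g f).unique ?_
  have h := (Complex.hasSum_conj'.2 (hasSum_inner_imaginaryPower hd hα (-γ) f g))
  rw [inner_conj_symm] at h
  refine h.congr_fun fun n => ?_
  have h1 := one_le_eigenvalue hd hα n
  have h2 : (starRingEnd ℂ) (((eigenvalue α n : ℝ) : ℂ) ^ (-(Complex.I * ((-γ : ℝ) : ℂ)))) =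
      ((eigenvalue α n : ℝ) : ℂ) ^ (-(Complex.I * (γ : ℂ))) := by
    have h3 := Complex.cpow_conj ((eigenvalue α n : ℝ) : ℂ) (-(Complex.I * ((-γ : ℝ) : ℂ))) (by
      rw [Complex.arg_ofReal_of_nonneg (by linarith)]
      exact Real.pi_pos.ne)
    rw [Complex.conj_ofReal] at h3
    rw [← h3, map_neg, map_mul, Complex.conj_I, Complex.conj_ofReal]
    push_cast
    ring_nf
  rw [map_mul, map_mul, inner_conj_symm, inner_conj_symm, h2]
  ring

theorem summable_inner_hermiteLp (hα : ∀ j, -1 / 2 ≤ α j) (g f : Lp ℂ 2 (weightMeasure α)) :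
    Summable fun n => ‖inner ℂ g (hermiteLp hα n) * inner ℂ (hermiteLp hα n) f‖ := by
  have h := ((hermiteBasis hα).summable_inner_mul_inner g f).norm
  simp only [hermiteBasis_apply] at h
  exact h

theorem summable_exp_neg_eigenvalue {s : ℝ} (hs : 0 < s) :
    Summable fun n : Fin d → ℕ => Real.exp (-s * eigenvalue α n) := by
  have hg : Summable fun k : ℕ => Real.exp (-(2 * s)) ^ k :=
    summable_geometric_of_lt_one (Real.exp_pos _).le (Real.exp_lt_one_iff.2 (by linarith))
  have h1 : ∀ n : Fin d → ℕ, Real.exp (-s * eigenvalue α n) =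
      Real.exp (-s * (2 * (∑ j, α j) + 2 * (d : ℝ))) * ∏ j, Real.exp (-(2 * s)) ^ n j := by
    intro n
    rw [Finset.prod_pow_eq_pow_sum, ← Real.exp_nat_mul, ← Real.exp_add, eigenvalue]
    push_cast
    ring_nf
  simp only [h1]
  refine Summable.mul_left _ ?_
  -- A finite set of multi-indices lies in a box, over which the sum is a product of partial
  -- geometric sums.
  refine summable_of_sum_le (c := ∏ _j : Fin d, ∑' k : ℕ, Real.exp (-(2 * s)) ^ k)
    (fun n => by positivity) fun u => ?_
  calc ∑ n ∈ u, ∏ j, Real.exp (-(2 * s)) ^ n j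
      ≤ ∑ n ∈ Fintype.piFinset fun j => u.image fun n => n j,
          ∏ j, Real.exp (-(2 * s)) ^ n j := by
        refine Finset.sum_le_sum_of_subset_of_nonneg (fun n hn => ?_) fun _ _ _ => by positivity
        exact Fintype.mem_piFinset.2 fun j => Finset.mem_image_of_mem _ hn
    _ = ∏ j, ∑ k ∈ u.image fun n => n j, Real.exp (-(2 * s)) ^ k :=
        (Finset.prod_univ_sum _ _).symm
    _ ≤ _ := Finset.prod_le_prod (fun j _ => by positivity) fun j _ =>
        hg.sum_le_tsum _ fun _ _ => by positivity

end

section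
/-! ### Bounding imaginary powers by the subordinated semigroup -/

-- Split the Mellin integral at `t = R`. The pieces are at most `M R^δ / (1 + δ)` and `M R^δ / (1/2
-- - δ)`, and `δ ≤ 1/4` bounds their sum by `(1 + 4) M R^δ`.
open Filter Topology Set in
theorem norm_setIntegral_cpow_smul_le {F : ℝ → ℂ} {M R δ : ℝ} (hR : 0 < R)
    (hδ : 0 < δ) (hδ' : δ ≤ 1 / 4) (γ : ℝ) (hF1 : ∀ t, 0 < t → ‖F t‖ ≤ M * (t / R))
    (hF2 : ∀ t, 0 < t → ‖F t‖ ≤ M * (R / t) ^ (1 / 2 : ℝ)) :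
    ‖mellin F (δ + Complex.I * γ)‖ ≤ 5 * M * R ^ δ := by
  have hM : 0 ≤ M := by
    have := (norm_nonneg _).trans (hF1 R hR)
    rwa [div_self hR.ne', mul_one] at this
  let g : ℝ → ℝ := fun t => if t ≤ R then M / R * t ^ δ else M * R ^ (1 / 2 : ℝ) * t ^ (δ - 3 / 2)
  have hun : Ioc 0 R ∪ Ioi R = Ioi 0 := Ioc_union_Ioi_eq_Ioi hR.le
  have e1 : EqOn g (fun t => M / R * t ^ δ) (Ioc 0 R) := fun t ht => if_pos ht.2
  have e2 : EqOn g (fun t => M * R ^ (1 / 2 : ℝ) * t ^ (δ - 3 / 2)) (Ioi R) :=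
    fun t ht => if_neg (not_le.2 ht)
  have i1 : IntegrableOn g (Ioc 0 R) := by
    refine IntegrableOn.congr_fun ?_ e1.symm measurableSet_Ioc
    have := (intervalIntegral.intervalIntegrable_rpow' (a := 0) (b := R) (r := δ)
      (by linarith)).const_mul (M / R)
    rwa [intervalIntegrable_iff_integrableOn_Ioc_of_le hR.le] at this
  have i2 : IntegrableOn g (Ioi R) := by
    refine IntegrableOn.congr_fun ?_ e2.symm measurableSet_Ioi
    exact (integrableOn_Ioi_rpow_of_lt (by linarith) hR).const_mul _
  have hg : IntegrableOn g (Ioi 0) := hun ▸ i1.union i2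
  have hI : ∫ t in Ioi 0, g t = M * R ^ δ * (1 / (δ + 1) + 1 / (1 / 2 - δ)) := by
    rw [← hun, setIntegral_union (Ioc_disjoint_Ioi le_rfl) measurableSet_Ioi i1 i2,
      setIntegral_congr_fun measurableSet_Ioc e1, setIntegral_congr_fun measurableSet_Ioi e2,
      integral_const_mul, integral_const_mul, ← intervalIntegral.integral_of_le hR.le,
      integral_rpow (Or.inl (by linarith)), integral_Ioi_rpow_of_lt (by linarith) hR,
      Real.zero_rpow (by linarith), Real.rpow_add_one hR.ne',
      show R ^ δ = R ^ (1 / 2 : ℝ) * R ^ (δ - 3 / 2 + 1) by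
        rw [← Real.rpow_add hR]; congr 1; ring]
    have h1 : δ + 1 ≠ 0 := by linarith
    have h2 : 1 / 2 - δ ≠ 0 := by linarith
    have h3 : δ - 3 / 2 + 1 = -(1 / 2 - δ) := by ring
    have h4 : R ≠ 0 := hR.ne'
    rw [h3, neg_div_neg_eq]
    generalize R ^ (-(1 / 2 - δ)) = y
    generalize R ^ (1 / 2 : ℝ) = z
    field_simp
    ring
  have hb : ‖mellin F (δ + Complex.I * γ)‖ ≤ ∫ t in Ioi 0, g t := by
    refine norm_integral_le_of_norm_le hg ((ae_restrict_mem measurableSet_Ioi).mono fun t ht => ?_)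
    have ht : 0 < t := ht
    rw [norm_smul, Complex.norm_cpow_eq_rpow_re_of_pos ht]
    have hre : (((δ : ℂ) + Complex.I * γ) - 1).re = δ - 1 := by simp
    rw [hre]
    have hp : 0 ≤ t ^ (δ - 1) := by positivity
    by_cases h : t ≤ R
    · simp only [g, if_pos h]
      calc t ^ (δ - 1) * ‖F t‖ ≤ t ^ (δ - 1) * (M * (t / R)) := by gcongr; exact hF1 t ht
        _ = M / R * (t ^ (δ - 1) * t) := by ring
        _ = M / R * t ^ δ := by rw [← Real.rpow_add_one ht.ne']; ring_nf
    · simp only [g, if_neg h]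
      calc t ^ (δ - 1) * ‖F t‖ ≤ t ^ (δ - 1) * (M * (R / t) ^ (1 / 2 : ℝ)) := by
            gcongr; exact hF2 t ht
        _ = M * R ^ (1 / 2 : ℝ) * (t ^ (δ - 1) / t ^ (1 / 2 : ℝ)) := by
            rw [Real.div_rpow hR.le ht.le]; ring
        _ = _ := by rw [← Real.rpow_sub ht]; ring_nf
  refine hb.trans (hI.trans_le ?_)
  have h1 : 1 / (δ + 1) ≤ 1 := by rw [div_le_one (by linarith)]; linarith
  have h2 : 1 / (1 / 2 - δ) ≤ 4 := by rw [div_le_iff₀ (by linarith)]; linarith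
  have h3 : 0 ≤ M * R ^ δ := by positivity
  nlinarith

-- For exponents of positive real part `δ`, the formula `Γ(z) p^(-z) = ∫ t^(z-1) exp(-p t) dt` sums
-- to a Mellin transform of `F`. Both sides are continuous as `δ → 0`: the sum by domination with
-- `‖c i‖`, since `p i ≥ 1`, and Gamma because `iγ` is not a pole.
open Filter Topology Set in
theorem norm_tsum_cpow_le {ι : Type*} [Countable ι] {c : ι → ℂ} {p : ι → ℝ} (hp : ∀ i, 1 ≤ p i)
    (hc : Summable fun i => ‖c i‖) {F : ℝ → ℂ} {M R : ℝ} (hR : 0 < R)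
    (hF : ∀ t ∈ Ioi (0 : ℝ), HasSum (fun i => c i * Real.exp (-p i * t)) (F t))
    (hF1 : ∀ t, 0 < t → ‖F t‖ ≤ M * (t / R))
    (hF2 : ∀ t, 0 < t → ‖F t‖ ≤ M * (R / t) ^ (1 / 2 : ℝ)) {γ : ℝ} (hγ : γ ≠ 0) :
    ‖∑' i, (p i : ℂ) ^ (-(Complex.I * (γ : ℂ))) * c i‖ ≤ 5 * M / ‖Complex.Gamma (Complex.I * γ)‖ := by
  have hpole : ∀ m : ℕ, Complex.I * (γ : ℂ) ≠ -m := fun m h => hγ (by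
    have := congrArg Complex.im h
    simpa using this)
  have hG0 : Complex.Gamma (Complex.I * γ) ≠ 0 := Complex.Gamma_ne_zero hpole
  have hcont : ContinuousAt Complex.Gamma (Complex.I * γ) :=
    (Complex.differentiableAt_Gamma _ hpole).continuousAt
  let z : ℝ → ℂ := fun δ => δ + Complex.I * γ
  have hzc : Continuous z := by fun_prop
  have hz0 : z 0 = Complex.I * γ := by simp [z]
  have hz : Tendsto z (𝓝[>] 0) (𝓝 (Complex.I * γ)) := by
    rw [← hz0]
    exact (hzc.tendsto 0).mono_left nhdsWithin_le_nhds
  have hp0 : ∀ i, (p i : ℂ) ≠ 0 := fun i => Complex.ofReal_ne_zero.2 (by linarith [hp i])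
  have hnorm : ∀ i δ, ‖(p i : ℂ) ^ (-z δ)‖ = p i ^ (-δ) := fun i δ => by
    rw [Complex.norm_cpow_eq_rpow_re_of_pos (by linarith [hp i])]
    simp [z]
  have key : ∀ δ, 0 < δ → δ ≤ 1 / 4 →
      ‖∑' i, (p i : ℂ) ^ (-z δ) * c i‖ ≤ 5 * M * R ^ δ / ‖Complex.Gamma (z δ)‖ := by
    intro δ hδ hδ'
    have hre : (z δ).re = δ := by simp [z]
    have h := hasSum_mellin (a := c) (p := p) (F := F) (s := z δ)
      (fun i => Or.inr (by linarith [hp i])) (hre.symm ▸ hδ)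
      hF (by
        refine hc.of_nonneg_of_le (fun i => by have := hp i; positivity) fun i => ?_
        exact div_le_self (norm_nonneg _) (Real.one_le_rpow (hp i) (hre.symm ▸ hδ.le)))
    have hG : Complex.Gamma (z δ) ≠ 0 := Complex.Gamma_ne_zero_of_re_pos (hre.symm ▸ hδ)
    have h2 : HasSum (fun i => (p i : ℂ) ^ (-z δ) * c i) ((Complex.Gamma (z δ))⁻¹ * mellin F (z δ)) := by
      refine (h.mul_left (Complex.Gamma (z δ))⁻¹).congr_fun fun i => ?_
      rw [Complex.cpow_neg]
      field_simp
    rw [h2.tsum_eq, norm_mul, norm_inv, div_eq_inv_mul]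
    gcongr
    exact norm_setIntegral_cpow_smul_le hR hδ hδ' γ hF1 hF2
  have lim1 : Tendsto (fun δ => ‖∑' i, (p i : ℂ) ^ (-z δ) * c i‖) (𝓝[>] 0)
      (𝓝 ‖∑' i, (p i : ℂ) ^ (-(Complex.I * (γ : ℂ))) * c i‖) := by
    refine Tendsto.norm (tendsto_tsum_of_dominated_convergence hc (fun i => ?_) ?_)
    · refine Tendsto.mul_const _ ?_
      exact (continuousAt_const_cpow (hp0 i)).tendsto.comp hz.neg
    · filter_upwards [self_mem_nhdsWithin] with δ hδ i
      rw [norm_mul, hnorm]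
      refine mul_le_of_le_one_left (norm_nonneg _) ?_
      exact Real.rpow_le_one_of_one_le_of_nonpos (hp i) (neg_nonpos.2 (le_of_lt hδ))
  have lim2 : Tendsto (fun δ => 5 * M * R ^ δ / ‖Complex.Gamma (z δ)‖) (𝓝[>] 0)
      (𝓝 (5 * M * R ^ (0 : ℝ) / ‖Complex.Gamma (Complex.I * γ)‖)) := by
    refine Tendsto.div (Tendsto.const_mul _ ?_) (hcont.tendsto.comp hz).norm (norm_ne_zero_iff.2 hG0)
    exact ((Real.continuous_const_rpow hR.ne').tendsto 0).mono_left nhdsWithin_le_nhds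
  rw [Real.rpow_zero, mul_one] at lim2
  refine le_of_tendsto_of_tendsto lim1 lim2 ?_
  filter_upwards [Ioc_mem_nhdsGT (show (0 : ℝ) < 1 / 4 by norm_num)] with δ hδ
  exact key δ hδ.1 hδ.2

end

section
/-! ### The Hörmander condition -/

/-- Duality between `L¹` and bounded functions, with test functions also in `L²` so that they can be
paired inside the Hilbert space. The extremal test function is the phase `F / ‖F‖`. -/
theorem setLIntegral_enorm_le_of_forall {X : Type*} [MeasurableSpace X] {μ : Measure X}
    [SigmaFinite μ] {F : X → ℂ} (hF : MemLp F 2 μ) (hFm : StronglyMeasurable F) {A : Set X}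
    (hA : MeasurableSet A) {C : ℝ}
    (h : ∀ g : X → ℂ, MemLp g 2 μ → (∀ x, ‖g x‖ ≤ 1) → (∀ x ∉ A, g x = 0) →
      ‖∫ x, (starRingEnd ℂ) (g x) * F x ∂μ‖ ≤ C) :
    ∫⁻ x in A, ‖F x‖ₑ ∂μ ≤ ENNReal.ofReal C := by
  -- The phase belongs to `L²` only on sets of finite measure, so `A` is exhausted by such sets.
  have hS : A = ⋃ N, A ∩ spanningSets μ N := by
    rw [← Set.inter_iUnion, iUnion_spanningSets, Set.inter_univ]
  have hmono : Monotone fun N => A ∩ spanningSets μ N := fun _ _ hmn =>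
    Set.inter_subset_inter_right _ (monotone_spanningSets μ hmn)
  rw [hS, setLIntegral_iUnion_of_directed _ hmono.directed_le]
  refine iSup_le fun N => ?_
  have hm : MeasurableSet (A ∩ spanningSets μ N) := hA.inter (measurableSet_spanningSets μ N)
  have hfin : μ (A ∩ spanningSets μ N) ≠ ∞ :=
    ((measure_mono Set.inter_subset_right).trans_lt (measure_spanningSets_lt_top μ N)).ne
  let g : X → ℂ := (A ∩ spanningSets μ N).indicator fun x => F x / (‖F x‖ : ℂ)
  have hgm : StronglyMeasurable g := by
    refine StronglyMeasurable.indicator ?_ hm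
    exact (hFm.measurable.div (Complex.measurable_ofReal.comp hFm.measurable.norm)).stronglyMeasurable
  have hg1 : ∀ x, ‖g x‖ ≤ ‖(A ∩ spanningSets μ N).indicator (fun _ => (1 : ℝ)) x‖ := by
    intro x
    by_cases hx : x ∈ A ∩ spanningSets μ N
    · simp only [g, Set.indicator_of_mem hx, norm_one, norm_div, Complex.norm_real, norm_norm]
      exact div_self_le_one _
    · simp [g, Set.indicator_of_notMem hx]
  have hg2 : MemLp g 2 μ := MemLp.mono (memLp_indicator_const 2 hm (1 : ℝ) (Or.inr hfin))
    hgm.aestronglyMeasurable (ae_of_all _ hg1)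
  have hle := h g hg2 (fun x => (hg1 x).trans (by
    by_cases hx : x ∈ A ∩ spanningSets μ N
    · simp [Set.indicator_of_mem hx]
    · simp [Set.indicator_of_notMem hx])) (fun x hx => Set.indicator_of_notMem (fun h => hx h.1) _)
  have heq : ∀ x, (starRingEnd ℂ) (g x) * F x =
      (((A ∩ spanningSets μ N).indicator (fun x => ‖F x‖) x : ℝ) : ℂ) := by
    intro x
    by_cases hx : x ∈ A ∩ spanningSets μ N
    · simp only [g, Set.indicator_of_mem hx, map_div₀, Complex.conj_ofReal]
      by_cases h0 : F x = 0
      · simp [h0]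
      · have h1 : (‖F x‖ : ℂ) ≠ 0 := by simpa using h0
        rw [div_mul_eq_mul_div, Complex.conj_mul', sq, mul_div_assoc, div_self h1, mul_one]
    · simp [g, Set.indicator_of_notMem hx]
  simp only [heq] at hle
  rw [integral_complex_ofReal, integral_indicator hm, Complex.norm_real] at hle
  have hint : IntegrableOn F (A ∩ spanningSets μ N) μ := by
    have : IsFiniteMeasure (μ.restrict (A ∩ spanningSets μ N)) :=
      ⟨by rwa [Measure.restrict_apply_univ, lt_top_iff_ne_top]⟩
    exact (hF.restrict _).integrable one_le_two
  rw [← ofReal_integral_norm_eq_lintegral_enorm hint]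
  exact ENNReal.ofReal_le_ofReal ((le_abs_self _).trans hle)

variable {d : ℕ} {α : Fin d → ℝ}

/-! ### Spectral expansion and kernel estimates of the Mehler semigroup. -/

theorem inner_mehlerKernel_hermiteLp (hα : ∀ j, -1 / 2 ≤ α j) {s : ℝ} (hs : 0 < s)
    (x : EuclideanSpace ℝ (Fin d)) (n : Fin d → ℕ) :
    inner ℂ ((memLp_mehlerKernel hα hs x).toLp _) (hermiteLp hα n) =
      ((Real.exp (-(s / 2) * eigenvalue α n) * hermiteFun α n x : ℝ) : ℂ) := by
  rw [hermiteLp, inner_toLp, ← integral_mehlerKernel_mul_hermiteFun hα hs, ← integral_complex_ofReal]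
  simp only [Complex.conj_ofReal, Complex.ofReal_mul]

/-- Parseval in the Hermite basis, applied to `f` and the section of the kernel at `x`. The sum is
identified at every `x`, not merely almost everywhere. -/
theorem hasSum_integral_mehlerKernel (hα : ∀ j, -1 / 2 ≤ α j) {s : ℝ} (hs : 0 < s)
    (f : Lp ℂ 2 (weightMeasure α)) (x : EuclideanSpace ℝ (Fin d)) :
    HasSum (fun n => ((Real.exp (-(s / 2) * eigenvalue α n) * hermiteFun α n x : ℝ) : ℂ) *
      inner ℂ (hermiteLp hα n) f) (∫ y, (mehlerKernel α s x y : ℂ) * f y ∂weightMeasure α) := by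
  have h := (hermiteBasis hα).hasSum_inner_mul_inner ((memLp_mehlerKernel hα hs x).toLp _) f
  simp only [hermiteBasis_apply] at h
  rw [inner_toLp_left] at h
  simp only [Complex.conj_ofReal] at h
  exact h.congr_fun fun n => by rw [← inner_mehlerKernel_hermiteLp hα hs x n]

theorem integral_sq_hermiteFun (hα : ∀ j, -1 / 2 ≤ α j) (n : Fin d → ℕ) :
    Integrable (fun x => hermiteFun α n x ^ 2) (weightMeasure α) ∧
      ∫ x, hermiteFun α n x ^ 2 ∂weightMeasure α = 1 := by
  constructor
  · have h := (memLp_hermiteFun hα n).integrable_norm_pow two_ne_zero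
    refine h.congr (ae_of_all _ fun x => ?_)
    simp
  · have h := integral_hermiteFun_mul hα n n
    rw [if_pos rfl] at h
    rw [← h]
    simp only [sq]

/-- Integrating the pointwise expansion against `g` requires absolute convergence. The heat factors
are summable, and the `L¹` norms of `g` times a Hermite function are bounded by `∫ |g|² + 1`. -/
theorem hasSum_integral_conj_mul_mehler (hα : ∀ j, -1 / 2 ≤ α j) {s : ℝ} (hs : 0 < s)
    (g f : Lp ℂ 2 (weightMeasure α)) :
    HasSum (fun n => (inner ℂ g (hermiteLp hα n) * inner ℂ (hermiteLp hα n) f) *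
        Real.exp (-eigenvalue α n * (s / 2)))
      (∫ x, (starRingEnd ℂ) (g x) * ∫ y, (mehlerKernel α s x y : ℂ) * f y ∂weightMeasure α
        ∂weightMeasure α) := by
  let G : (Fin d → ℕ) → EuclideanSpace ℝ (Fin d) → ℂ := fun n x =>
    (starRingEnd ℂ) (g x) * (((Real.exp (-(s / 2) * eigenvalue α n) * hermiteFun α n x : ℝ) : ℂ) *
      inner ℂ (hermiteLp hα n) f)
  have hg := Lp.memLp g
  have hbase : ∀ n, Integrable (fun x => (starRingEnd ℂ) (g x) * (hermiteFun α n x : ℂ))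
      (weightMeasure α) := fun n => hg.star.integrable_mul (memLp_hermiteFun hα n)
  have hGeq : ∀ n, G n = fun x => ((starRingEnd ℂ) (g x) * (hermiteFun α n x : ℂ)) *
      ((Real.exp (-(s / 2) * eigenvalue α n) : ℝ) * inner ℂ (hermiteLp hα n) f) := by
    intro n
    funext x
    simp only [G]
    push_cast
    ring
  have hGint : ∀ n, Integrable (G n) (weightMeasure α) := fun n => by
    rw [hGeq]
    exact (hbase n).mul_const _
  have hG2 : Integrable (fun x => ‖g x‖ ^ 2) (weightMeasure α) := hg.integrable_norm_pow two_ne_zero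
  have hnb : ∀ n, ∫ x, ‖(starRingEnd ℂ) (g x) * (hermiteFun α n x : ℂ)‖ ∂weightMeasure α ≤
      (∫ x, ‖g x‖ ^ 2 ∂weightMeasure α) + 1 := by
    intro n
    obtain ⟨h1, h2⟩ := integral_sq_hermiteFun hα n
    rw [← h2, ← integral_add hG2 h1]
    refine integral_mono (hbase n).norm (hG2.add h1) fun x => ?_
    simp only [norm_mul, RCLike.norm_conj, Complex.norm_real, Real.norm_eq_abs]
    nlinarith [sq_nonneg (‖g x‖ - |hermiteFun α n x|), sq_abs (hermiteFun α n x), norm_nonneg (g x),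
      abs_nonneg (hermiteFun α n x)]
  have hsum : Summable fun n => ∫ x, ‖G n x‖ ∂weightMeasure α := by
    refine Summable.of_nonneg_of_le (fun n => integral_nonneg fun x => norm_nonneg _) (fun n => ?_)
      ((summable_exp_neg_eigenvalue (α := α) (half_pos hs)).mul_left
        (((∫ x, ‖g x‖ ^ 2 ∂weightMeasure α) + 1) * ‖f‖))
    rw [hGeq]
    simp only [norm_mul _ (((Real.exp (-(s / 2) * eigenvalue α n) : ℝ) : ℂ) * _)]
    rw [integral_mul_const, norm_mul, Complex.norm_real, Real.norm_of_nonneg (Real.exp_pos _).le,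
      mul_assoc, mul_comm (Real.exp _)]
    have h3 : ‖inner ℂ (hermiteLp hα n) f‖ ≤ ‖f‖ := by
      have := norm_inner_le_norm (𝕜 := ℂ) (hermiteLp hα n) f
      rwa [(orthonormal_hermiteLp hα).1 n, one_mul] at this
    gcongr
    exact hnb n
  have h := hasSum_integral_of_summable_integral_norm hGint hsum
  have h1 : ∀ x, ∑' n, G n x =
      (starRingEnd ℂ) (g x) * ∫ y, (mehlerKernel α s x y : ℂ) * f y ∂weightMeasure α := fun x => by
    rw [← (hasSum_integral_mehlerKernel hα hs f x).tsum_eq, tsum_mul_left]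
  simp only [h1] at h
  refine h.congr_fun fun n => ?_
  rw [hGeq, integral_mul_const, hermiteLp, L2.inner_def]
  have h2 : ∫ x, inner ℂ (g x) ((memLp_hermiteFun hα n).toLp _ x) ∂weightMeasure α =
      ∫ x, (starRingEnd ℂ) (g x) * (hermiteFun α n x : ℂ) ∂weightMeasure α := by
    refine integral_congr_ae ?_
    filter_upwards [(memLp_hermiteFun hα n).coeFn_toLp] with x hx
    rw [hx, RCLike.inner_apply, mul_comm]
  rw [h2]
  ring_nf

theorem lintegral_enorm_mehlerKernel_sub_le (hα : ∀ j, -1 / 2 ≤ α j) {s : ℝ} (hs : 0 < s)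
    (y c : EuclideanSpace ℝ (Fin d)) :
    ∫⁻ x, ‖mehlerKernel α s x y - mehlerKernel α s x c‖ₑ ∂weightMeasure α ≤
      ENNReal.ofReal ((12 * d * 2 ^ d) * ‖y - c‖ / √s) := by
  have h := integral_abs_mehlerKernel_sub_le hα hs y c
  have hi : Integrable (fun x => mehlerKernel α s y x - mehlerKernel α s c x) (weightMeasure α) :=
    (integrable_mehlerKernel hα hs y).sub (integrable_mehlerKernel hα hs c)
  have h2 := ofReal_integral_norm_eq_lintegral_enorm hi
  simp only [mehlerKernel_comm s _ y, mehlerKernel_comm s _ c]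
  rw [← h2]
  exact ENNReal.ofReal_le_ofReal h

/-- Chebyshev's inequality for the second moment. -/
theorem lintegral_enorm_mehlerKernel_le (hα : ∀ j, -1 / 2 ≤ α j) {s r : ℝ} (hs : 0 < s)
    (hr : 0 < r) (y : EuclideanSpace ℝ (Fin d)) {A : Set (EuclideanSpace ℝ (Fin d))}
    (hA : MeasurableSet A) (hAr : ∀ x ∈ A, r ≤ ‖y - x‖) :
    ∫⁻ x in A, ‖mehlerKernel α s x y‖ₑ ∂weightMeasure α ≤
      ENNReal.ofReal ((∑ j, (2 * α j + 4) * 2) * s / r ^ 2) := by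
  obtain ⟨h1, h2⟩ := integral_sq_norm_sub_mul_mehlerKernel_le hα hs y
  have h3 := h1.div_const (r ^ 2)
  calc ∫⁻ x in A, ‖mehlerKernel α s x y‖ₑ ∂weightMeasure α
      ≤ ∫⁻ x in A, ‖‖y - x‖ ^ 2 * mehlerKernel α s y x / r ^ 2‖ₑ ∂weightMeasure α := by
        refine setLIntegral_mono' hA fun x hx => ?_
        rw [enorm_le_iff_norm_le, mehlerKernel_comm, mul_div_right_comm, norm_mul,
          Real.norm_of_nonneg (by positivity : 0 ≤ ‖y - x‖ ^ 2 / r ^ 2)]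
        refine le_mul_of_one_le_left (norm_nonneg _) ?_
        rw [one_le_div (by positivity)]
        have := hAr x hx
        gcongr
    _ ≤ ∫⁻ x, ‖‖y - x‖ ^ 2 * mehlerKernel α s y x / r ^ 2‖ₑ ∂weightMeasure α :=
        setLIntegral_le_lintegral _ _
    _ = ENNReal.ofReal (∫ x, ‖y - x‖ ^ 2 * mehlerKernel α s y x / r ^ 2 ∂weightMeasure α) := by
        rw [← ofReal_integral_norm_eq_lintegral_enorm h3]
        congr 1
        refine integral_congr_ae (ae_of_all _ fun x => ?_)
        have := mehlerKernel_nonneg hα hs y x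
        exact Real.norm_of_nonneg (by positivity)
    _ ≤ _ := by
        rw [integral_div]
        gcongr

/-- The constant in the kernel estimates for the Mehler semigroup. -/
def kernelConst (α : Fin d → ℝ) : ℝ := 12 * d * 2 ^ d + 4 * ∑ j, (2 * α j + 4) * 2

/-- For the bound `t / r²` the two kernels are treated separately: off the double ball both `y` and
`c` have distance at least `r`, and the second moment applies to each. For `(r² / t)^(1/2)` the
support of `g` is ignored and the `L¹` Lipschitz bound is used. -/
theorem lintegral_enorm_mul_mehlerKernel_sub_le (hα : ∀ j, -1 / 2 ≤ α j) {t r : ℝ} (ht : 0 < t)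
    (hr : 0 < r) {y c : EuclideanSpace ℝ (Fin d)} (hy : y ∈ Metric.closedBall c r)
    {g : EuclideanSpace ℝ (Fin d) → ℂ} (hg1 : ∀ x, ‖g x‖ ≤ 1)
    (hg0 : ∀ x ∈ Metric.closedBall c (2 * r), g x = 0) :
    ∫⁻ x, ‖g x‖ₑ * ‖mehlerKernel α (2 * t) x y - mehlerKernel α (2 * t) x c‖ₑ ∂weightMeasure α ≤
      ENNReal.ofReal (kernelConst α * min (t / r ^ 2) ((r ^ 2 / t) ^ (1 / 2 : ℝ))) := by
  have hs : 0 < 2 * t := by linarith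
  have hB : 0 ≤ ∑ j, (2 * α j + 4) * 2 := Finset.sum_nonneg fun j _ => by linarith [hα j]
  have hA : (0 : ℝ) ≤ 12 * d * 2 ^ d := by positivity
  have hg1' : ∀ x, ‖g x‖ₑ ≤ 1 := fun x => by
    rw [← enorm_one (G := ℝ), enorm_le_iff_norm_le, norm_one]
    exact hg1 x
  have hyc : ‖y - c‖ ≤ r := by rwa [← dist_eq_norm]
  rcases min_choice (t / r ^ 2) ((r ^ 2 / t) ^ (1 / 2 : ℝ)) with h | h <;> rw [h]
  · let A := (Metric.closedBall c (2 * r))ᶜ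
    have hAm : MeasurableSet A := Metric.isClosed_closedBall.measurableSet.compl
    have hAn : ∀ x ∈ A, 2 * r < ‖x - c‖ := fun x hx => by
      rw [← dist_eq_norm]
      simpa [A] using hx
    have e1 := lintegral_enorm_mehlerKernel_le hα hs hr y hAm fun x hx => by
      have h1 := hAn x hx
      have h2 := norm_sub_le_norm_sub_add_norm_sub x y c
      rw [norm_sub_rev y x]
      linarith
    have e2 := lintegral_enorm_mehlerKernel_le hα hs hr c hAm fun x hx => by
      have h1 := hAn x hx
      rw [norm_sub_rev c x]
      linarith
    calc _ ≤ ∫⁻ x, A.indicator (fun x => ‖mehlerKernel α (2 * t) x y‖ₑ +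
            ‖mehlerKernel α (2 * t) x c‖ₑ) x ∂weightMeasure α := by
          refine lintegral_mono fun x => ?_
          by_cases hx : x ∈ A
          · rw [Set.indicator_of_mem hx]
            calc _ ≤ 1 * ‖mehlerKernel α (2 * t) x y - mehlerKernel α (2 * t) x c‖ₑ := by
                  gcongr; exact hg1' x
              _ ≤ _ := by rw [one_mul]; exact enorm_sub_le
          · rw [Set.indicator_of_notMem hx, hg0 x (by simpa [A] using hx)]
            simp
      _ = (∫⁻ x in A, ‖mehlerKernel α (2 * t) x y‖ₑ ∂weightMeasure α) +
            ∫⁻ x in A, ‖mehlerKernel α (2 * t) x c‖ₑ ∂weightMeasure α := by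
          rw [lintegral_indicator hAm, lintegral_add_right]
          have hc := (continuous_mehlerKernel hα (2 * t)).comp₂ continuous_id' 
            (continuous_const (y := c))
          exact hc.measurable.enorm
      _ ≤ _ := by
          refine (add_le_add e1 e2).trans ?_
          rw [← ENNReal.ofReal_add (by positivity) (by positivity)]
          refine ENNReal.ofReal_le_ofReal ?_
          rw [kernelConst]
          calc _ = (4 * ∑ j, (2 * α j + 4) * 2) * (t / r ^ 2) := by ring
            _ ≤ _ := by gcongr; linarith
  · calc _ ≤ ∫⁻ x, ‖mehlerKernel α (2 * t) x y - mehlerKernel α (2 * t) x c‖ₑ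
            ∂weightMeasure α := by
          refine lintegral_mono fun x => mul_le_of_le_one_left' (hg1' x)
      _ ≤ _ := by
          refine (lintegral_enorm_mehlerKernel_sub_le hα hs y c).trans (ENNReal.ofReal_le_ofReal ?_)
          have h1 : (r ^ 2 / t) ^ (1 / 2 : ℝ) = r / √t := by
            rw [← Real.sqrt_eq_rpow, Real.sqrt_div (by positivity), Real.sqrt_sq hr.le]
          have h2 : √t ≤ √(2 * t) := Real.sqrt_le_sqrt (by linarith)
          have h3 := Real.sqrt_pos.2 ht
          rw [h1, kernelConst, mul_div_assoc]
          gcongr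
          linarith

/-- Since `b` has mean zero, the kernel at the centre may be subtracted for free; Tonelli then moves
the `x` integral inside. -/
theorem norm_integral_conj_mul_mehler_le (hα : ∀ j, -1 / 2 ≤ α j) {t r : ℝ} (ht : 0 < t)
    (hr : 0 < r) {c : EuclideanSpace ℝ (Fin d)} {g b : EuclideanSpace ℝ (Fin d) → ℂ}
    (hgm : AEStronglyMeasurable g (weightMeasure α)) (hg1 : ∀ x, ‖g x‖ ≤ 1)
    (hg0 : ∀ x ∈ Metric.closedBall c (2 * r), g x = 0)
    (hb1 : Integrable b (weightMeasure α)) (hb2 : MemLp b 2 (weightMeasure α))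
    (hb0 : ∀ y ∉ Metric.closedBall c r, b y = 0) (hbi : ∫ y, b y ∂weightMeasure α = 0) :
    ‖∫ x, (starRingEnd ℂ) (g x) * ∫ y, (mehlerKernel α (2 * t) x y : ℂ) * b y ∂weightMeasure α
        ∂weightMeasure α‖ ≤
      (kernelConst α * ∫ y, ‖b y‖ ∂weightMeasure α) *
        min (t / r ^ 2) ((r ^ 2 / t) ^ (1 / 2 : ℝ)) := by
  have hs : 0 < 2 * t := by linarith
  have hB : 0 ≤ ∑ j, (2 * α j + 4) * 2 := Finset.sum_nonneg fun j _ => by linarith [hα j]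
  have hC : 0 ≤ kernelConst α := by rw [kernelConst]; positivity
  set m := min (t / r ^ 2) ((r ^ 2 / t) ^ (1 / 2 : ℝ)) with hm
  have hm0 : 0 ≤ m := by positivity
  have hK : Continuous fun p : EuclideanSpace ℝ (Fin d) × EuclideanSpace ℝ (Fin d) =>
      mehlerKernel α (2 * t) p.1 p.2 - mehlerKernel α (2 * t) p.1 c := by
    have h1 := continuous_mehlerKernel hα (2 * t)
    exact h1.sub (h1.comp₂ continuous_fst continuous_const)
  have hsub : ∀ x, ∫ y, (mehlerKernel α (2 * t) x y : ℂ) * b y ∂weightMeasure α =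
      ∫ y, ((mehlerKernel α (2 * t) x y - mehlerKernel α (2 * t) x c : ℝ) : ℂ) * b y
        ∂weightMeasure α := by
    intro x
    have h1 : Integrable (fun y => (mehlerKernel α (2 * t) x y : ℂ) * b y) (weightMeasure α) :=
      (memLp_mehlerKernel hα hs x).integrable_mul hb2
    have h2 : Integrable (fun y => (mehlerKernel α (2 * t) x c : ℂ) * b y) (weightMeasure α) :=
      hb1.const_mul _
    have h3 : ∫ y, (mehlerKernel α (2 * t) x c : ℂ) * b y ∂weightMeasure α = 0 := by
      rw [integral_const_mul, hbi, mul_zero]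
    rw [← sub_zero (∫ y, (mehlerKernel α (2 * t) x y : ℂ) * b y ∂weightMeasure α), ← h3,
      ← integral_sub h1 h2]
    refine integral_congr_ae (ae_of_all _ fun y => ?_)
    push_cast
    ring
  have key : ‖∫ x, (starRingEnd ℂ) (g x) * ∫ y, (mehlerKernel α (2 * t) x y : ℂ) * b y
      ∂weightMeasure α ∂weightMeasure α‖ₑ ≤
      ENNReal.ofReal ((kernelConst α * ∫ y, ‖b y‖ ∂weightMeasure α) * m) := by
    simp only [hsub]
    calc _ ≤ ∫⁻ x, ∫⁻ y, ‖g x‖ₑ * ‖mehlerKernel α (2 * t) x y - mehlerKernel α (2 * t) x c‖ₑ *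
          ‖b y‖ₑ ∂weightMeasure α ∂weightMeasure α := by
          refine (enorm_integral_le_lintegral_enorm _).trans (lintegral_mono fun x => ?_)
          rw [enorm_mul, RCLike.enorm_conj]
          refine (mul_le_mul_right (enorm_integral_le_lintegral_enorm _) _).trans ?_
          rw [← lintegral_const_mul'' _]
          · refine lintegral_mono fun y => le_of_eq ?_
            rw [enorm_mul, mul_assoc]
            congr 2
            rw [← ofReal_norm, Complex.norm_real, ofReal_norm]
          · refine (AEStronglyMeasurable.mul ?_ hb1.1).enorm
            exact (Complex.continuous_ofReal.comp
              (hK.comp₂ continuous_const continuous_id')).aestronglyMeasurable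
      _ = ∫⁻ y, ∫⁻ x, ‖g x‖ₑ * ‖mehlerKernel α (2 * t) x y - mehlerKernel α (2 * t) x c‖ₑ *
          ‖b y‖ₑ ∂weightMeasure α ∂weightMeasure α := by
          refine lintegral_lintegral_swap ?_
          refine AEMeasurable.mul (AEMeasurable.mul hgm.comp_fst.enorm ?_) hb1.1.comp_snd.enorm
          exact hK.measurable.enorm.aemeasurable
      _ ≤ ∫⁻ y, ENNReal.ofReal (kernelConst α * m) * ‖b y‖ₑ ∂weightMeasure α := by
          refine lintegral_mono fun y => ?_
          by_cases hy : y ∈ Metric.closedBall c r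
          · rw [lintegral_mul_const' _ _ enorm_ne_top]
            gcongr
            exact lintegral_enorm_mul_mehlerKernel_sub_le hα ht hr hy hg1 hg0
          · simp [hb0 y hy]
      _ = _ := by
          rw [lintegral_const_mul' _ _ ENNReal.ofReal_ne_top,
            ← ofReal_integral_norm_eq_lintegral_enorm hb1, ← ENNReal.ofReal_mul (by positivity)]
          congr 1
          ring
  rw [← ofReal_norm, ENNReal.ofReal_le_ofReal_iff] at key
  · exact key
  · have : 0 ≤ ∫ y, ‖b y‖ ∂weightMeasure α := integral_nonneg fun y => norm_nonneg _
    positivity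

/-- The constant in the Hörmander condition for the imaginary power. -/
def hormanderConst (α : Fin d → ℝ) (γ : ℝ) : ℝ :=
  5 * kernelConst α / ‖Complex.Gamma (Complex.I * γ)‖

/-- By duality it is enough to pair with bounded `g` vanishing on the double ball. The pairing is a
spectral sum whose heat version satisfies the hypotheses of `norm_tsum_cpow_le` with `R = r²`. -/
theorem setLIntegral_imaginaryPower_le (hd : 0 < d) (hα : ∀ j, -1 / 2 ≤ α j) {γ : ℝ} (hγ : γ ≠ 0)
    {r : ℝ} (hr : 0 < r) {c : EuclideanSpace ℝ (Fin d)} {b : EuclideanSpace ℝ (Fin d) → ℂ}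
    (hb1 : Integrable b (weightMeasure α)) (hb2 : MemLp b 2 (weightMeasure α))
    (hb0 : ∀ y ∉ Metric.closedBall c r, b y = 0) (hbi : ∫ y, b y ∂weightMeasure α = 0) :
    ∫⁻ x in (Metric.closedBall c (2 * r))ᶜ, ‖imaginaryPower hα γ (hb2.toLp b) x‖ₑ
      ∂weightMeasure α ≤
      ENNReal.ofReal (hormanderConst α γ) * ∫⁻ y, ‖b y‖ₑ ∂weightMeasure α := by
  have hB : 0 ≤ ∑ j, (2 * α j + 4) * 2 := Finset.sum_nonneg fun j _ => by linarith [hα j]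
  have hC : 0 ≤ kernelConst α := by rw [kernelConst]; positivity
  have hH : 0 ≤ hormanderConst α γ := by rw [hormanderConst]; positivity
  rw [← ofReal_integral_norm_eq_lintegral_enorm hb1, ← ENNReal.ofReal_mul hH]
  refine setLIntegral_enorm_le_of_forall (Lp.memLp _) (Lp.stronglyMeasurable _)
    Metric.isClosed_closedBall.measurableSet.compl fun g hg hg1 hg0 => ?_
  have hg0' : ∀ x ∈ Metric.closedBall c (2 * r), g x = 0 := fun x hx => hg0 x fun h => h hx
  rw [← inner_toLp_left hg, ← (hasSum_inner_imaginaryPower hd hα γ _ _).tsum_eq]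
  set M := kernelConst α * ∫ y, ‖b y‖ ∂weightMeasure α with hMdef
  have hM : 0 ≤ M := mul_nonneg hC (integral_nonneg fun y => norm_nonneg _)
  let F : ℝ → ℂ := fun t => ∫ x, (starRingEnd ℂ) (g x) *
    ∫ y, (mehlerKernel α (2 * t) x y : ℂ) * b y ∂weightMeasure α ∂weightMeasure α
  have hFb : ∀ t, 0 < t → ‖F t‖ ≤ M * min (t / r ^ 2) ((r ^ 2 / t) ^ (1 / 2 : ℝ)) := fun t ht =>
    norm_integral_conj_mul_mehler_le hα ht hr hg.1 hg1 hg0' hb1 hb2 hb0 hbi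
  have hF : ∀ t ∈ Set.Ioi (0 : ℝ), HasSum (fun n => (inner ℂ (hg.toLp g) (hermiteLp hα n) *
      inner ℂ (hermiteLp hα n) (hb2.toLp b)) * Real.exp (-eigenvalue α n * t)) (F t) := by
    intro t ht
    have h := hasSum_integral_conj_mul_mehler hα (mul_pos two_pos ht) (hg.toLp g) (hb2.toLp b)
    rw [mul_div_cancel_left₀ t two_ne_zero] at h
    have e : F t = ∫ x, (starRingEnd ℂ) (hg.toLp g x) *
        ∫ y, (mehlerKernel α (2 * t) x y : ℂ) * hb2.toLp b y ∂weightMeasure α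
          ∂weightMeasure α := by
      refine integral_congr_ae ?_
      filter_upwards [hg.coeFn_toLp] with x hx
      rw [hx]
      congr 1
      refine integral_congr_ae ?_
      filter_upwards [hb2.coeFn_toLp] with y hy
      rw [hy]
    rw [e]
    exact h
  refine (norm_tsum_cpow_le (M := M) (one_le_eigenvalue hd hα) (summable_inner_hermiteLp hα _ _)
    (pow_pos hr 2) hF (fun t ht => (hFb t ht).trans ?_) (fun t ht => (hFb t ht).trans ?_)
    hγ).trans_eq ?_
  · gcongr
    exact min_le_left _ _
  · gcongr
    exact min_le_right _ _
  · rw [hormanderConst, hMdef]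
    ring

end

section
/-! ### Doubling measures and the Calderón–Zygmund covering -/

/-- A measure which is doubling on all balls, the measure of a ball being large, uniformly in the
centre, if the radius is large. -/
structure IsDoublingGrowth {X : Type*} [PseudoMetricSpace X] [MeasurableSpace X] (μ : Measure X)
    (D : ℝ≥0) : Prop where
  doubling : ∀ x r, 0 < r → μ (Metric.closedBall x (2 * r)) ≤ D * μ (Metric.closedBall x r)
  growth : ∀ M : ℝ≥0∞, M ≠ ∞ → ∃ R : ℝ, ∀ x r, R ≤ r → M < μ (Metric.closedBall x r)

section

variable {X : Type*} [MetricSpace X] [MeasurableSpace X] {μ : Measure X} {D : ℝ≥0}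

theorem IsDoublingGrowth.measure_closedBall_two_pow_mul_le (h : IsDoublingGrowth μ D) (x : X)
    {r : ℝ} (hr : 0 < r) (k : ℕ) :
    μ (Metric.closedBall x (2 ^ k * r)) ≤ D ^ k * μ (Metric.closedBall x r) := by
  induction k with
  | zero => simp
  | succ k ih =>
    calc μ (Metric.closedBall x (2 ^ (k + 1) * r))
        = μ (Metric.closedBall x (2 * (2 ^ k * r))) := by ring_nf
      _ ≤ D * μ (Metric.closedBall x (2 ^ k * r)) := h.doubling x _ (by positivity)
      _ ≤ D * (D ^ k * μ (Metric.closedBall x r)) := by gcongr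
      _ = _ := by ring

/-- A null ball would, by doubling, make arbitrarily large concentric balls null, against the growth
condition. -/
theorem IsDoublingGrowth.measure_closedBall_pos (h : IsDoublingGrowth μ D) (x : X)
    {r : ℝ} (hr : 0 < r) : 0 < μ (Metric.closedBall x r) := by
  obtain ⟨R, hR⟩ := h.growth 0 ENNReal.zero_ne_top
  obtain ⟨k, hk⟩ := exists_nat_ge (R / r)
  have h1 : R ≤ 2 ^ k * r := by
    rw [div_le_iff₀ hr] at hk
    refine hk.trans (mul_le_mul_of_nonneg_right ?_ hr.le)
    exact_mod_cast (Nat.lt_two_pow_self (n := k)).le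
  have h2 := (hR x _ h1).trans_le (h.measure_closedBall_two_pow_mul_le x hr k)
  by_contra h0
  rw [not_lt, nonpos_iff_eq_zero] at h0
  simp [h0] at h2

/-- Growth bounds the radii with average above `l`, uniformly in the centre. A radius exceeding half
of their supremum has large average itself, while all radii from its double on have small average.
-/
theorem IsDoublingGrowth.exists_radius (h : IsDoublingGrowth μ D) {F : X → ℝ≥0∞}
    (hF : ∫⁻ x, F x ∂μ ≠ ∞) {l : ℝ≥0∞} (hl0 : l ≠ 0) (hl : l ≠ ∞) :
    ∃ R : ℝ, ∀ x, (∃ ρ > 0, l * μ (Metric.closedBall x ρ) < ∫⁻ y in Metric.closedBall x ρ, F y ∂μ) →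
      ∃ r, 0 < r ∧ r ≤ R ∧
        l * μ (Metric.closedBall x r) < ∫⁻ y in Metric.closedBall x r, F y ∂μ ∧
        ∀ ρ, 2 * r ≤ ρ → ∫⁻ y in Metric.closedBall x ρ, F y ∂μ ≤ l * μ (Metric.closedBall x ρ) := by
  obtain ⟨R, hR⟩ := h.growth ((∫⁻ x, F x ∂μ) / l) (ENNReal.div_ne_top hF hl0)
  refine ⟨R, fun x hx => ?_⟩
  let S : Set ℝ := {ρ | 0 < ρ ∧
    l * μ (Metric.closedBall x ρ) < ∫⁻ y in Metric.closedBall x ρ, F y ∂μ}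
  have hSR : ∀ ρ ∈ S, ρ ≤ R := by
    intro ρ hρ
    by_contra hc
    have h1 := hR x ρ (not_le.1 hc).le
    rw [ENNReal.div_lt_iff (Or.inl hl0) (Or.inl hl), mul_comm] at h1
    exact absurd (hρ.2.trans_le (setLIntegral_le_lintegral _ _)) (not_lt.2 h1.le)
  have hb : BddAbove S := ⟨R, hSR⟩
  obtain ⟨ρ₀, h0, h1⟩ := hx
  have hs : 0 < sSup S := h0.trans_le (le_csSup hb ⟨h0, h1⟩)
  obtain ⟨r, hr, hr2⟩ := exists_lt_of_lt_csSup (⟨ρ₀, h0, h1⟩ : S.Nonempty) (half_lt_self hs)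
  refine ⟨r, hr.1, hSR r hr, hr.2, fun ρ hρ => ?_⟩
  by_contra hc
  have hρS : ρ ∈ S := ⟨by linarith [hr.1], not_le.1 hc⟩
  have := le_csSup hb hρS
  linarith

/-- The Vitali covering lemma for the stopping balls. Its enlargement factor `5` is at least `2`, so
the stopping property controls the averages over the enlarged balls. -/
theorem IsDoublingGrowth.exists_covering [SecondCountableTopology X] (h : IsDoublingGrowth μ D)
    {F : X → ℝ≥0∞} (hF : ∫⁻ x, F x ∂μ ≠ ∞) {l : ℝ≥0∞} (hl0 : l ≠ 0) (hl : l ≠ ∞) :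
    ∃ (u : Set X) (r : X → ℝ), u.Countable ∧ (∀ x ∈ u, 0 < r x) ∧
      (u.PairwiseDisjoint fun x => Metric.closedBall x (r x)) ∧
      (∀ x ∈ u, l * μ (Metric.closedBall x (r x)) ≤ ∫⁻ y in Metric.closedBall x (r x), F y ∂μ) ∧
      (∀ x ∈ u, ∫⁻ y in Metric.closedBall x (5 * r x), F y ∂μ ≤
        l * μ (Metric.closedBall x (5 * r x))) ∧
      ∀ x, x ∉ (⋃ y ∈ u, Metric.closedBall y (5 * r y)) → ∀ ρ, 0 < ρ →
        ∫⁻ y in Metric.closedBall x ρ, F y ∂μ ≤ l * μ (Metric.closedBall x ρ) := by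
  classical
  obtain ⟨R, hR⟩ := h.exists_radius hF hl0 hl
  let E : Set X := {x | ∃ ρ > 0, l * μ (Metric.closedBall x ρ) <
    ∫⁻ y in Metric.closedBall x ρ, F y ∂μ}
  choose! r hr using hR
  obtain ⟨u, huE, hdisj, hcov⟩ := Vitali.exists_disjoint_subfamily_covering_enlargement_closedBall
    E (fun x => x) r R (fun x hx => (hr x hx).2.1) 5 (by norm_num)
  refine ⟨u, r, ?_, fun x hx => (hr x (huE hx)).1, hdisj, fun x hx => (hr x (huE hx)).2.2.1.le,
    fun x hx => (hr x (huE hx)).2.2.2 _ (by linarith [(hr x (huE hx)).1]), fun x hx ρ hρ => ?_⟩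
  · refine hdisj.countable_of_nonempty_interior fun x hx => ?_
    exact ⟨x, Metric.ball_subset_interior_closedBall (Metric.mem_ball_self (hr x (huE hx)).1)⟩
  · by_contra hc
    have hxE : x ∈ E := ⟨ρ, hρ, not_le.1 hc⟩
    obtain ⟨y, hy, hxy⟩ := hcov x hxE
    exact hx (Set.mem_biUnion hy (hxy (Metric.mem_closedBall_self (hr x hxE).1.le)))

-- Lebesgue differentiation for doubling measures: the value at almost every point is a limit of
-- averages over shrinking balls.
open Filter Topology in
theorem IsDoublingGrowth.ae_enorm_le [SecondCountableTopology X] [BorelSpace X]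
    [IsLocallyFiniteMeasure μ] (h : IsDoublingGrowth μ D) {f : X → ℂ} (hf : Integrable f μ)
    (l : ℝ≥0) :
    ∀ᵐ x ∂μ, (∀ ρ, 0 < ρ →
      ∫⁻ y in Metric.closedBall x ρ, ‖f y‖ₑ ∂μ ≤ l * μ (Metric.closedBall x ρ)) → ‖f x‖ ≤ l := by
  have : IsUnifLocDoublingMeasure μ :=
    ⟨D, eventually_mem_nhdsWithin.mono fun r hr x => h.doubling x r hr⟩
  filter_upwards [IsUnifLocDoublingMeasure.ae_tendsto_average (μ := μ)
    hf.norm.locallyIntegrable 1] with x hx hle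
  have h1 := hx (l := 𝓝[>] (0 : ℝ)) (fun _ => x) id tendsto_id
    (eventually_mem_nhdsWithin.mono fun r hr => Metric.mem_closedBall_self (by
      simpa using (le_of_lt hr : (0 : ℝ) ≤ r)))
  refine le_of_tendsto h1 (eventually_mem_nhdsWithin.mono fun r hr => ?_)
  have hr : 0 < r := hr
  have hpos := h.measure_closedBall_pos x hr
  have h2 := hle r hr
  rw [setAverage_eq, id, smul_eq_mul]
  rw [← ofReal_integral_norm_eq_lintegral_enorm hf.integrableOn] at h2
  by_cases htop : μ (Metric.closedBall x r) = ∞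
  · rw [Measure.real, htop]
    simp
  · rw [Measure.real, inv_mul_le_iff₀ (ENNReal.toReal_pos hpos.ne' htop), mul_comm]
    have h3 := ENNReal.toReal_mono (ENNReal.mul_ne_top ENNReal.coe_ne_top htop) h2
    rwa [ENNReal.toReal_ofReal (integral_nonneg fun _ => norm_nonneg _), ENNReal.toReal_mul] at h3

end

end

section
/-! ### The Calderón–Zygmund decomposition -/

theorem exists_pairwise_disjoint_subset {ι X : Type*} [Countable ι] [MeasurableSpace X]
    {S : ι → Set X} (hS : ∀ i, MeasurableSet (S i)) :
    ∃ Q : ι → Set X, (∀ i, MeasurableSet (Q i)) ∧ (∀ i, Q i ⊆ S i) ∧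
      Pairwise (Function.onFun Disjoint Q) ∧ ⋃ i, Q i = ⋃ i, S i := by
  classical
  obtain ⟨e, he⟩ := exists_injective_nat ι
  refine ⟨fun i => S i \ ⋃ j, ⋃ (_ : e j < e i), S j, fun i => (hS i).diff
    (MeasurableSet.iUnion fun j => MeasurableSet.iUnion fun _ => hS j),
    fun i => Set.sdiff_subset, ?_, ?_⟩
  · intro i j hij
    refine Set.disjoint_left.2 fun x hxi hxj => ?_
    rcases lt_trichotomy (e i) (e j) with h | h | h
    · exact hxj.2 (Set.mem_iUnion₂.2 ⟨i, h, hxi.1⟩)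
    · exact hij (he h)
    · exact hxi.2 (Set.mem_iUnion₂.2 ⟨j, h, hxj.1⟩)
  · refine (Set.iUnion_mono fun i => Set.sdiff_subset).antisymm fun x hx => ?_
    have hex : ∃ k, ∃ i, e i = k ∧ x ∈ S i := by
      obtain ⟨i, hi⟩ := Set.mem_iUnion.1 hx
      exact ⟨e i, i, rfl, hi⟩
    obtain ⟨i, hi, hxi⟩ := Nat.find_spec hex
    refine Set.mem_iUnion.2 ⟨i, hxi, fun hc => ?_⟩
    obtain ⟨j, hj, hxj⟩ := Set.mem_iUnion₂.1 hc
    exact Nat.find_min hex (hi ▸ hj) ⟨j, rfl, hxj⟩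

theorem hasSum_indicator_of_mem {ι X M : Type*} [AddCommMonoid M] [TopologicalSpace M]
    {S : ι → Set X} (hS : Pairwise (Function.onFun Disjoint S)) (φ : ι → X → M) {x : X} {i : ι}
    (hx : x ∈ S i) : HasSum (fun j => (S j).indicator (φ j) x) (φ i x) := by
  have h := hasSum_single (f := fun j => (S j).indicator (φ j) x) i fun j hj =>
    Set.indicator_of_notMem (fun hxj => Set.disjoint_left.1 (hS hj) hxj hx) _
  simpa only [Set.indicator_of_mem hx] using h

theorem hasSum_indicator_of_forall_notMem {ι X M : Type*} [AddCommMonoid M] [TopologicalSpace M]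
    {S : ι → Set X} (φ : ι → X → M) {x : X} (hx : ∀ i, x ∉ S i) :
    HasSum (fun j => (S j).indicator (φ j) x) 0 := by
  simp only [Set.indicator_of_notMem (hx _)]
  exact hasSum_zero

theorem hasSum_indicator_iUnion {ι X M : Type*} [AddCommMonoid M] [TopologicalSpace M]
    {S : ι → Set X} (hS : Pairwise (Function.onFun Disjoint S)) (φ : X → M) (x : X) :
    HasSum (fun j => (S j).indicator φ x) ((⋃ i, S i).indicator φ x) := by
  by_cases hx : x ∈ ⋃ i, S i
  · rw [Set.indicator_of_mem hx]
    obtain ⟨i, hi⟩ := Set.mem_iUnion.1 hx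
    exact hasSum_indicator_of_mem hS (fun _ => φ) hi
  · rw [Set.indicator_of_notMem hx]
    exact hasSum_indicator_of_forall_notMem (fun _ => φ) fun i hi => hx (Set.mem_iUnion.2 ⟨i, hi⟩)

theorem memLp_two_of_lintegral_sq {X : Type*} [MeasurableSpace X] {μ : Measure X} {f : X → ℂ}
    (hf : AEStronglyMeasurable f μ) (h : ∫⁻ x, ‖f x‖ₑ ^ 2 ∂μ ≠ ∞) : MemLp f 2 μ := by
  refine ⟨hf, ?_⟩
  rw [eLpNorm_lt_top_iff_lintegral_rpow_enorm_lt_top two_ne_zero ENNReal.ofNat_ne_top]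
  simpa using h.lt_top

theorem lintegral_sq_ne_top {X : Type*} [MeasurableSpace X] {μ : Measure X} {f : X → ℂ}
    (hf : MemLp f 2 μ) : ∫⁻ x, ‖f x‖ₑ ^ 2 ∂μ ≠ ∞ := by
  have h := hf.2
  rw [eLpNorm_lt_top_iff_lintegral_rpow_enorm_lt_top two_ne_zero ENNReal.ofNat_ne_top] at h
  simpa using h.ne

theorem ennreal_add_sq_le (a b : ℝ≥0∞) : (a + b) ^ 2 ≤ 4 * (a ^ 2 + b ^ 2) := by
  rcases le_total a b with h | h
  · calc (a + b) ^ 2 ≤ (b + b) ^ 2 := by gcongr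
      _ = 4 * b ^ 2 := by ring
      _ ≤ _ := by gcongr; exact le_add_self
  · calc (a + b) ^ 2 ≤ (a + a) ^ 2 := by gcongr
      _ = 4 * a ^ 2 := by ring
      _ ≤ _ := by gcongr; exact le_self_add

/-- The function is cut along disjoint pieces `Q i` of the enlarged balls, and the mean is removed
on the small ball `B i`. The `Q i` may have tiny measure, whereas the `B i` are disjoint and
comparable in measure to the enlarged balls, which keeps the correction below `D³ l`. The square
integrability of `∑ ‖b i‖` permits summing under a continuous operator on `L²`. -/
theorem IsDoublingGrowth.exists_decomposition {X : Type*} [MetricSpace X] [MeasurableSpace X]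
    [BorelSpace X] [SecondCountableTopology X] [ProperSpace X] {μ : Measure X}
    [IsLocallyFiniteMeasure μ] {D : ℝ≥0} (h : IsDoublingGrowth μ D) {f : X → ℂ}
    (hf1 : Integrable f μ) (hf2 : MemLp f 2 μ) {l : ℝ≥0} (hl : 0 < l) :
    ∃ (u : Set X) (r : X → ℝ) (b : u → X → ℂ) (g : X → ℂ), u.Countable ∧ (∀ i ∈ u, 0 < r i) ∧
      (∀ i, Integrable (b i) μ ∧ MemLp (b i) 2 μ ∧
        (∀ x ∉ Metric.closedBall (i : X) (5 * r i), b i x = 0) ∧ ∫ x, b i x ∂μ = 0) ∧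
      (∑' i, ∫⁻ x, ‖b i x‖ₑ ∂μ ≤ 2 * ∫⁻ x, ‖f x‖ₑ ∂μ) ∧
      MemLp g 2 μ ∧ (∫⁻ x, ‖g x‖ₑ ^ 2 ∂μ ≤ (1 + D ^ 3) * l * (2 * ∫⁻ x, ‖f x‖ₑ ∂μ)) ∧
      (∀ x, HasSum (fun i => b i x) (f x - g x)) ∧
      (∫⁻ x, (∑' i, ‖b i x‖ₑ) ^ 2 ∂μ ≠ ∞) ∧
      l * ∑' i : u, μ (Metric.closedBall (i : X) (5 * r i)) ≤ D ^ 3 * ∫⁻ x, ‖f x‖ₑ ∂μ := by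
  have hl0 : (l : ℝ≥0∞) ≠ 0 := by exact_mod_cast hl.ne'
  have hfin : ∫⁻ x, ‖f x‖ₑ ∂μ ≠ ∞ := hf1.2.ne
  obtain ⟨u, r, hu, hr, hdisj, hlow, hup, hoff⟩ := h.exists_covering hfin hl0 ENNReal.coe_ne_top
  have : Countable u := hu.to_subtype
  let B : u → Set X := fun i => Metric.closedBall (i : X) (r i)
  let S : u → Set X := fun i => Metric.closedBall (i : X) (5 * r i)
  have hri : ∀ i : u, 0 < r i := fun i => hr i i.2
  have hBS : ∀ i, B i ⊆ S i := fun i => Metric.closedBall_subset_closedBall (by linarith [hri i])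
  have hBm : ∀ i, MeasurableSet (B i) := fun i => Metric.isClosed_closedBall.measurableSet
  have hSm : ∀ i, MeasurableSet (S i) := fun i => Metric.isClosed_closedBall.measurableSet
  have hBd : Pairwise (Function.onFun Disjoint B) := fun i j hij =>
    hdisj i.2 j.2 fun hc => hij (Subtype.ext hc)
  obtain ⟨Q, hQm, hQS, hQd, hQU⟩ := exists_pairwise_disjoint_subset hSm
  have hB0 : ∀ i, μ (B i) ≠ 0 := fun i => (h.measure_closedBall_pos _ (hri i)).ne'
  have hBt : ∀ i, μ (B i) ≠ ∞ := fun i => measure_closedBall_lt_top.ne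
  -- Three doublings suffice because `5 ≤ 2³`.
  have hSB : ∀ i, μ (S i) ≤ D ^ 3 * μ (B i) := fun i =>
    (measure_mono (Metric.closedBall_subset_closedBall (by linarith [hri i]))).trans
      (h.measure_closedBall_two_pow_mul_le (i : X) (hri i) 3)
  -- Divided by the measure of `B i`, not of `Q i`: spread over `B i`, the constant carries exactly
  -- the mass of `f` on `Q i`.
  let c : u → ℂ := fun i => (∫ x in Q i, f x ∂μ) / ((μ (B i)).toReal : ℂ)
  have hcB : ∀ i, ‖c i‖ₑ * μ (B i) ≤ ∫⁻ x in Q i, ‖f x‖ₑ ∂μ := by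
    intro i
    have e : ‖c i‖ₑ * μ (B i) = ‖∫ x in Q i, f x ∂μ‖ₑ := by
      have h1 : ‖((μ (B i)).toReal : ℂ)‖ₑ = μ (B i) := by
        rw [← ofReal_norm, Complex.norm_real, Real.norm_of_nonneg ENNReal.toReal_nonneg,
          ENNReal.ofReal_toReal (hBt i)]
      have h2 : ((μ (B i)).toReal : ℂ) ≠ 0 := by
        simpa using ENNReal.toReal_ne_zero.2 ⟨hB0 i, hBt i⟩
      have h3 : ‖c i * ((μ (B i)).toReal : ℂ)‖ₑ = ‖∫ x in Q i, f x ∂μ‖ₑ := by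
        simp only [c, div_mul_cancel₀ _ h2]
      rwa [enorm_mul, h1] at h3
    rw [e]
    exact enorm_integral_le_lintegral_enorm _
  have hc : ∀ i, ‖c i‖ₑ ≤ D ^ 3 * l := by
    intro i
    have h1 : ‖c i‖ₑ * μ (B i) ≤ (D ^ 3 * l) * μ (B i) :=
      calc ‖c i‖ₑ * μ (B i) ≤ ∫⁻ x in Q i, ‖f x‖ₑ ∂μ := hcB i
        _ ≤ ∫⁻ x in S i, ‖f x‖ₑ ∂μ := lintegral_mono_set (hQS i)
        _ ≤ l * μ (S i) := hup i i.2
        _ ≤ l * (D ^ 3 * μ (B i)) := by gcongr; exact hSB i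
        _ = _ := by ring
    exact (ENNReal.mul_le_mul_iff_left (hB0 i) (hBt i)).1 h1
  let G : X → ℝ≥0∞ := fun x => ∑' i, (B i).indicator (fun _ => ‖c i‖ₑ) x
  have hGm : Measurable G := Measurable.tsum fun i => measurable_const.indicator (hBm i)
  have hGb : ∀ x, G x ≤ D ^ 3 * l := by
    intro x
    by_cases hx : ∃ i, x ∈ B i
    · obtain ⟨i, hi⟩ := hx
      rw [show G x = ‖c i‖ₑ from (hasSum_indicator_of_mem hBd (fun i _ => ‖c i‖ₑ) hi).tsum_eq]
      exact hc i
    · rw [show G x = 0 from (hasSum_indicator_of_forall_notMem (fun i _ => ‖c i‖ₑ)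
        (not_exists.1 hx)).tsum_eq]
      exact zero_le
  have hQf : ∑' i, ∫⁻ x in Q i, ‖f x‖ₑ ∂μ ≤ ∫⁻ x, ‖f x‖ₑ ∂μ := by
    rw [← lintegral_iUnion hQm hQd]
    exact setLIntegral_le_lintegral _ _
  have hcBf : ∑' i, ‖c i‖ₑ * μ (B i) ≤ ∫⁻ x, ‖f x‖ₑ ∂μ :=
    (ENNReal.tsum_le_tsum hcB).trans hQf
  have hG1 : ∫⁻ x, G x ∂μ ≤ ∫⁻ x, ‖f x‖ₑ ∂μ := by
    rw [lintegral_tsum fun i => (measurable_const.indicator (hBm i)).aemeasurable]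
    simp only [lintegral_indicator_const (hBm _)]
    exact hcBf
  let b : u → X → ℂ := fun i x => (Q i).indicator f x - (B i).indicator (fun _ => c i) x
  let g : X → ℂ := fun x => (⋃ i, Q i)ᶜ.indicator f x + ∑' i, (B i).indicator (fun _ => c i) x
  have hsumB : ∀ x, HasSum (fun i => (B i).indicator (fun _ => c i) x)
      (∑' i, (B i).indicator (fun _ => c i) x) := by
    intro x
    by_cases hx : ∃ i, x ∈ B i
    · obtain ⟨i, hi⟩ := hx
      exact (hasSum_indicator_of_mem hBd (fun i _ => c i) hi).summable.hasSum
    · exact (hasSum_indicator_of_forall_notMem (fun i _ => c i)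
        (not_exists.1 hx)).summable.hasSum
  have hnB : ∀ x i, ‖(B i).indicator (fun _ => c i) x‖ₑ = (B i).indicator (fun _ => ‖c i‖ₑ) x :=
    fun x i => by rw [enorm_indicator_eq_indicator_enorm]
  have hgG : ∀ x, ‖∑' i, (B i).indicator (fun _ => c i) x‖ₑ ≤ G x := fun x => by
    refine enorm_tsum_le_tsum_enorm.trans_eq ?_
    simp only [hnB, G]
  have hBint : ∀ i, Integrable ((B i).indicator fun _ => c i) μ := fun i =>
    (integrable_indicator_iff (hBm i)).2 (integrableOn_const (hBt i))
  have hgm : AEStronglyMeasurable g μ := by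
    refine (hf1.1.indicator (MeasurableSet.iUnion hQm).compl).add ?_
    exact aestronglyMeasurable_of_tendsto_ae Filter.atTop
      (f := fun (s : Finset u) x => ∑ i ∈ s, (B i).indicator (fun _ => c i) x)
      (fun s => Finset.aestronglyMeasurable_fun_sum s fun i _ => (hBint i).1)
      (ae_of_all _ fun x => hsumB x)
  have hgle : ∀ x, ‖g x‖ₑ ≤ (⋃ i, Q i)ᶜ.indicator (fun x => ‖f x‖ₑ) x + G x := fun x =>
    (enorm_add_le _ _).trans (add_le_add (by rw [enorm_indicator_eq_indicator_enorm]) (hgG x))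
  have hg1 : ∫⁻ x, ‖g x‖ₑ ∂μ ≤ 2 * ∫⁻ x, ‖f x‖ₑ ∂μ := by
    calc ∫⁻ x, ‖g x‖ₑ ∂μ ≤ ∫⁻ x, (‖f x‖ₑ + G x) ∂μ := by
          refine lintegral_mono fun x => (hgle x).trans ?_
          gcongr
          exact Set.indicator_le_self _ _ _
      _ = (∫⁻ x, ‖f x‖ₑ ∂μ) + ∫⁻ x, G x ∂μ := lintegral_add_right _ hGm
      _ ≤ _ := by rw [two_mul]; gcongr
  have hgb : ∀ᵐ x ∂μ, ‖g x‖ₑ ≤ (1 + D ^ 3) * l := by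
    filter_upwards [h.ae_enorm_le hf1 l] with x hx
    refine (hgle x).trans ?_
    rw [add_mul, one_mul]
    refine add_le_add ?_ (hGb x)
    by_cases hxQ : x ∈ ⋃ i, Q i
    · rw [Set.indicator_of_notMem (by simpa using hxQ)]
      exact zero_le
    · rw [Set.indicator_of_mem (by simpa using hxQ)]
      have := hx fun ρ hρ => hoff x (by rwa [hQU, Set.iUnion_subtype] at hxQ) ρ hρ
      rw [← ofReal_norm, ← ENNReal.ofReal_coe_nnreal]
      exact ENNReal.ofReal_le_ofReal this
  have hg2 : ∫⁻ x, ‖g x‖ₑ ^ 2 ∂μ ≤ (1 + D ^ 3) * l * (2 * ∫⁻ x, ‖f x‖ₑ ∂μ) := by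
    calc ∫⁻ x, ‖g x‖ₑ ^ 2 ∂μ ≤ ∫⁻ x, (1 + D ^ 3) * l * ‖g x‖ₑ ∂μ := by
          refine lintegral_mono_ae (hgb.mono fun x hx => ?_)
          rw [sq]
          gcongr
      _ = (1 + D ^ 3) * l * ∫⁻ x, ‖g x‖ₑ ∂μ := by
          rw [lintegral_const_mul'' _ hgm.enorm]
      _ ≤ _ := by gcongr
  have hble : ∀ i x, ‖b i x‖ₑ ≤ (Q i).indicator (fun x => ‖f x‖ₑ) x +
      (B i).indicator (fun _ => ‖c i‖ₑ) x := fun i x => by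
    refine enorm_sub_le.trans (add_le_add ?_ ?_) <;> rw [enorm_indicator_eq_indicator_enorm]
  refine ⟨u, r, b, g, hu, hr, fun i => ⟨?_, ?_, fun x hx => ?_, ?_⟩, ?_,
    memLp_two_of_lintegral_sq hgm (ne_top_of_le_ne_top (by finiteness) hg2), hg2, fun x => ?_, ?_, ?_⟩
  · exact (hf1.indicator (hQm i)).sub (hBint i)
  · exact (hf2.indicator (hQm i)).sub (memLp_indicator_const 2 (hBm i) (c i) (Or.inr (hBt i)))
  · have h1 : x ∉ Q i := fun hc => hx (hQS i hc)
    have h2 : x ∉ B i := fun hc => hx (hBS i hc)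
    simp only [b, Set.indicator_of_notMem h1, Set.indicator_of_notMem h2, sub_zero]
  · have h2 : ((μ (B i)).toReal : ℂ) ≠ 0 := by
      simpa using ENNReal.toReal_ne_zero.2 ⟨hB0 i, hBt i⟩
    simp only [b]
    rw [integral_sub (hf1.indicator (hQm i)) (hBint i), integral_indicator (hQm i),
      integral_indicator (hBm i), setIntegral_const, Measure.real, Complex.real_smul]
    simp only [c, mul_div_cancel₀ _ h2, sub_self]
  · calc ∑' i, ∫⁻ x, ‖b i x‖ₑ ∂μ
        ≤ ∑' i, ((∫⁻ x in Q i, ‖f x‖ₑ ∂μ) + ‖c i‖ₑ * μ (B i)) := by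
          refine ENNReal.tsum_le_tsum fun i => (lintegral_mono (hble i)).trans_eq ?_
          rw [lintegral_add_right _ (measurable_const.indicator (hBm i)),
            lintegral_indicator (hQm i), lintegral_indicator_const (hBm i)]
      _ ≤ _ := by
          rw [ENNReal.tsum_add, two_mul]
          gcongr
  · have h1 : f x - g x = (⋃ i, Q i).indicator f x - ∑' i, (B i).indicator (fun _ => c i) x := by
      have := congrFun (Set.indicator_self_add_compl (⋃ i, Q i) f) x
      simp only [Pi.add_apply] at this
      simp only [g]
      rw [← this]
      ring
    rw [h1]
    exact (hasSum_indicator_iUnion hQd f x).sub (hsumB x)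
  · have h1 : ∀ x, (∑' i, ‖b i x‖ₑ) ^ 2 ≤ 4 * (‖f x‖ₑ ^ 2 + D ^ 3 * l * G x) := by
      intro x
      have h2 : ∑' i, ‖b i x‖ₑ ≤ ‖f x‖ₑ + G x := by
        refine (ENNReal.tsum_le_tsum fun i => hble i x).trans ?_
        rw [ENNReal.tsum_add, (hasSum_indicator_iUnion hQd (fun x => ‖f x‖ₑ) x).tsum_eq]
        gcongr
        exact Set.indicator_le_self _ _ _
      calc (∑' i, ‖b i x‖ₑ) ^ 2 ≤ (‖f x‖ₑ + G x) ^ 2 := by gcongr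
        _ ≤ 4 * (‖f x‖ₑ ^ 2 + G x ^ 2) := ennreal_add_sq_le _ _
        _ ≤ _ := by
          gcongr
          rw [sq]
          gcongr
          exact hGb x
    refine ne_top_of_le_ne_top ?_ (lintegral_mono h1)
    rw [lintegral_const_mul' _ _ ENNReal.ofNat_ne_top,
      lintegral_add_right _ (hGm.const_mul _), lintegral_const_mul _ hGm]
    have h3 := lintegral_sq_ne_top hf2
    have h4 : ∫⁻ x, G x ∂μ ≠ ∞ := ne_top_of_le_ne_top hfin hG1
    finiteness
  · calc (l : ℝ≥0∞) * ∑' i, μ (S i) ≤ l * ∑' i, D ^ 3 * μ (B i) := by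
          gcongr with i
          exact hSB i
      _ = D ^ 3 * ∑' i, l * μ (B i) := by
          rw [ENNReal.tsum_mul_left, ENNReal.tsum_mul_left]
          ring
      _ ≤ D ^ 3 * ∑' i, ∫⁻ x in B i, ‖f x‖ₑ ∂μ := by
          gcongr with i
          exact hlow i i.2
      _ ≤ _ := by
          gcongr
          rw [← lintegral_iUnion hBm hBd]
          exact setLIntegral_le_lintegral _ _

end

section
/-! ### The weak type `(1, 1)` estimate -/

theorem lintegral_sq_eq_enorm_sq {X : Type*} [MeasurableSpace X] {μ : Measure X}
    (F : Lp ℂ 2 μ) : ∫⁻ x, ‖F x‖ₑ ^ 2 ∂μ = ‖F‖ₑ ^ 2 := by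
  rw [Lp.enorm_def, eLpNorm_eq_lintegral_rpow_enorm_toReal two_ne_zero ENNReal.ofNat_ne_top,
    ← ENNReal.rpow_natCast, ← ENNReal.rpow_mul]
  norm_num

/-- Hörmander's condition for an operator on `L²`: the image of a function with mean zero supported
in a ball is integrable off the double ball, with a uniform estimate. -/
def HormanderCondition {X : Type*} [MetricSpace X] [MeasurableSpace X] {μ : Measure X}
    (T : Lp ℂ 2 μ →L[ℂ] Lp ℂ 2 μ) (A : ℝ≥0) : Prop :=
  ∀ (c : X) (r : ℝ), 0 < r → ∀ (b : X → ℂ) (hb : MemLp b 2 μ), Integrable b μ →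
    (∀ x ∉ Metric.closedBall c r, b x = 0) → ∫ x, b x ∂μ = 0 →
    ∫⁻ x in (Metric.closedBall c (2 * r))ᶜ, ‖T (hb.toLp b) x‖ₑ ∂μ ≤ A * ∫⁻ x, ‖b x‖ₑ ∂μ

section

variable {X : Type*} [MetricSpace X] [MeasurableSpace X] [BorelSpace X]
  {μ : Measure X} [SigmaFinite μ] {T : Lp ℂ 2 μ →L[ℂ] Lp ℂ 2 μ} {A : ℝ≥0}

/-- The bad function is an infinite sum of atoms. Moving `T` to the test function as its adjoint
leaves a scalar pairing with the sum, which may be taken term by term by dominated convergence; each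
term is then moved back and estimated by Hörmander's condition. -/
theorem HormanderCondition.setLIntegral_le {ι : Type*} [Countable ι]
    (hH : HormanderCondition T A) {c : ι → X} {r : ι → ℝ} (hr : ∀ i, 0 < r i) {b : ι → X → ℂ}
    (hb1 : ∀ i, Integrable (b i) μ) (hb2 : ∀ i, MemLp (b i) 2 μ)
    (hb0 : ∀ i, ∀ x ∉ Metric.closedBall (c i) (r i), b i x = 0) (hbi : ∀ i, ∫ x, b i x ∂μ = 0)
    {f : X → ℂ} (hf : MemLp f 2 μ) (hsum : ∀ x, HasSum (fun i => b i x) (f x))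
    (hdom : ∫⁻ x, (∑' i, ‖b i x‖ₑ) ^ 2 ∂μ ≠ ∞) (htop : ∑' i, ∫⁻ x, ‖b i x‖ₑ ∂μ ≠ ∞) :
    ∫⁻ x in (⋃ i, Metric.closedBall (c i) (2 * r i))ᶜ, ‖T (hf.toLp f) x‖ₑ ∂μ ≤
      A * ∑' i, ∫⁻ x, ‖b i x‖ₑ ∂μ := by
  have hAt : A * ∑' i, ∫⁻ x, ‖b i x‖ₑ ∂μ ≠ ∞ := by finiteness
  rw [← ENNReal.ofReal_toReal hAt]
  have hΩ : MeasurableSet (⋃ i, Metric.closedBall (c i) (2 * r i)) :=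
    MeasurableSet.iUnion fun i => Metric.isClosed_closedBall.measurableSet
  refine setLIntegral_enorm_le_of_forall (Lp.memLp _) (Lp.stronglyMeasurable _) hΩ.compl
    fun φ hφ hφ1 hφ0 => ?_
  have hφ0' : ∀ i, ∀ x ∈ Metric.closedBall (c i) (2 * r i), φ x = 0 := fun i x hx =>
    hφ0 x fun h => h (Set.mem_iUnion.2 ⟨i, hx⟩)
  let ψ : Lp ℂ 2 μ := ContinuousLinearMap.adjoint T (hφ.toLp φ)
  have hpair : ∀ {k : X → ℂ} (hk : MemLp k 2 μ),
      ∫ x, (starRingEnd ℂ) (φ x) * T (hk.toLp k) x ∂μ = ∫ x, (starRingEnd ℂ) (ψ x) * k x ∂μ := by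
    intro k hk
    rw [← inner_toLp_left hφ, ← ContinuousLinearMap.adjoint_inner_left, L2.inner_def]
    refine integral_congr_ae ?_
    filter_upwards [hk.coeFn_toLp] with x hx
    rw [hx, RCLike.inner_apply, mul_comm]
  have hψm : AEStronglyMeasurable (fun x => (starRingEnd ℂ) (ψ x)) μ :=
    RCLike.continuous_conj.comp_aestronglyMeasurable (Lp.aestronglyMeasurable ψ)
  have hψb : ∀ i, AEStronglyMeasurable (fun x => (starRingEnd ℂ) (ψ x) * b i x) μ := fun i =>
    hψm.mul (hb1 i).1
  have hfin : ∑' i, ∫⁻ x, ‖(starRingEnd ℂ) (ψ x) * b i x‖ₑ ∂μ ≠ ∞ := by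
    rw [← lintegral_tsum fun i => (hψb i).enorm]
    have h1 : ∀ x, ∑' i, ‖(starRingEnd ℂ) (ψ x) * b i x‖ₑ ≤
        ‖ψ x‖ₑ ^ 2 + (∑' i, ‖b i x‖ₑ) ^ 2 := by
      intro x
      simp only [enorm_mul, RCLike.enorm_conj]
      rw [ENNReal.tsum_mul_left]
      rcases le_total ‖ψ x‖ₑ (∑' i, ‖b i x‖ₑ) with h | h
      · refine le_add_left ?_
        rw [sq]
        gcongr
      · refine le_add_right ?_
        rw [sq]
        gcongr
    refine ne_top_of_le_ne_top ?_ (lintegral_mono h1)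
    rw [lintegral_add_left' ((Lp.aestronglyMeasurable ψ).enorm.pow_const 2)]
    exact ENNReal.add_ne_top.2 ⟨lintegral_sq_ne_top (Lp.memLp ψ), hdom⟩
  have e1 : ∫ x, (starRingEnd ℂ) (φ x) * T (hf.toLp f) x ∂μ =
      ∑' i, ∫ x, (starRingEnd ℂ) (φ x) * T ((hb2 i).toLp (b i)) x ∂μ := by
    simp only [hpair]
    rw [← integral_tsum hψb hfin]
    refine integral_congr_ae (ae_of_all _ fun x => ?_)
    exact ((hsum x).mul_left _).tsum_eq.symm
  have key : ‖∫ x, (starRingEnd ℂ) (φ x) * T (hf.toLp f) x ∂μ‖ₑ ≤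
      A * ∑' i, ∫⁻ x, ‖b i x‖ₑ ∂μ := by
    rw [e1, ← ENNReal.tsum_mul_left]
    refine enorm_tsum_le_tsum_enorm.trans (ENNReal.tsum_le_tsum fun i => ?_)
    refine (enorm_integral_le_lintegral_enorm _).trans
      (le_trans ?_ (hH (c i) (r i) (hr i) (b i) (hb2 i) (hb1 i) (hb0 i) (hbi i)))
    rw [← lintegral_indicator Metric.isClosed_closedBall.measurableSet.compl]
    refine lintegral_mono fun x => ?_
    by_cases hx : x ∈ Metric.closedBall (c i) (2 * r i)
    · simp [hφ0' i x hx]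
    · rw [Set.indicator_of_mem (by exact hx), enorm_mul, RCLike.enorm_conj]
      refine mul_le_of_le_one_left' ?_
      rw [← enorm_one (G := ℝ), enorm_le_iff_norm_le, norm_one]
      exact hφ1 x
  rw [← ENNReal.toReal_ofReal (norm_nonneg _), ofReal_norm]
  exact ENNReal.toReal_mono hAt key

/-- The constant in the weak type estimate. -/
def weakConst (D A : ℝ≥0) : ℝ≥0 := 8 * (1 + D ^ 3) + D ^ 4 + 4 * A

/-- The good part is handled by Chebyshev in `L²` and the contraction property, the bad part off the
doubled balls by Hörmander's condition. The doubled balls themselves are discarded at the cost of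
one more doubling, hence `D ^ 4`. -/
theorem HormanderCondition.weak_type [SecondCountableTopology X] [ProperSpace X]
    [IsLocallyFiniteMeasure μ] {D : ℝ≥0} (h : IsDoublingGrowth μ D)
    (hT : ∀ f, ‖T f‖ ≤ ‖f‖) (hH : HormanderCondition T A) {f : X → ℂ} (hf1 : Integrable f μ)
    (hf2 : MemLp f 2 μ) (l : ℝ≥0) :
    l * μ {x | l < ‖T (hf2.toLp f) x‖₊} ≤ weakConst D A * ∫⁻ x, ‖f x‖ₑ ∂μ := by
  rcases eq_zero_or_pos l with rfl | hl
  · simp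
  obtain ⟨u, r, b, g, hu, hr, hb, hb3, hg2, hgI, hsum, hdom, hmeas⟩ :=
    h.exists_decomposition hf1 hf2 hl
  have : Countable u := hu.to_subtype
  set I := ∫⁻ x, ‖f x‖ₑ ∂μ with hI
  have hIfin : I ≠ ∞ := hf1.2.ne
  have hl0 : (l : ℝ≥0∞) ≠ 0 := by exact_mod_cast hl.ne'
  have hbad : MemLp (fun x => f x - g x) 2 μ := hf2.sub hg2
  have hsplit : T (hf2.toLp f) = T (hg2.toLp g) + T (hbad.toLp _) := by
    rw [← map_add, ← MemLp.toLp_add]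
    congr 1
    exact MemLp.toLp_congr _ _ (ae_of_all _ fun x => by simp)
  set Ω : Set X := ⋃ i : u, Metric.closedBall (i : X) (2 * (5 * r i)) with hΩ
  have hΩm : MeasurableSet Ω :=
    MeasurableSet.iUnion fun i => Metric.isClosed_closedBall.measurableSet
  have hB := hH.setLIntegral_le (c := fun i : u => (i : X)) (r := fun i : u => 5 * r i)
    (fun i => by have := hr i i.2; positivity) (fun i => (hb i).1) (fun i => (hb i).2.1)
    (fun i => (hb i).2.2.1) (fun i => (hb i).2.2.2) hbad hsum hdom
    (ne_top_of_le_ne_top (by finiteness) hb3)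
  -- Half of the level goes to each of the good and the bad part.
  set l' : ℝ≥0 := l / 2 with hl'
  have hl2 : (l : ℝ≥0∞) = 2 * l' := by
    rw [hl']; norm_cast; field_simp
  have hsub : {x | l < ‖T (hf2.toLp f) x‖₊} ≤ᵐ[μ] ({x | (l' : ℝ≥0∞) ^ 2 ≤ ‖T (hg2.toLp g) x‖ₑ ^ 2} ∪
      (Ω ∪ {x | (l' : ℝ≥0∞) ≤ Ωᶜ.indicator (fun x => ‖T (hbad.toLp _) x‖ₑ) x}) : Set X) := by
    have h1 := Lp.coeFn_add (T (hg2.toLp g)) (T (hbad.toLp _))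
    rw [← hsplit] at h1
    filter_upwards [h1] with x hx hlt
    have hlt : l < ‖T (hf2.toLp f) x‖₊ := hlt
    rw [hx, Pi.add_apply] at hlt
    by_contra hc
    have hc1 : x ∉ {x | (l' : ℝ≥0∞) ^ 2 ≤ ‖T (hg2.toLp g) x‖ₑ ^ 2} := fun hx => hc (Or.inl hx)
    have hc2 : x ∉ Ω := fun hx => hc (Or.inr (Or.inl hx))
    have hc3 : x ∉ {x | (l' : ℝ≥0∞) ≤ Ωᶜ.indicator (fun x => ‖T (hbad.toLp _) x‖ₑ) x} :=
      fun hx => hc (Or.inr (Or.inr hx))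
    rw [Set.mem_ofPred_eq, Set.indicator_of_mem (by exact hc2), not_le, enorm_eq_nnnorm,
      ENNReal.coe_lt_coe] at hc3
    have hc4 : ‖T (hg2.toLp g) x‖₊ < l' := by
      by_contra h5
      refine hc1 ?_
      rw [Set.mem_ofPred_eq, enorm_eq_nnnorm]
      have := not_lt.1 h5
      gcongr
    have h6 := nnnorm_add_le (T (hg2.toLp g) x) (T (hbad.toLp _) x)
    have h7 : l = l' + l' := by rw [hl', add_halves]
    exact absurd (hlt.trans_le h6) (not_lt.2 (h7 ▸ (add_lt_add hc4 hc3).le))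
  have m1 : l * μ {x | (l' : ℝ≥0∞) ^ 2 ≤ ‖T (hg2.toLp g) x‖ₑ ^ 2} ≤ 8 * (1 + D ^ 3) * I := by
    have h1 := mul_meas_ge_le_lintegral₀ (μ := μ) (f := fun x => ‖T (hg2.toLp g) x‖ₑ ^ 2)
      ((Lp.aestronglyMeasurable _).enorm.pow_const 2) ((l' : ℝ≥0∞) ^ 2)
    rw [lintegral_sq_eq_enorm_sq] at h1
    have h2 : ‖T (hg2.toLp g)‖ₑ ^ 2 ≤ ∫⁻ x, ‖g x‖ₑ ^ 2 ∂μ := by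
      have h3 : ∫⁻ x, ‖g x‖ₑ ^ 2 ∂μ = ‖hg2.toLp g‖ₑ ^ 2 := by
        rw [← lintegral_sq_eq_enorm_sq]
        refine lintegral_congr_ae ?_
        filter_upwards [hg2.coeFn_toLp] with x hx
        rw [hx]
      rw [h3]
      gcongr
      exact enorm_le_iff_norm_le.2 (hT _)
    have h4 := h1.trans (h2.trans hgI)
    rw [hl2] at h4 ⊢
    have hl'0 : (l' : ℝ≥0∞) ≠ 0 := by
      rw [Ne, ENNReal.coe_eq_zero, hl']; positivity
    rw [← ENNReal.mul_le_mul_iff_right hl'0 ENNReal.coe_ne_top]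
    calc (l' : ℝ≥0∞) * (2 * l' * μ {x | (l' : ℝ≥0∞) ^ 2 ≤ ‖T (hg2.toLp g) x‖ₑ ^ 2})
        = 2 * (l' ^ 2 * μ {x | (l' : ℝ≥0∞) ^ 2 ≤ ‖T (hg2.toLp g) x‖ₑ ^ 2}) := by ring
      _ ≤ 2 * ((1 + D ^ 3) * (2 * l') * (2 * I)) := by gcongr
      _ = _ := by ring
  have m2 : l * μ Ω ≤ D ^ 4 * I := by
    calc l * μ Ω ≤ l * ∑' i : u, D * μ (Metric.closedBall (i : X) (5 * r i)) := by
          gcongr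
          refine (measure_iUnion_le _).trans (ENNReal.tsum_le_tsum fun i => ?_)
          exact h.doubling _ _ (by have := hr i i.2; positivity)
      _ = D * (l * ∑' i : u, μ (Metric.closedBall (i : X) (5 * r i))) := by
          rw [ENNReal.tsum_mul_left]
          ring
      _ ≤ D * (D ^ 3 * I) := by gcongr
      _ = _ := by ring
  have m3 : l * μ {x | (l' : ℝ≥0∞) ≤ Ωᶜ.indicator (fun x => ‖T (hbad.toLp _) x‖ₑ) x} ≤
      4 * A * I := by
    have h1 := mul_meas_ge_le_lintegral₀ (μ := μ)
      (f := Ωᶜ.indicator (fun x => ‖T (hbad.toLp _) x‖ₑ))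
      ((Lp.aestronglyMeasurable _).enorm.indicator hΩm.compl) (l' : ℝ≥0∞)
    rw [lintegral_indicator hΩm.compl] at h1
    have h2 := h1.trans hB
    calc _ = 2 * (l' * μ {x | (l' : ℝ≥0∞) ≤ Ωᶜ.indicator (fun x => ‖T (hbad.toLp _) x‖ₑ) x}) := by
          rw [hl2]; ring
      _ ≤ 2 * (A * (2 * I)) := mul_le_mul_right (h2.trans (mul_le_mul_right hb3 _)) _
      _ = _ := by ring
  calc _ ≤ l * (μ {x | (l' : ℝ≥0∞) ^ 2 ≤ ‖T (hg2.toLp g) x‖ₑ ^ 2} + (μ Ω +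
        μ {x | (l' : ℝ≥0∞) ≤ Ωᶜ.indicator (fun x => ‖T (hbad.toLp _) x‖ₑ) x})) := by
        gcongr
        refine (measure_mono_ae hsub).trans ((measure_union_le _ _).trans ?_)
        gcongr
        exact measure_union_le _ _
    _ ≤ 8 * (1 + D ^ 3) * I + (D ^ 4 * I + 4 * A * I) := by
        rw [mul_add, mul_add]
        gcongr
    _ = _ := by
        rw [weakConst]
        push_cast
        ring

end

end

section
/-! ### Doubling of the weighted measure -/

/-- The outermost quarter of the interval on the side away from the origin has length `ρ / 2`, and
there `|v| ≥ (|u| + ρ) / 2`. -/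
theorem le_powMeasure_Icc {a : ℝ} (ha : -1 / 2 ≤ a) (u : ℝ) {ρ : ℝ} (hρ : 0 < ρ) :
    ENNReal.ofReal (ρ / 2 * ((|u| + ρ) / 2) ^ (2 * a + 1)) ≤
      powMeasure a (Set.Icc (u - ρ) (u + ρ)) := by
  have hb : 0 ≤ 2 * a + 1 := by linarith
  obtain ⟨y, h1, h2, h3⟩ : ∃ y : ℝ, u - ρ ≤ y ∧ y + ρ / 2 ≤ u + ρ ∧
      ∀ v ∈ Set.Icc y (y + ρ / 2), (|u| + ρ) / 2 ≤ |v| := by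
    rcases le_total 0 u with hu | hu
    · refine ⟨u + ρ / 2, by linarith, by linarith, fun v hv => ?_⟩
      rw [abs_of_nonneg hu]
      exact le_trans (by linarith [hv.1]) (le_abs_self v)
    · refine ⟨u - ρ, by linarith, by linarith, fun v hv => ?_⟩
      rw [abs_of_nonpos hu]
      exact le_trans (by linarith [hv.2]) (neg_le_abs v)
  calc ENNReal.ofReal (ρ / 2 * ((|u| + ρ) / 2) ^ (2 * a + 1))
      = ∫⁻ v in Set.Icc y (y + ρ / 2), ENNReal.ofReal (((|u| + ρ) / 2) ^ (2 * a + 1)) := by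
        rw [setLIntegral_const, Real.volume_Icc, ← ENNReal.ofReal_mul (by positivity)]
        congr 1
        ring
    _ ≤ ∫⁻ v in Set.Icc y (y + ρ / 2), ENNReal.ofReal (|v| ^ (2 * a + 1)) := by
        refine setLIntegral_mono' measurableSet_Icc fun v hv => ENNReal.ofReal_le_ofReal ?_
        exact Real.rpow_le_rpow (by positivity) (h3 v hv) hb
    _ = powMeasure a (Set.Icc y (y + ρ / 2)) := by
        rw [powMeasure, withDensity_apply _ measurableSet_Icc]
    _ ≤ _ := measure_mono (Set.Icc_subset_Icc h1 h2)

theorem powMeasure_Icc_le {a : ℝ} (ha : -1 / 2 ≤ a) (u : ℝ) {ρ : ℝ} (hρ : 0 < ρ) :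
    powMeasure a (Set.Icc (u - ρ) (u + ρ)) ≤
      ENNReal.ofReal (2 * ρ * (|u| + ρ) ^ (2 * a + 1)) := by
  have hb : 0 ≤ 2 * a + 1 := by linarith
  rw [powMeasure, withDensity_apply _ measurableSet_Icc]
  calc _ ≤ ∫⁻ v in Set.Icc (u - ρ) (u + ρ), ENNReal.ofReal ((|u| + ρ) ^ (2 * a + 1)) := by
        refine setLIntegral_mono' measurableSet_Icc fun v hv => ENNReal.ofReal_le_ofReal ?_
        refine Real.rpow_le_rpow (abs_nonneg _) ?_ hb
        have h1 : |v - u| ≤ ρ := abs_le.2 ⟨by linarith [hv.1], by linarith [hv.2]⟩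
        have h2 := abs_add_le u (v - u)
        rw [add_sub_cancel] at h2
        linarith
    _ = _ := by
        rw [setLIntegral_const, Real.volume_Icc, ← ENNReal.ofReal_mul (by positivity)]
        congr 1
        ring

theorem powMeasure_Icc_mul_le {a : ℝ} (ha : -1 / 2 ≤ a) (u : ℝ) {ρ k : ℝ} (hρ : 0 < ρ)
    (hk : 1 ≤ k) :
    powMeasure a (Set.Icc (u - k * ρ) (u + k * ρ)) ≤
      ENNReal.ofReal (4 * k * (2 * k) ^ (2 * a + 1)) * powMeasure a (Set.Icc (u - ρ) (u + ρ)) := by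
  have hb : 0 ≤ 2 * a + 1 := by linarith
  have hk0 : 0 < k := by linarith
  refine (powMeasure_Icc_le ha u (mul_pos hk0 hρ)).trans
    (le_trans ?_ (mul_le_mul_right (le_powMeasure_Icc ha u hρ) _))
  rw [← ENNReal.ofReal_mul (by positivity)]
  refine ENNReal.ofReal_le_ofReal ?_
  have h1 : (2 * k) ^ (2 * a + 1) * ((|u| + ρ) / 2) ^ (2 * a + 1) =
      (k * (|u| + ρ)) ^ (2 * a + 1) := by
    rw [← Real.mul_rpow (by positivity) (by positivity)]
    congr 1
    ring
  have h2 : (|u| + k * ρ) ^ (2 * a + 1) ≤ (k * (|u| + ρ)) ^ (2 * a + 1) := by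
    refine Real.rpow_le_rpow (by positivity) ?_ hb
    nlinarith [abs_nonneg u]
  calc 2 * (k * ρ) * (|u| + k * ρ) ^ (2 * a + 1)
      ≤ 2 * (k * ρ) * (k * (|u| + ρ)) ^ (2 * a + 1) := by gcongr
    _ = _ := by rw [← h1]; ring

variable {d : ℕ} {α : Fin d → ℝ}

/-- The cube with centre `c` and half side `ρ`. -/
def cube (c : EuclideanSpace ℝ (Fin d)) (ρ : ℝ) : Set (EuclideanSpace ℝ (Fin d)) :=
  {x | ∀ j, x j ∈ Set.Icc (c j - ρ) (c j + ρ)}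

theorem weightMeasure_cube (α : Fin d → ℝ) (c : EuclideanSpace ℝ (Fin d)) (ρ : ℝ) :
    weightMeasure α (cube c ρ) = ∏ j, powMeasure (α j) (Set.Icc (c j - ρ) (c j + ρ)) := by
  have h : MeasurableSet (cube c ρ) := by
    have : cube c ρ = ⋂ j, {x | x j ∈ Set.Icc (c j - ρ) (c j + ρ)} := by
      ext x
      simp [cube]
    rw [this]
    refine MeasurableSet.iInter fun j => ?_
    exact (by fun_prop : Measurable fun x : EuclideanSpace ℝ (Fin d) => x j) measurableSet_Icc
  rw [← (measurePreserving_toLp α).measure_preimage h.nullMeasurableSet, ← Measure.pi_pi]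
  congr 1
  ext x
  simp only [cube, Set.mem_preimage, Set.mem_ofPred_eq, Set.mem_pi, Set.mem_univ, true_imp_iff]
  rfl

theorem closedBall_subset_cube (c : EuclideanSpace ℝ (Fin d)) (r : ℝ) :
    Metric.closedBall c r ⊆ cube c r := by
  intro x hx j
  rw [Metric.mem_closedBall, dist_eq_norm] at hx
  have h := (PiLp.norm_apply_le (x - c) j).trans hx
  rw [Real.norm_eq_abs, PiLp.sub_apply, abs_le] at h
  exact ⟨by linarith [h.1], by linarith [h.2]⟩

theorem cube_subset_closedBall (hd : 0 < d) (c : EuclideanSpace ℝ (Fin d)) {r : ℝ} (hr : 0 < r) :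
    cube c (r / d) ⊆ Metric.closedBall c r := by
  intro x hx
  have hd1 : (1 : ℝ) ≤ d := by exact_mod_cast hd
  rw [Metric.mem_closedBall, dist_eq_norm, EuclideanSpace.norm_eq, Real.sqrt_le_left hr.le]
  calc ∑ j, ‖(x - c) j‖ ^ 2 ≤ ∑ _j : Fin d, (r / d) ^ 2 := by
        refine Finset.sum_le_sum fun j _ => ?_
        have h := hx j
        rw [Real.norm_eq_abs, PiLp.sub_apply]
        refine pow_le_pow_left₀ (abs_nonneg _) ?_ 2
        exact abs_le.2 ⟨by linarith [h.1], by linarith [h.2]⟩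
    _ = r ^ 2 / d := by
        rw [Finset.sum_const, Finset.card_univ, Fintype.card_fin, nsmul_eq_mul]
        field_simp
    _ ≤ r ^ 2 := div_le_self (by positivity) hd1

/-- The doubling constant of the weighted measure. -/
def doublingConst (α : Fin d → ℝ) : ℝ≥0 :=
  ∏ j, Real.toNNReal (4 * (2 * d) * (2 * (2 * d)) ^ (2 * α j + 1))

/-- Balls are compared with cubes, whose measures are products. The ball of radius `2r` lies in the
cube of half side `2r`, and the cube of half side `r / d` lies in the ball of radius `r`, so each
coordinate is dilated by `2d`. -/
theorem isDoublingGrowth_weightMeasure (hd : 0 < d) (hα : ∀ j, -1 / 2 ≤ α j) :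
    IsDoublingGrowth (weightMeasure α) (doublingConst α) := by
  have hd1 : (1 : ℝ) ≤ d := by exact_mod_cast hd
  constructor
  · intro x r hr
    have hρ : 0 < r / d := by positivity
    calc weightMeasure α (Metric.closedBall x (2 * r)) ≤ weightMeasure α (cube x (2 * r)) :=
          measure_mono (closedBall_subset_cube x _)
      _ = ∏ j, powMeasure (α j) (Set.Icc (x j - 2 * d * (r / d)) (x j + 2 * d * (r / d))) := by
          rw [weightMeasure_cube]
          have : 2 * d * (r / d) = 2 * r := by field_simp
          rw [this]
      _ ≤ ∏ j, (ENNReal.ofReal (4 * (2 * d) * (2 * (2 * d)) ^ (2 * α j + 1)) *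
            powMeasure (α j) (Set.Icc (x j - r / d) (x j + r / d))) :=
          Finset.prod_le_prod' fun j _ => powMeasure_Icc_mul_le (hα j) (x j) hρ (by linarith)
      _ = doublingConst α * weightMeasure α (cube x (r / d)) := by
          rw [Finset.prod_mul_distrib, weightMeasure_cube, doublingConst, ENNReal.ofNNReal_finsetProd]
          rfl
      _ ≤ _ := by
          gcongr
          exact cube_subset_closedBall hd x hr
  · intro M hM
    -- Then `r / d ≥ 2 (M + 1)`: in each coordinate the length factor is at least `M + 1` and the
    -- density factor at least `1`. The extra `1` gives strictness and makes the `d`-th power at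
    -- least the base.
    refine ⟨d * (2 * (M.toReal + 1)), fun x r hr => ?_⟩
    have hM0 : 0 ≤ M.toReal := ENNReal.toReal_nonneg
    have hr0 : 0 < r := lt_of_lt_of_le (by positivity) hr
    have h1 : 2 * (M.toReal + 1) ≤ r / d := by
      rwa [le_div_iff₀ (by positivity), mul_comm]
    have hρ : 0 < r / d := by positivity
    calc M = ENNReal.ofReal M.toReal := (ENNReal.ofReal_toReal hM).symm
      _ < ENNReal.ofReal (M.toReal + 1) :=
          (ENNReal.ofReal_lt_ofReal_iff (by positivity)).2 (by linarith)
      _ ≤ ENNReal.ofReal (M.toReal + 1) ^ d := by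
          refine le_self_pow₀ ?_ hd.ne'
          rw [ENNReal.one_le_ofReal]
          linarith
      _ = ∏ _j : Fin d, ENNReal.ofReal (M.toReal + 1) := by simp
      _ ≤ ∏ j, powMeasure (α j) (Set.Icc (x j - r / d) (x j + r / d)) := by
          refine Finset.prod_le_prod' fun j _ => le_trans ?_ (le_powMeasure_Icc (hα j) (x j) hρ)
          refine ENNReal.ofReal_le_ofReal ?_
          have h2 : 1 ≤ ((|x j| + r / d) / 2) ^ (2 * α j + 1) :=
            Real.one_le_rpow (by linarith [abs_nonneg (x j)]) (by linarith [hα j])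
          nlinarith
      _ = weightMeasure α (cube x (r / d)) := (weightMeasure_cube _ _ _).symm
      _ ≤ _ := measure_mono (cube_subset_closedBall hd x hr0)

theorem isLocallyFiniteMeasure_weightMeasure (hα : ∀ j, -1 / 2 ≤ α j) :
    IsLocallyFiniteMeasure (weightMeasure α) := by
  refine IsLocallyFiniteMeasure.withDensity_ofReal ?_
  unfold weight
  refine continuous_finsetProd _ fun j _ => ?_
  refine Continuous.rpow_const (by fun_prop) fun x => Or.inr ?_
  linarith [hα j]

/-! ### Weak type `(1, 1)` of the imaginary powers. -/

theorem norm_imaginaryPowerL_le (hd : 0 < d) (hα : ∀ j, -1 / 2 ≤ α j) (γ : ℝ)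
    (f : Lp ℂ 2 (weightMeasure α)) : ‖imaginaryPowerL hd hα γ f‖ ≤ ‖f‖ := by
  rw [imaginaryPowerL_apply]
  exact norm_imaginaryPower_le hd hα γ f

theorem hormanderCondition_imaginaryPowerL (hd : 0 < d) (hα : ∀ j, -1 / 2 ≤ α j) {γ : ℝ}
    (hγ : γ ≠ 0) :
    HormanderCondition (imaginaryPowerL hd hα γ) (hormanderConst α γ).toNNReal := by
  intro c r hr b hb2 hb1 hb0 hbi
  rw [imaginaryPowerL_apply]
  exact setLIntegral_imaginaryPower_le hd hα hγ hr hb1 hb2 hb0 hbi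

/-- An operator on `L²` is of weak type `(1, 1)` on `L¹ ∩ L²`. -/
def WeakTypeOne {X : Type*} [MeasurableSpace X] {μ : Measure X} (T : Lp ℂ 2 μ →L[ℂ] Lp ℂ 2 μ)
    (C : ℝ≥0) : Prop :=
  ∀ (f : X → ℂ) (_ : MemLp f 1 μ) (hf2 : MemLp f 2 μ) (l : ℝ≥0),
    l * μ {x | l < ‖T (hf2.toLp f) x‖₊} ≤ C * ∫⁻ x, ‖f x‖ₑ ∂μ

theorem HormanderCondition.weakTypeOne {X : Type*} [MetricSpace X] [MeasurableSpace X]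
    [BorelSpace X] [SecondCountableTopology X] [ProperSpace X] {μ : Measure X} [SigmaFinite μ]
    [IsLocallyFiniteMeasure μ] {T : Lp ℂ 2 μ →L[ℂ] Lp ℂ 2 μ} {A D : ℝ≥0}
    (h : IsDoublingGrowth μ D) (hT : ∀ f, ‖T f‖ ≤ ‖f‖) (hH : HormanderCondition T A) :
    WeakTypeOne T (weakConst D A) :=
  fun _ hf1 hf2 l => hH.weak_type h hT (memLp_one_iff_integrable.1 hf1) hf2 l

theorem exists_weakTypeOne_imaginaryPowerL (hd : 0 < d) (hα : ∀ j, -1 / 2 ≤ α j) {γ : ℝ}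
    (hγ : γ ≠ 0) : ∃ C, WeakTypeOne (imaginaryPowerL hd hα γ) C := by
  have := isLocallyFiniteMeasure_weightMeasure hα
  exact ⟨_, (hormanderCondition_imaginaryPowerL hd hα hγ).weakTypeOne
    (isDoublingGrowth_weightMeasure hd hα) (norm_imaginaryPowerL_le hd hα γ)⟩

end

section
/-! ### Interpolation between weak `L¹` and `L²` -/

section

variable {X : Type*} [MeasurableSpace X] {μ : Measure X}
  {T : Lp ℂ 2 μ →L[ℂ] Lp ℂ 2 μ} {C : ℝ≥0}

theorem lintegral_sq_map_le (hT : ∀ f, ‖T f‖ ≤ ‖f‖) {g : X → ℂ} (hg : MemLp g 2 μ) :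
    ∫⁻ x, ‖T (hg.toLp g) x‖ₑ ^ 2 ∂μ ≤ ∫⁻ x, ‖g x‖ₑ ^ 2 ∂μ := by
  have h3 : ∫⁻ x, ‖g x‖ₑ ^ 2 ∂μ = ‖hg.toLp g‖ₑ ^ 2 := by
    rw [← lintegral_sq_eq_enorm_sq]
    refine lintegral_congr_ae ?_
    filter_upwards [hg.coeFn_toLp] with x hx
    rw [hx]
  rw [h3, lintegral_sq_eq_enorm_sq]
  gcongr
  exact enorm_le_iff_norm_le.2 (hT _)

/-- Marcinkiewicz splitting at the height of the level set: the part of `f` above `2l` is treated by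
the weak type bound, the part below by `L²`. -/
theorem WeakTypeOne.sq_mul_meas_le (hT : ∀ f, ‖T f‖ ≤ ‖f‖) (hw : WeakTypeOne T C) {f : X → ℂ}
    (hf : StronglyMeasurable f) (hf2 : MemLp f 2 μ) {l : ℝ≥0} (hl : 0 < l) :
    l ^ 2 * μ {x | 2 * l < ‖T (hf2.toLp f) x‖₊} ≤
      C * l * ∫⁻ x in {x | 2 * l < ‖f x‖₊}, ‖f x‖ₑ ∂μ +
        ∫⁻ x in {x | 2 * l < ‖f x‖₊}ᶜ, ‖f x‖ₑ ^ 2 ∂μ := by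
  set S : Set X := {x | 2 * l < ‖f x‖₊} with hS
  have hSm : MeasurableSet S := measurableSet_lt measurable_const hf.measurable.nnnorm
  have h1 : MemLp (S.indicator f) 2 μ := hf2.indicator hSm
  have h2 : MemLp (Sᶜ.indicator f) 2 μ := hf2.indicator hSm.compl
  -- Where `|f| > 2l` one has `|f| ≤ |f|² / (2l)`, so the large part is integrable.
  have h11 : MemLp (S.indicator f) 1 μ := by
    rw [memLp_one_iff_integrable]
    refine ((hf2.integrable_norm_pow two_ne_zero).div_const (2 * l : ℝ)).mono'
      (hf.indicator hSm).aestronglyMeasurable (ae_of_all _ fun x => ?_)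
    by_cases hx : x ∈ S
    · rw [Set.indicator_of_mem hx, le_div_iff₀ (by positivity), sq]
      have : (2 * l : ℝ) ≤ ‖f x‖ := by exact_mod_cast (le_of_lt hx : 2 * l ≤ ‖f x‖₊)
      gcongr
    · rw [Set.indicator_of_notMem hx, norm_zero]
      positivity
  have hsplit : T (hf2.toLp f) = T (h1.toLp _) + T (h2.toLp _) := by
    rw [← map_add, ← MemLp.toLp_add]
    congr 1
    exact MemLp.toLp_congr _ _ (ae_of_all _ fun x => by
      rw [Set.indicator_self_add_compl])
  have hsub : {x | 2 * l < ‖T (hf2.toLp f) x‖₊} ≤ᵐ[μ] ({x | l < ‖T (h1.toLp _) x‖₊} ∪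
      {x | (l : ℝ≥0∞) ^ 2 ≤ ‖T (h2.toLp _) x‖ₑ ^ 2} : Set X) := by
    have h3 := Lp.coeFn_add (T (h1.toLp _)) (T (h2.toLp _))
    rw [← hsplit] at h3
    filter_upwards [h3] with x hx hlt
    have hlt : 2 * l < ‖T (hf2.toLp f) x‖₊ := hlt
    rw [hx, Pi.add_apply] at hlt
    by_contra hc
    have hc1 : ‖T (h1.toLp _) x‖₊ ≤ l := not_lt.1 fun hx => hc (Or.inl hx)
    have hc2 : ‖T (h2.toLp _) x‖₊ < l := by
      by_contra h5
      refine hc (Or.inr ?_)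
      rw [Set.mem_ofPred_eq, enorm_eq_nnnorm]
      have := not_lt.1 h5
      gcongr
    have h6 := nnnorm_add_le (T (h1.toLp _) x) (T (h2.toLp _) x)
    rw [two_mul] at hlt
    exact absurd (hlt.trans_le h6) (not_lt.2 (add_le_add hc1 hc2.le))
  calc (l : ℝ≥0∞) ^ 2 * μ {x | 2 * l < ‖T (hf2.toLp f) x‖₊}
      ≤ l ^ 2 * (μ {x | l < ‖T (h1.toLp _) x‖₊} +
          μ {x | (l : ℝ≥0∞) ^ 2 ≤ ‖T (h2.toLp _) x‖ₑ ^ 2}) := by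
        gcongr
        exact (measure_mono_ae hsub).trans (measure_union_le _ _)
    _ = l * (l * μ {x | l < ‖T (h1.toLp _) x‖₊}) +
          l ^ 2 * μ {x | (l : ℝ≥0∞) ^ 2 ≤ ‖T (h2.toLp _) x‖ₑ ^ 2} := by ring
    _ ≤ l * (C * ∫⁻ x, ‖S.indicator f x‖ₑ ∂μ) + ∫⁻ x, ‖Sᶜ.indicator f x‖ₑ ^ 2 ∂μ := by
        refine add_le_add (mul_le_mul_right (hw _ h11 h1 l) _) ?_
        exact (mul_meas_ge_le_lintegral₀ ((Lp.aestronglyMeasurable _).enorm.pow_const 2) _).trans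
          (lintegral_sq_map_le hT h2)
    _ = _ := by
        have e1 : ∀ x, ‖S.indicator f x‖ₑ = S.indicator (fun x => ‖f x‖ₑ) x := fun x => by
          rw [enorm_indicator_eq_indicator_enorm]
        have e2 : ∀ x, ‖Sᶜ.indicator f x‖ₑ ^ 2 = Sᶜ.indicator (fun x => ‖f x‖ₑ ^ 2) x := fun x => by
          rw [enorm_indicator_eq_indicator_enorm]
          by_cases hx : x ∈ Sᶜ
          · simp only [Set.indicator_of_mem hx]
          · simp [Set.indicator_of_notMem hx]
        simp only [e1, e2]
        rw [lintegral_indicator hSm, lintegral_indicator hSm.compl]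
        ring

theorem lintegral_Ioo_rpow {a q : ℝ} (ha : 0 ≤ a) (hq : 0 < q) :
    ∫⁻ t in Set.Ioo 0 a, ENNReal.ofReal (t ^ (q - 1)) = ENNReal.ofReal (a ^ q / q) := by
  have hi : IntegrableOn (fun t : ℝ => t ^ (q - 1)) (Set.Ioo 0 a) := by
    have := intervalIntegral.intervalIntegrable_rpow' (a := 0) (b := a) (r := q - 1) (by linarith)
    rw [intervalIntegrable_iff_integrableOn_Ioc_of_le ha] at this
    exact this.mono_set Set.Ioo_subset_Ioc_self
  rw [← ofReal_integral_eq_lintegral_ofReal hi ((ae_restrict_mem measurableSet_Ioo).mono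
    fun t ht => Real.rpow_nonneg ht.1.le _), ← integral_Ioc_eq_integral_Ioo,
    ← intervalIntegral.integral_of_le ha, integral_rpow (Or.inl (by linarith)), sub_add_cancel,
    Real.zero_rpow hq.ne', sub_zero]

theorem lintegral_Ici_rpow {a q : ℝ} (ha : 0 < a) (hq : 0 < q) :
    ∫⁻ t in Set.Ici a, ENNReal.ofReal (t ^ (-q - 1)) = ENNReal.ofReal (a ^ (-q) / q) := by
  rw [setLIntegral_congr Ioi_ae_eq_Ici.symm, ← ofReal_integral_eq_lintegral_ofReal
    (integrableOn_Ioi_rpow_of_lt (by linarith) ha) ((ae_restrict_mem measurableSet_Ioi).mono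
    fun t ht => Real.rpow_nonneg (ha.trans ht).le _), integral_Ioi_rpow_of_lt (by linarith) ha,
    sub_add_cancel, neg_div_neg_eq]

/-- The constant of the interpolated strong type estimate. -/
def interpConst (C : ℝ≥0) (p : ℝ) : ℝ≥0∞ :=
  ENNReal.ofReal p * (2 * C * ENNReal.ofReal (1 / (p - 1)) + 4 * ENNReal.ofReal (1 / (2 - p)))

/-- Layer cake formula with level `t = 2l`, then Tonelli. For fixed `x` the integrals of `t^(p-2)`
below `|f x|` and of `t^(p-3)` above it converge since `1 < p` and `p < 2`; they yield `1 / (p - 1)`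
and `1 / (2 - p)`. -/
theorem WeakTypeOne.lintegral_rpow_le [SFinite μ] (hT : ∀ f, ‖T f‖ ≤ ‖f‖) (hw : WeakTypeOne T C)
    {p : ℝ} (hp1 : 1 < p) (hp2 : p < 2) {f : X → ℂ} (hf : StronglyMeasurable f)
    (hf2 : MemLp f 2 μ) :
    ∫⁻ x, ‖T (hf2.toLp f) x‖ₑ ^ p ∂μ ≤ interpConst C p * ∫⁻ x, ‖f x‖ₑ ^ p ∂μ := by
  have hp0 : 0 < p := by linarith
  set F := T (hf2.toLp f) with hF
  have hnorm : ∀ z : ℂ, ‖z‖ₑ ^ p = ENNReal.ofReal (‖z‖ ^ p) := fun z => by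
    rw [← ofReal_norm, ENNReal.ofReal_rpow_of_nonneg (norm_nonneg _) hp0.le]
  let S : Set (ℝ × X) := {q | q.1 < ‖f q.2‖}
  have hfm := hf.measurable
  have hSm : MeasurableSet S := measurableSet_lt measurable_fst (hfm.comp measurable_snd).norm
  let k1 : ℝ × X → ℝ≥0∞ := S.indicator fun q => ENNReal.ofReal (q.1 ^ (p - 1 - 1)) * ‖f q.2‖ₑ
  let k2 : ℝ × X → ℝ≥0∞ :=
    Sᶜ.indicator fun q => ENNReal.ofReal (q.1 ^ (-(2 - p) - 1)) * ‖f q.2‖ₑ ^ 2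
  have hk1 : Measurable k1 := by
    refine Measurable.indicator ?_ hSm
    exact (measurable_fst.pow_const _).ennreal_ofReal.mul (hfm.comp measurable_snd).enorm
  have hk2 : Measurable k2 := by
    refine Measurable.indicator ?_ hSm.compl
    exact (measurable_fst.pow_const _).ennreal_ofReal.mul
      ((hfm.comp measurable_snd).enorm.pow_const 2)
  have hpt : ∀ t ∈ Set.Ioi (0 : ℝ), μ {x | t < ‖F x‖} * ENNReal.ofReal (t ^ (p - 1)) ≤
      2 * C * (∫⁻ x, k1 (t, x) ∂μ) + 4 * ∫⁻ x, k2 (t, x) ∂μ := by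
    intro t ht
    have ht : 0 < t := ht
    let l : ℝ≥0 := ⟨t / 2, by positivity⟩
    have hl : 0 < l := by rw [← NNReal.coe_pos]; exact half_pos ht
    have hlt : 2 * (l : ℝ) = t := mul_div_cancel₀ t two_ne_zero
    have hcast : ∀ z : ℂ, 2 * l < ‖z‖₊ ↔ t < ‖z‖ := fun z => by
      rw [← NNReal.coe_lt_coe, NNReal.coe_mul, coe_nnnorm, ← hlt]
      simp
    have h := hw.sq_mul_meas_le hT hf hf2 hl
    simp only [hcast] at h
    have hlE : ENNReal.ofReal t = 2 * l := by
      rw [← hlt, ENNReal.ofReal_mul zero_le_two]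
      simp
    have hS' : MeasurableSet {x | t < ‖f x‖} := measurableSet_lt measurable_const hfm.norm
    have e1 : ∫⁻ x, k1 (t, x) ∂μ =
        ENNReal.ofReal (t ^ (p - 1 - 1)) * ∫⁻ x in {x | t < ‖f x‖}, ‖f x‖ₑ ∂μ := by
      rw [← lintegral_const_mul' _ _ ENNReal.ofReal_ne_top, ← lintegral_indicator hS']
      rfl
    have e2 : ∫⁻ x, k2 (t, x) ∂μ =
        ENNReal.ofReal (t ^ (-(2 - p) - 1)) * ∫⁻ x in {x | t < ‖f x‖}ᶜ, ‖f x‖ₑ ^ 2 ∂μ := by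
      rw [← lintegral_const_mul' _ _ ENNReal.ofReal_ne_top, ← lintegral_indicator hS'.compl]
      rfl
    have e3 : ENNReal.ofReal (t ^ (p - 1)) =
        ENNReal.ofReal (t ^ (-(2 - p) - 1)) * ENNReal.ofReal t ^ 2 := by
      rw [← ENNReal.ofReal_pow ht.le, ← ENNReal.ofReal_mul (by positivity), ← Real.rpow_natCast,
        ← Real.rpow_add ht]
      congr 2
      push_cast
      ring
    have e4 : ENNReal.ofReal (t ^ (p - 1 - 1)) =
        ENNReal.ofReal (t ^ (-(2 - p) - 1)) * ENNReal.ofReal t := by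
      rw [← ENNReal.ofReal_mul (by positivity), ← Real.rpow_add_one ht.ne']
      congr 2
      ring
    rw [e1, e2, e3, e4, hlE]
    calc μ {x | t < ‖F x‖} * (ENNReal.ofReal (t ^ (-(2 - p) - 1)) * (2 * l) ^ 2)
        = 4 * ENNReal.ofReal (t ^ (-(2 - p) - 1)) * (l ^ 2 * μ {x | t < ‖F x‖}) := by ring
      _ ≤ _ := mul_le_mul_right h _
      _ = _ := by ring
  calc ∫⁻ x, ‖F x‖ₑ ^ p ∂μ = ENNReal.ofReal p * ∫⁻ t in Set.Ioi 0,
        μ {x | t < ‖F x‖} * ENNReal.ofReal (t ^ (p - 1)) := by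
        simp only [hnorm]
        exact lintegral_rpow_eq_lintegral_meas_lt_mul μ (ae_of_all _ fun x => norm_nonneg _)
          (Lp.aestronglyMeasurable F).norm.aemeasurable hp0
    _ ≤ ENNReal.ofReal p * ∫⁻ t in Set.Ioi 0,
        (2 * C * (∫⁻ x, k1 (t, x) ∂μ) + 4 * ∫⁻ x, k2 (t, x) ∂μ) := by
        exact mul_le_mul_right (setLIntegral_mono' measurableSet_Ioi hpt) _
    _ = ENNReal.ofReal p * (2 * C * (∫⁻ x, ∫⁻ t in Set.Ioi 0, k1 (t, x) ∂volume ∂μ) +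
        4 * ∫⁻ x, ∫⁻ t in Set.Ioi 0, k2 (t, x) ∂volume ∂μ) := by
        rw [lintegral_add_left (hk1.lintegral_prod_right'.const_mul _),
          lintegral_const_mul _ hk1.lintegral_prod_right',
          lintegral_const_mul _ hk2.lintegral_prod_right',
          lintegral_lintegral_swap (f := fun t x => k1 (t, x)) hk1.aemeasurable, lintegral_lintegral_swap (f := fun t x => k2 (t, x)) hk2.aemeasurable]
    _ ≤ ENNReal.ofReal p * (2 * C * (∫⁻ x, ENNReal.ofReal (1 / (p - 1)) * ‖f x‖ₑ ^ p ∂μ) +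
        4 * ∫⁻ x, ENNReal.ofReal (1 / (2 - p)) * ‖f x‖ₑ ^ p ∂μ) := by
        refine mul_le_mul_right (add_le_add (mul_le_mul_right (lintegral_mono fun x => ?_) _)
          (mul_le_mul_right (lintegral_mono fun x => ?_) _)) _
        · have h1 : ∀ t, (Set.Ioi (0 : ℝ)).indicator (fun t => k1 (t, x)) t =
              (Set.Ioo 0 ‖f x‖).indicator
                (fun t => ENNReal.ofReal (t ^ (p - 1 - 1)) * ‖f x‖ₑ) t := by
            intro t
            by_cases h0 : 0 < t <;> by_cases h1 : t < ‖f x‖ <;> simp [k1, S, Set.indicator, h0, h1]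
          rw [← lintegral_indicator measurableSet_Ioi]
          simp only [h1]
          rw [lintegral_indicator measurableSet_Ioo, lintegral_mul_const' _ _ enorm_ne_top,
            lintegral_Ioo_rpow (norm_nonneg _) (by linarith), hnorm, ← ofReal_norm,
            ← ENNReal.ofReal_mul (by have : 0 < p - 1 := by linarith
                                     positivity),
            ← ENNReal.ofReal_mul (by have : 0 < p - 1 := by linarith
                                     positivity)]
          refine ENNReal.ofReal_le_ofReal (le_of_eq ?_)
          rcases (norm_nonneg (f x)).eq_or_lt with h0 | h0
          · rw [← h0, Real.zero_rpow hp0.ne']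
            ring
          · have : ‖f x‖ ^ p = ‖f x‖ ^ (p - 1) * ‖f x‖ := by
              rw [← Real.rpow_add_one h0.ne', sub_add_cancel]
            rw [this]
            ring
        · have h1 : ∀ t, (Set.Ioi (0 : ℝ)).indicator (fun t => k2 (t, x)) t ≤
              (Set.Ici ‖f x‖).indicator
                (fun t => ENNReal.ofReal (t ^ (-(2 - p) - 1)) * ‖f x‖ₑ ^ 2) t := by
            intro t
            by_cases h0 : 0 < t <;> by_cases h1 : t < ‖f x‖ <;>
              simp [k2, S, Set.indicator, h0, h1, not_le.2, not_lt.1]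
          rw [← lintegral_indicator measurableSet_Ioi]
          refine (lintegral_mono h1).trans ?_
          rw [lintegral_indicator measurableSet_Ici,
            lintegral_mul_const' _ _ (ENNReal.pow_ne_top enorm_ne_top)]
          rcases (norm_nonneg (f x)).eq_or_lt with h0 | h0
          · have : f x = 0 := norm_eq_zero.1 h0.symm
            simp [this]
          · rw [lintegral_Ici_rpow h0 (by linarith), hnorm, ← ofReal_norm,
              ← ENNReal.ofReal_pow (norm_nonneg _),
              ← ENNReal.ofReal_mul (by have : 0 < 2 - p := by linarith
                                       positivity),
              ← ENNReal.ofReal_mul (by have : 0 < 2 - p := by linarith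
                                       positivity)]
            refine ENNReal.ofReal_le_ofReal (le_of_eq ?_)
            have : ‖f x‖ ^ p = ‖f x‖ ^ (-(2 - p)) * ‖f x‖ ^ 2 := by
              rw [← Real.rpow_natCast, ← Real.rpow_add h0]
              congr 1
              push_cast
              ring
            rw [this]
            ring
    _ = _ := by
        rw [lintegral_const_mul' _ _ ENNReal.ofReal_ne_top,
          lintegral_const_mul' _ _ ENNReal.ofReal_ne_top, interpConst]
        ring

end

end

section
/-! ### Strong type estimates -/

section

variable {X : Type*} [MeasurableSpace X] {μ : Measure X} {T S : Lp ℂ 2 μ →L[ℂ] Lp ℂ 2 μ}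

/-- Pair `F = T f` with `g = |F|^(p-2) F`, whose `q`-th power integral is that of `|F|^p`. Hölder
and the bound for the adjoint give `I ≤ J^(1/p) (K I)^(1/q)`, from which `I` is cancelled.
Truncating at `|F| ≤ N` keeps `g` in `L²`, because `p > 2`, and `I` finite, which the cancellation
needs. -/
theorem setLIntegral_rpow_le_of_adjoint {p q : ℝ} (hpq : p.HolderConjugate q) (hp2 : 2 < p)
    (hTS : ∀ g f, inner ℂ g (T f) = inner ℂ (S g) f) {K : ℝ≥0∞}
    (hS : ∀ (g : X → ℂ) (_ : StronglyMeasurable g) (hg : MemLp g 2 μ),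
      ∫⁻ x, ‖S (hg.toLp g) x‖ₑ ^ q ∂μ ≤ K * ∫⁻ x, ‖g x‖ₑ ^ q ∂μ)
    {f : X → ℂ} (hf : MemLp f 2 μ) (N : ℕ) :
    ∫⁻ x in {x | ‖T (hf.toLp f) x‖ ≤ N}, ‖T (hf.toLp f) x‖ₑ ^ p ∂μ ≤
      K ^ (p - 1) * ∫⁻ x, ‖f x‖ₑ ^ p ∂μ := by
  have hp0 : 0 < p := hpq.pos
  have hq0 : 0 < q := hpq.symm.pos
  set F := T (hf.toLp f) with hF
  have hFm : StronglyMeasurable F := Lp.stronglyMeasurable F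
  set A : Set X := {x | ‖F x‖ ≤ N} with hA
  have hAm : MeasurableSet A := measurableSet_le hFm.measurable.norm measurable_const
  let g : X → ℂ := A.indicator fun x => ((‖F x‖ ^ (p - 2) : ℝ) : ℂ) * F x
  have hgm : StronglyMeasurable g := by
    refine StronglyMeasurable.indicator ?_ hAm
    exact ((Complex.measurable_ofReal.comp (hFm.measurable.norm.pow_const _)).mul
      hFm.measurable).stronglyMeasurable
  have hg2 : MemLp g 2 μ := by
    refine MemLp.of_le_mul (c := (N : ℝ) ^ (p - 2)) (Lp.memLp F) hgm.aestronglyMeasurable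
      (ae_of_all _ fun x => ?_)
    by_cases hx : x ∈ A
    · simp only [g, Set.indicator_of_mem hx, norm_mul, Complex.norm_real]
      rw [Real.norm_of_nonneg (by positivity)]
      have h1 : ‖F x‖ ≤ N := hx
      have h2 : 0 ≤ p - 2 := by linarith
      gcongr
    · simp only [g, Set.indicator_of_notMem hx, norm_zero]
      positivity
  have hgF : ∀ x, (starRingEnd ℂ) (g x) * F x =
      ((A.indicator (fun x => ‖F x‖ ^ p) x : ℝ) : ℂ) := by
    intro x
    by_cases hx : x ∈ A
    · simp only [g, Set.indicator_of_mem hx, map_mul, Complex.conj_ofReal]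
      rw [mul_assoc, Complex.conj_mul', ← Complex.ofReal_pow, ← Complex.ofReal_mul]
      congr 1
      rcases (norm_nonneg (F x)).eq_or_lt with h0 | h0
      · rw [← h0, Real.zero_rpow hp0.ne']
        simp
      · rw [← Real.rpow_natCast, ← Real.rpow_add h0]
        congr 1
        push_cast
        ring
    · simp [g, Set.indicator_of_notMem hx]
  have hnorm : ∀ x, ENNReal.ofReal (‖F x‖ ^ p) = ‖F x‖ₑ ^ p := fun x => by
    rw [← ofReal_norm, ENNReal.ofReal_rpow_of_nonneg (norm_nonneg _) hp0.le]
  have hint : Integrable (fun x => A.indicator (fun x => ‖F x‖ ^ p) x) μ := by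
    have h1 : Integrable (fun x => (starRingEnd ℂ) (g x) * F x) μ :=
      hg2.star.integrable_mul (Lp.memLp F)
    simp only [hgF] at h1
    simpa using h1.re
  set I := ∫⁻ x in A, ‖F x‖ₑ ^ p ∂μ with hI
  set J := ∫⁻ x, ‖f x‖ₑ ^ p ∂μ with hJ
  have hIeq : I = ENNReal.ofReal (∫ x, A.indicator (fun x => ‖F x‖ ^ p) x ∂μ) := by
    have hnn : ∀ x, 0 ≤ A.indicator (fun x => ‖F x‖ ^ p) x :=
      fun x => Set.indicator_nonneg (fun x _ => by positivity) x
    rw [ofReal_integral_eq_lintegral_ofReal hint (ae_of_all _ hnn), hI, ← lintegral_indicator hAm]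
    refine lintegral_congr fun x => ?_
    by_cases hx : x ∈ A
    · simp only [Set.indicator_of_mem hx, hnorm]
    · simp [Set.indicator_of_notMem hx]
  have hIfin : I ≠ ∞ := by rw [hIeq]; exact ENNReal.ofReal_ne_top
  have hgq : ∫⁻ x, ‖g x‖ₑ ^ q ∂μ = I := by
    rw [hI, ← lintegral_indicator hAm]
    refine lintegral_congr fun x => ?_
    by_cases hx : x ∈ A
    · simp only [g, Set.indicator_of_mem hx]
      rw [← hnorm, ← ofReal_norm, ENNReal.ofReal_rpow_of_nonneg (norm_nonneg _) hq0.le, norm_mul,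
        Complex.norm_real, Real.norm_of_nonneg (by positivity)]
      congr 1
      rcases (norm_nonneg (F x)).eq_or_lt with h0 | h0
      · rw [← h0, mul_zero, Real.zero_rpow hp0.ne', Real.zero_rpow hq0.ne']
      · rw [← Real.rpow_add_one h0.ne', ← Real.rpow_mul h0.le]
        congr 1
        have := hpq.sub_one_mul_conj
        linarith
    · simp [g, Set.indicator_of_notMem hx, hq0]
  have hmain : I ≤ J ^ (1 / p) * (K * I) ^ (1 / q) := by
    have h1 : (∫ x, (starRingEnd ℂ) (g x) * F x ∂μ) =
        ∫ x, (starRingEnd ℂ) (S (hg2.toLp g) x) * f x ∂μ := by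
      rw [← inner_toLp_left hg2, hF, hTS, L2.inner_def]
      refine integral_congr_ae ?_
      filter_upwards [hf.coeFn_toLp] with x hx
      rw [hx, RCLike.inner_apply, mul_comm]
    have h2 : I = ‖∫ x, (starRingEnd ℂ) (g x) * F x ∂μ‖ₑ := by
      simp only [hgF]
      rw [hIeq, integral_complex_ofReal, ← ofReal_norm, Complex.norm_real, Real.norm_of_nonneg]
      exact integral_nonneg fun x => Set.indicator_nonneg (fun x _ => by positivity) x
    rw [h1] at h2
    calc I ≤ ∫⁻ x, ‖f x‖ₑ * ‖S (hg2.toLp g) x‖ₑ ∂μ := by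
          rw [h2]
          refine (enorm_integral_le_lintegral_enorm _).trans_eq (lintegral_congr fun x => ?_)
          rw [enorm_mul, RCLike.enorm_conj, mul_comm]
      _ ≤ J ^ (1 / p) * (∫⁻ x, ‖S (hg2.toLp g) x‖ₑ ^ q ∂μ) ^ (1 / q) :=
          ENNReal.lintegral_mul_le_Lp_mul_Lq μ hpq hf.1.enorm (Lp.aestronglyMeasurable _).enorm
      _ ≤ _ := by
          have := hS g hgm hg2
          rw [hgq] at this
          gcongr
  rcases eq_or_ne I 0 with h0 | h0
  · rw [h0]
    exact zero_le
  · have h3 : I ^ p ≤ J * (K * I) ^ (p - 1) := by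
      calc I ^ p ≤ (J ^ (1 / p) * (K * I) ^ (1 / q)) ^ p := by gcongr
        _ = J * (K * I) ^ (p - 1) := by
          rw [ENNReal.mul_rpow_of_nonneg _ _ hp0.le, ← ENNReal.rpow_mul, ← ENNReal.rpow_mul,
            one_div_mul_cancel hp0.ne', ENNReal.rpow_one]
          congr 2
          rw [one_div, inv_mul_eq_div]
          exact hpq.div_conj_eq_sub_one
    rw [ENNReal.mul_rpow_of_nonneg _ _ hpq.sub_one_pos.le] at h3
    have h4 : I ^ p = I * I ^ (p - 1) := by
      have := ENNReal.rpow_add 1 (p - 1) h0 hIfin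
      rwa [ENNReal.rpow_one, add_sub_cancel] at this
    rw [h4, ← mul_assoc] at h3
    have h5 : I ^ (p - 1) ≠ 0 := (ENNReal.rpow_pos (pos_iff_ne_zero.2 h0) hIfin).ne'
    have h6 : I ^ (p - 1) ≠ ∞ := ENNReal.rpow_ne_top_of_nonneg hpq.sub_one_pos.le hIfin
    have h7 := (ENNReal.mul_le_mul_iff_left h5 h6).1 h3
    rwa [mul_comm] at h7

theorem lintegral_rpow_le_of_adjoint {p q : ℝ} (hpq : p.HolderConjugate q) (hp2 : 2 < p)
    (hTS : ∀ g f, inner ℂ g (T f) = inner ℂ (S g) f) {K : ℝ≥0∞}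
    (hS : ∀ (g : X → ℂ) (_ : StronglyMeasurable g) (hg : MemLp g 2 μ),
      ∫⁻ x, ‖S (hg.toLp g) x‖ₑ ^ q ∂μ ≤ K * ∫⁻ x, ‖g x‖ₑ ^ q ∂μ)
    {f : X → ℂ} (hf : MemLp f 2 μ) :
    ∫⁻ x, ‖T (hf.toLp f) x‖ₑ ^ p ∂μ ≤ K ^ (p - 1) * ∫⁻ x, ‖f x‖ₑ ^ p ∂μ := by
  have hU : (⋃ N : ℕ, {x | ‖T (hf.toLp f) x‖ ≤ N}) = Set.univ :=
    Set.eq_univ_of_forall fun x => Set.mem_iUnion.2 (by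
      obtain ⟨N, hN⟩ := exists_nat_ge ‖T (hf.toLp f) x‖
      exact ⟨N, hN⟩)
  have hmono : Monotone fun N : ℕ => {x | ‖T (hf.toLp f) x‖ ≤ N} := fun m n hmn x hx =>
    le_trans (show ‖T (hf.toLp f) x‖ ≤ m from hx) (by exact_mod_cast hmn)
  rw [← setLIntegral_univ, ← hU, setLIntegral_iUnion_of_directed _ hmono.directed_le]
  exact iSup_le fun N => setLIntegral_rpow_le_of_adjoint hpq hp2 hTS hS hf N

theorem interpConst_ne_top (C : ℝ≥0) (p : ℝ) : interpConst C p ≠ ∞ := by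
  rw [interpConst]
  finiteness

theorem WeakTypeOne.exists_strong_type [SFinite μ] {C C' : ℝ≥0} (hT : ∀ f, ‖T f‖ ≤ ‖f‖)
    (hS : ∀ f, ‖S f‖ ≤ ‖f‖) (hTS : ∀ g f, inner ℂ g (T f) = inner ℂ (S g) f)
    (hwT : WeakTypeOne T C) (hwS : WeakTypeOne S C') {p : ℝ} (hp : 1 < p) :
    ∃ K : ℝ≥0∞, K ≠ ∞ ∧ ∀ (f : X → ℂ) (_ : StronglyMeasurable f) (hf : MemLp f 2 μ),
      ∫⁻ x, ‖T (hf.toLp f) x‖ₑ ^ p ∂μ ≤ K * ∫⁻ x, ‖f x‖ₑ ^ p ∂μ := by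
  rcases lt_trichotomy p 2 with h | rfl | h
  · exact ⟨_, interpConst_ne_top C p, fun f hf hf2 => hwT.lintegral_rpow_le hT hp h hf hf2⟩
  · refine ⟨1, ENNReal.one_ne_top, fun f hf hf2 => ?_⟩
    rw [one_mul]
    simpa using lintegral_sq_map_le hT hf2
  · have hpq := Real.HolderConjugate.conjExponent hp
    have hq : p.conjExponent < 2 := by
      rw [Real.conjExponent, div_lt_iff₀ (by linarith)]
      linarith
    exact ⟨_, ENNReal.rpow_ne_top_of_nonneg hpq.sub_one_pos.le
      (interpConst_ne_top C' p.conjExponent), fun f _ hf2 =>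
      lintegral_rpow_le_of_adjoint hpq h hTS
        (fun g hg hg2 => hwS.lintegral_rpow_le hS hpq.symm.lt hq hg hg2) hf2⟩

/-! ### The extension to `L^p` -/

theorem exists_memLp_one_two_approx {f : X → ℂ} {p : ℝ≥0∞} (hp0 : p ≠ 0) (hp : p ≠ ∞)
    (hf : MemLp f p μ) {ε : ℝ≥0∞} (hε : ε ≠ 0) :
    ∃ g : X → ℂ, MemLp g p μ ∧ MemLp g 2 μ ∧ eLpNorm (f - g) p μ < ε := by
  obtain ⟨g, hg, hgp⟩ := hf.exists_simpleFunc_eLpNorm_sub_lt hp hε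
  refine ⟨g, hgp, ?_, hg⟩
  rw [SimpleFunc.memLp_iff_finMeasSupp two_ne_zero ENNReal.ofNat_ne_top]
  exact (SimpleFunc.memLp_iff_finMeasSupp hp0 hp).1 hgp

theorem eLpNorm_le_of_lintegral_rpow_le {p : ℝ≥0∞} (hp0 : p ≠ 0) (hp : p ≠ ∞) {K : ℝ≥0∞}
    {f g : X → ℂ} (h : ∫⁻ x, ‖f x‖ₑ ^ p.toReal ∂μ ≤ K * ∫⁻ x, ‖g x‖ₑ ^ p.toReal ∂μ) :
    eLpNorm f p μ ≤ K ^ (1 / p.toReal) * eLpNorm g p μ := by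
  rw [eLpNorm_eq_lintegral_rpow_enorm_toReal hp0 hp, eLpNorm_eq_lintegral_rpow_enorm_toReal hp0 hp,
    ← ENNReal.mul_rpow_of_nonneg _ _ (by positivity)]
  gcongr

/-- Classes of `L^p` that also lie in `L²` form a subspace, dense because simple functions of finite
measure support belong to it. The operator extends from it by continuity, and only in one way. -/
theorem exists_unique_extension {p : ℝ≥0∞} [Fact (1 ≤ p)] (hp : p ≠ ∞) {K : ℝ≥0}
    (hK : ∀ (f : X → ℂ) (hf2 : MemLp f 2 μ), MemLp f p μ →
      eLpNorm (T (hf2.toLp f)) p μ ≤ K * eLpNorm f p μ) :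
    ∃! T' : Lp ℂ p μ →L[ℂ] Lp ℂ p μ, ∀ (f : X → ℂ) (hf2 : MemLp f 2 μ) (hfp : MemLp f p μ),
      T' (hfp.toLp f) =ᵐ[μ] T (hf2.toLp f) := by
  have hp0 : p ≠ 0 := (zero_lt_one.trans_le (Fact.out : 1 ≤ p)).ne'
  let V : Submodule ℂ (Lp ℂ p μ) :=
    { carrier := {f | MemLp f 2 μ}
      add_mem' := fun {f g} hf hg => (memLp_congr_ae (Lp.coeFn_add f g)).2 (hf.add hg)
      zero_mem' := (memLp_congr_ae (Lp.coeFn_zero ℂ p μ)).2 MemLp.zero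
      smul_mem' := fun c f hf => (memLp_congr_ae (Lp.coeFn_smul c f)).2 (hf.const_smul c) }
  have hV : ∀ f : V, MemLp f.1 2 μ := fun f => f.2
  have hbound : ∀ f : V, eLpNorm (T ((hV f).toLp _)) p μ ≤ K * eLpNorm f.1 p μ := fun f =>
    hK _ (hV f) (Lp.memLp f.1)
  have hmem : ∀ f : V, MemLp (T ((hV f).toLp _)) p μ := fun f =>
    ⟨Lp.aestronglyMeasurable _, (hbound f).trans_lt (by
      have := (Lp.memLp f.1).2
      finiteness)⟩
  have hadd : ∀ f g : V, (hV (f + g)).toLp _ = (hV f).toLp _ + (hV g).toLp _ := fun f g => by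
    rw [← MemLp.toLp_add]
    exact MemLp.toLp_congr _ _ (Lp.coeFn_add f.1 g.1)
  have hsmul : ∀ (c : ℂ) (f : V), (hV (c • f)).toLp _ = c • (hV f).toLp _ := fun c f => by
    rw [← MemLp.toLp_const_smul]
    exact MemLp.toLp_congr _ _ (Lp.coeFn_smul c f.1)
  let L : V →ₗ[ℂ] Lp ℂ p μ :=
    { toFun := fun f => (hmem f).toLp _
      map_add' := fun f g => by
        rw [← MemLp.toLp_add]
        refine MemLp.toLp_congr _ _ ?_
        rw [hadd, map_add]
        exact Lp.coeFn_add _ _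
      map_smul' := fun c f => by
        rw [RingHom.id_apply, ← MemLp.toLp_const_smul]
        refine MemLp.toLp_congr _ _ ?_
        rw [hsmul, map_smul]
        exact Lp.coeFn_smul _ _ }
  have hL : ∀ f : V, ‖L f‖ ≤ K * ‖V.subtype f‖ := fun f => by
    have h1 : ‖L f‖ = (eLpNorm (T ((hV f).toLp _)) p μ).toReal := Lp.norm_toLp _ (hmem f)
    rw [h1, Submodule.subtype_apply, Lp.norm_def, ← ENNReal.coe_toReal K, ← ENNReal.toReal_mul]
    exact ENNReal.toReal_mono (ENNReal.mul_ne_top ENNReal.coe_ne_top (Lp.memLp f.1).2.ne) (hbound f)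
  have hdense : DenseRange V.subtype := by
    intro f
    rw [Metric.mem_closure_iff]
    intro ε hε
    obtain ⟨g, hgp, hg2, hfg⟩ := exists_memLp_one_two_approx hp0 hp (Lp.memLp f)
      (ENNReal.ofReal_pos.2 hε).ne'
    have hgV : hgp.toLp g ∈ V := (memLp_congr_ae hgp.coeFn_toLp).2 hg2
    refine ⟨hgp.toLp g, ⟨⟨_, hgV⟩, rfl⟩, ?_⟩
    rw [dist_eq_norm, Lp.norm_def, ← ENNReal.toReal_ofReal hε.le]
    refine (ENNReal.toReal_lt_toReal (Lp.memLp _).2.ne ENNReal.ofReal_ne_top).2 ?_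
    refine lt_of_eq_of_lt (eLpNorm_congr_ae ?_) hfg
    filter_upwards [Lp.coeFn_sub f (hgp.toLp g), hgp.coeFn_toLp] with x h1 h2
    rw [h1, Pi.sub_apply, Pi.sub_apply, h2]
  refine ⟨L.extendOfNorm V.subtype, fun f hf2 hfp => ?_, fun T' hT' => ?_⟩
  · have hfV : hfp.toLp f ∈ V := (memLp_congr_ae hfp.coeFn_toLp).2 hf2
    have h1 : L.extendOfNorm V.subtype (hfp.toLp f) = L ⟨_, hfV⟩ :=
      LinearMap.extendOfNorm_eq hdense ⟨K, hL⟩ ⟨_, hfV⟩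
    rw [h1]
    have h2 : (hV ⟨_, hfV⟩).toLp _ = hf2.toLp f := MemLp.toLp_congr _ _ hfp.coeFn_toLp
    exact (hmem ⟨_, hfV⟩).coeFn_toLp.trans (h2 ▸ Filter.EventuallyEq.rfl)
  · refine (LinearMap.extendOfNorm_unique hdense K hL T' (LinearMap.ext fun f => ?_)).symm
    refine Lp.ext ?_
    have h1 := hT' f.1 (hV f) (Lp.memLp f.1)
    rw [Lp.toLp_coeFn] at h1
    exact h1.trans (hmem f).coeFn_toLp.symm

end

end

section
/-! ### The extension from `L¹` to weak `L¹` -/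

section

variable {X : Type*} [MeasurableSpace X] {μ : Measure X} {T : Lp ℂ 2 μ →L[ℂ] Lp ℂ 2 μ} {C : ℝ≥0}

/-- `F` is a limit in measure of `T g` as `g ∈ L¹ ∩ L²` tends to `f` in `L¹`. -/
def IsMeasureLimit (T : Lp ℂ 2 μ →L[ℂ] Lp ℂ 2 μ) (f F : X → ℂ) : Prop :=
  ∀ ε : ℝ≥0, 0 < ε → ∀ l : ℝ≥0, 0 < l → ∃ (g : X → ℂ) (_ : MemLp g 1 μ) (hg : MemLp g 2 μ),
    eLpNorm (f - g) 1 μ ≤ ε ∧ μ {x | l < ‖F x - T (hg.toLp g) x‖₊} ≤ ε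

theorem WeakTypeOne.meas_le (hw : WeakTypeOne T C) {g : X → ℂ} (hg1 : MemLp g 1 μ)
    (hg2 : MemLp g 2 μ) (l : ℝ≥0) :
    l * μ {x | l < ‖T (hg2.toLp g) x‖₊} ≤ C * eLpNorm g 1 μ := by
  rw [eLpNorm_one_eq_lintegral_enorm]
  exact hw g hg1 hg2 l

theorem isMeasureLimit_self {f : X → ℂ} (hf1 : MemLp f 1 μ) (hf2 : MemLp f 2 μ) {F : X → ℂ}
    (hF : F =ᵐ[μ] T (hf2.toLp f)) : IsMeasureLimit T f F := by
  refine fun ε _ l _ => ⟨f, hf1, hf2, by simp, ?_⟩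
  have h : μ {x | l < ‖F x - T (hf2.toLp f) x‖₊} = 0 := by
    refine measure_mono_null (t := {x | ¬ F x = T (hf2.toLp f) x}) (fun x hx h0 => ?_)
      (ae_iff.1 hF)
    have hx : l < ‖F x - T (hf2.toLp f) x‖₊ := hx
    rw [h0, sub_self, nnnorm_zero] at hx
    exact absurd hx (not_lt.2 zero_le)
  rw [h]
  exact zero_le

theorem meas_nnnorm_add_le (F G : X → ℂ) (l m : ℝ≥0) :
    μ {x | l + m < ‖F x + G x‖₊} ≤ μ {x | l < ‖F x‖₊} + μ {x | m < ‖G x‖₊} := by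
  refine (measure_mono fun x hx => ?_).trans (measure_union_le _ _)
  have hx : l + m < ‖F x + G x‖₊ := hx
  by_contra hc
  have h1 : ‖F x‖₊ ≤ l := not_lt.1 fun h => hc (Or.inl h)
  have h2 : ‖G x‖₊ ≤ m := not_lt.1 fun h => hc (Or.inr h)
  exact absurd (hx.trans_le (nnnorm_add_le _ _)) (not_lt.2 (add_le_add h1 h2))

theorem meas_congr_lt {F G : X → ℂ} (h : F =ᵐ[μ] G) (l : ℝ≥0) :
    μ {x | l < ‖F x‖₊} = μ {x | l < ‖G x‖₊} := by
  refine measure_congr ?_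
  filter_upwards [h] with x hx
  refine propext ?_
  change l < ‖F x‖₊ ↔ l < ‖G x‖₊
  rw [hx]

theorem IsMeasureLimit.congr {f f' F F' : X → ℂ} (h : IsMeasureLimit T f F) (hf : f =ᵐ[μ] f')
    (hF : F =ᵐ[μ] F') : IsMeasureLimit T f' F' := by
  intro ε hε l hl
  obtain ⟨g, hg1, hg2, h1, h2⟩ := h ε hε l hl
  refine ⟨g, hg1, hg2, ?_, ?_⟩
  · rwa [← eLpNorm_congr_ae (hf.sub Filter.EventuallyEq.rfl)]
  · refine (meas_congr_lt (G := fun x => F x - T (hg2.toLp g) x) ?_ l).trans_le h2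
    filter_upwards [hF] with x hx
    rw [hx]

theorem IsMeasureLimit.add {f f' F F' : X → ℂ} (hf : AEStronglyMeasurable f μ)
    (hf' : AEStronglyMeasurable f' μ) (h : IsMeasureLimit T f F) (h' : IsMeasureLimit T f' F') :
    IsMeasureLimit T (f + f') (F + F') := by
  intro ε hε l hl
  obtain ⟨g, hg1, hg2, h1, h2⟩ := h (ε / 2) (half_pos hε) (l / 2) (half_pos hl)
  obtain ⟨g', hg1', hg2', h1', h2'⟩ := h' (ε / 2) (half_pos hε) (l / 2) (half_pos hl)
  have hε2 : ((ε / 2 : ℝ≥0) : ℝ≥0∞) + (ε / 2 : ℝ≥0) = ε := by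
    rw [← ENNReal.coe_add, add_halves]
  refine ⟨g + g', hg1.add hg1', hg2.add hg2', ?_, ?_⟩
  · rw [add_sub_add_comm, ← hε2]
    exact (eLpNorm_add_le (hf.sub hg1.1) (hf'.sub hg1'.1) le_rfl).trans (add_le_add h1 h1')
  · have e : (fun x => (F + F') x - T ((hg2.add hg2').toLp (g + g')) x) =ᵐ[μ]
        fun x => (F x - T (hg2.toLp g) x) + (F' x - T (hg2'.toLp g') x) := by
      have h3 := Lp.coeFn_add (T (hg2.toLp g)) (T (hg2'.toLp g'))
      rw [← map_add, ← MemLp.toLp_add] at h3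
      filter_upwards [h3] with x hx
      rw [hx, Pi.add_apply, Pi.add_apply]
      ring
    rw [meas_congr_lt e, ← hε2]
    conv_lhs => rw [← add_halves l]
    exact (meas_nnnorm_add_le _ _ _ _).trans (add_le_add h2 h2')

theorem IsMeasureLimit.const_smul {f F : X → ℂ} (h : IsMeasureLimit T f F) (c : ℂ) :
    IsMeasureLimit T (c • f) (c • F) := by
  intro ε hε l hl
  set k : ℝ≥0 := ‖c‖₊ + 1 with hk
  have hk1 : 1 ≤ k := le_add_self
  have hk0 : 0 < k := zero_lt_one.trans_le hk1
  obtain ⟨g, hg1, hg2, h1, h2⟩ := h (ε / k) (div_pos hε hk0) (l / k) (div_pos hl hk0)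
  have hck : ‖c‖₊ ≤ k := le_self_add
  refine ⟨c • g, hg1.const_smul c, hg2.const_smul c, ?_, ?_⟩
  · rw [← smul_sub, eLpNorm_const_smul]
    calc ‖c‖ₑ * eLpNorm (f - g) 1 μ ≤ k * ((ε / k : ℝ≥0) : ℝ≥0∞) := by
          gcongr
          rw [enorm_eq_nnnorm]
          exact_mod_cast hck
      _ = ε := by rw [← ENNReal.coe_mul, mul_div_cancel₀ _ hk0.ne']
  · have e : (fun x => (c • F) x - T ((hg2.const_smul c).toLp (c • g)) x) =ᵐ[μ]
        fun x => c * (F x - T (hg2.toLp g) x) := by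
      have h3 := Lp.coeFn_smul c (T (hg2.toLp g))
      rw [← map_smul, ← MemLp.toLp_const_smul] at h3
      filter_upwards [h3] with x hx
      rw [hx, Pi.smul_apply, Pi.smul_apply, smul_eq_mul, smul_eq_mul]
      ring
    rw [meas_congr_lt e]
    refine (measure_mono fun x hx => ?_).trans (h2.trans ?_)
    · have hx : l < ‖c * (F x - T (hg2.toLp g) x)‖₊ := hx
      rw [nnnorm_mul] at hx
      change l / k < _
      rw [div_lt_iff₀ hk0, mul_comm]
      exact hx.trans_le (by gcongr)
    · exact_mod_cast div_le_self zero_le hk1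

/-- The weak bound passes to limits in measure at the price of a factor `2`, half of the level being
spent on the approximation error. -/
theorem WeakTypeOne.meas_le_of_isMeasureLimit (hw : WeakTypeOne T C) {f F : X → ℂ}
    (hf : AEStronglyMeasurable f μ) (h : IsMeasureLimit T f F) (l : ℝ≥0) :
    l * μ {x | l < ‖F x‖₊} ≤ (2 * C : ℝ≥0) * eLpNorm f 1 μ := by
  rcases eq_zero_or_pos l with rfl | hl
  · simp
  refine ENNReal.le_of_forall_pos_le_add fun ε hε _ => ?_
  -- The approximation errors add up to `k` times the tolerance, which is therefore taken to be `ε /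
  -- k`.
  set k : ℝ≥0 := l + 2 * C with hk
  have hk0 : 0 < k := hl.trans_le le_self_add
  obtain ⟨g, hg1, hg2, h1, h2⟩ := h (ε / k) (div_pos hε hk0) (l / 2) (half_pos hl)
  have h3 := hw.meas_le hg1 hg2 (l / 2)
  have h5 := meas_nnnorm_add_le (μ := μ) (fun x => F x - T (hg2.toLp g) x)
    (T (hg2.toLp g)) (l / 2) (l / 2)
  simp only [sub_add_cancel, add_halves] at h5
  have h6 : eLpNorm g 1 μ ≤ eLpNorm f 1 μ + (ε / k : ℝ≥0) := by
    have e : g = f - (f - g) := by abel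
    calc eLpNorm g 1 μ = eLpNorm (f - (f - g)) 1 μ := by rw [← e]
      _ ≤ eLpNorm f 1 μ + eLpNorm (f - g) 1 μ := eLpNorm_sub_le hf (hf.sub hg1.1) le_rfl
      _ ≤ _ := by gcongr
  have hl2 : (l : ℝ≥0∞) = 2 * ((l / 2 : ℝ≥0) : ℝ≥0∞) := by
    rw [← ENNReal.coe_ofNat, ← ENNReal.coe_mul, mul_div_cancel₀ _ two_ne_zero]
  calc l * μ {x | l < ‖F x‖₊}
      ≤ l * (((ε / k : ℝ≥0) : ℝ≥0∞) + μ {x | l / 2 < ‖T (hg2.toLp g) x‖₊}) := by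
        gcongr
        exact h5.trans (add_le_add h2 le_rfl)
    _ = l * ((ε / k : ℝ≥0) : ℝ≥0∞) +
        2 * (((l / 2 : ℝ≥0) : ℝ≥0∞) * μ {x | l / 2 < ‖T (hg2.toLp g) x‖₊}) := by
        rw [mul_add, ← mul_assoc 2, ← hl2]
    _ ≤ l * ((ε / k : ℝ≥0) : ℝ≥0∞) + 2 * (C * (eLpNorm f 1 μ + (ε / k : ℝ≥0))) := by
        exact add_le_add le_rfl (mul_le_mul_right (h3.trans (mul_le_mul_right h6 _)) _)
    _ = (2 * C : ℝ≥0) * eLpNorm f 1 μ + k * ((ε / k : ℝ≥0) : ℝ≥0∞) := by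
        rw [hk]
        push_cast
        ring
    _ = _ := by rw [← ENNReal.coe_mul, mul_div_cancel₀ _ hk0.ne']

/-- By linearity the difference of two limits is a limit for the zero function, where the weak bound
annihilates every level set. -/
theorem WeakTypeOne.isMeasureLimit_unique (hw : WeakTypeOne T C) {f F F' : X → ℂ}
    (hf : AEStronglyMeasurable f μ) (h : IsMeasureLimit T f F) (h' : IsMeasureLimit T f F') :
    F =ᵐ[μ] F' := by
  have h1 : IsMeasureLimit T (f + (-1 : ℂ) • f) (F + (-1 : ℂ) • F') :=
    h.add hf (hf.const_smul _) (h'.const_smul (-1))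
  have h2 : ∀ l : ℝ≥0, 0 < l → μ {x | l < ‖(F + (-1 : ℂ) • F') x‖₊} = 0 := by
    intro l hl
    have h3 := hw.meas_le_of_isMeasureLimit (hf.add (hf.const_smul _)) h1 l
    have e : f + (-1 : ℂ) • f = 0 := by simp
    rw [e, eLpNorm_zero, mul_zero, nonpos_iff_eq_zero, mul_eq_zero] at h3
    exact h3.resolve_left (by exact_mod_cast hl.ne')
  have h3 : ∀ᵐ x ∂μ, ∀ n : ℕ, ¬ (1 / ((n : ℝ≥0) + 1) < ‖(F + (-1 : ℂ) • F') x‖₊) := by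
    rw [ae_all_iff]
    intro n
    rw [ae_iff]
    simp only [not_not]
    exact h2 _ (by positivity)
  filter_upwards [h3] with x hx
  have h4 : ‖(F + (-1 : ℂ) • F') x‖₊ = 0 := by
    by_contra h0
    obtain ⟨n, hn⟩ := exists_nat_one_div_lt (NNReal.coe_pos.2 (pos_iff_ne_zero.2 h0))
    refine hx n ?_
    rw [← NNReal.coe_lt_coe]
    push_cast
    exact hn
  rw [nnnorm_eq_zero, Pi.add_apply, Pi.smul_apply, neg_one_smul, ← sub_eq_add_neg, sub_eq_zero] at h4
  exact h4

-- The approximants are within `h n ^ 2` of `f` in `L¹`, with `h n = 2^(-n)`. The weak bound at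
-- level `h n` costs one factor `h n`, so consecutive images differ by more than `h n` only on a set
-- of measure `2 C h n`. By Borel–Cantelli the images converge almost everywhere, and the tails
-- control the distance to the limit in measure.
open Filter Topology in
theorem WeakTypeOne.exists_isMeasureLimit (hw : WeakTypeOne T C) {f : X → ℂ} (hf : MemLp f 1 μ) :
    ∃ F : X → ℂ, AEStronglyMeasurable F μ ∧ IsMeasureLimit T f F := by
  let h : ℕ → ℝ≥0 := fun n => (1 / 2) ^ n
  have hpos : ∀ n, 0 < h n := fun n => by positivity
  have hle1 : ∀ n, h n ≤ 1 := fun n => pow_le_one₀ zero_le (by norm_num)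
  have happ : ∀ n, ∃ g : X → ℂ, MemLp g 1 μ ∧ MemLp g 2 μ ∧
      eLpNorm (f - g) 1 μ < ((h n ^ 2 : ℝ≥0) : ℝ≥0∞) := fun n =>
    exists_memLp_one_two_approx one_ne_zero ENNReal.one_ne_top hf (by
      exact_mod_cast (pow_pos (hpos n) 2).ne')
  choose g hg1 hg2 hfg using happ
  let a : ℕ → X → ℂ := fun n => T ((hg2 n).toLp (g n))
  let S : ℕ → Set X := fun n => {x | h n < ‖a (n + 1) x - a n x‖₊}
  have hS : ∀ n, μ (S n) ≤ (2 * C * h n : ℝ≥0) := by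
    intro n
    have e : (fun x => a (n + 1) x - a n x) =ᵐ[μ]
        T (((hg2 (n + 1)).sub (hg2 n)).toLp (g (n + 1) - g n)) := by
      have h3 := Lp.coeFn_sub (T ((hg2 (n + 1)).toLp _)) (T ((hg2 n).toLp _))
      rw [← map_sub, ← MemLp.toLp_sub] at h3
      exact h3.symm
    have h1 := hw.meas_le ((hg1 (n + 1)).sub (hg1 n)) ((hg2 (n + 1)).sub (hg2 n)) (h n)
    rw [← meas_congr_lt e] at h1
    have h2 : eLpNorm (g (n + 1) - g n) 1 μ ≤ ((2 * h n ^ 2 : ℝ≥0) : ℝ≥0∞) := by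
      have e2 : g (n + 1) - g n = (f - g n) - (f - g (n + 1)) := by abel
      have hmono : h (n + 1) ≤ h n := pow_le_pow_of_le_one zero_le (by norm_num) (Nat.le_succ n)
      rw [e2]
      calc _ ≤ eLpNorm (f - g n) 1 μ + eLpNorm (f - g (n + 1)) 1 μ :=
            eLpNorm_sub_le (hf.1.sub (hg1 n).1) (hf.1.sub (hg1 (n + 1)).1) le_rfl
        _ ≤ ((h n ^ 2 : ℝ≥0) : ℝ≥0∞) + ((h n ^ 2 : ℝ≥0) : ℝ≥0∞) := by
            refine add_le_add (hfg n).le ((hfg (n + 1)).le.trans ?_)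
            exact_mod_cast pow_le_pow_left₀ zero_le hmono 2
        _ = _ := by rw [← ENNReal.coe_add, two_mul]
    have h3 : (h n : ℝ≥0∞) * μ (S n) ≤ h n * ((2 * C * h n : ℝ≥0) : ℝ≥0∞) :=
      (h1.trans (mul_le_mul_right h2 _)).trans_eq (by push_cast; ring)
    exact (ENNReal.mul_le_mul_iff_right (by exact_mod_cast (hpos n).ne') ENNReal.coe_ne_top).1 h3
  have htail : ∀ N, ∑' m, μ (S (N + m)) ≤ (4 * C * h N : ℝ≥0) := by
    intro N
    calc ∑' m, μ (S (N + m)) ≤ ∑' m : ℕ, (2 * C * h N : ℝ≥0) * (2 : ℝ≥0∞)⁻¹ ^ m := by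
          refine ENNReal.tsum_le_tsum fun m => (hS _).trans_eq ?_
          simp only [h, pow_add]
          push_cast
          rw [one_div]
          ring
      _ = _ := by
          rw [ENNReal.tsum_mul_left, ENNReal.tsum_geometric_two]
          push_cast
          ring
  have hdist : ∀ (n : ℕ) (x : X), x ∉ S n → dist (a n x) (a (n + 1) x) ≤ h n := by
    intro n x hx
    rw [dist_comm, dist_eq_norm, ← coe_nnnorm, NNReal.coe_le_coe]
    exact not_lt.1 hx
  have hsum : Summable fun n => (h n : ℝ) := by
    have : ∀ n, (h n : ℝ) = (1 / 2) ^ n := fun n => by simp [h]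
    simp only [this]
    exact summable_geometric_two
  have hconv : ∀ᵐ x ∂μ, ∃ y, Tendsto (fun n => a n x) atTop (𝓝 y) := by
    have h0 : ∑' m, μ (S m) ≠ ∞ := by
      have := htail 0
      simp only [zero_add] at this
      exact ne_top_of_le_ne_top ENNReal.coe_ne_top this
    filter_upwards [ae_eventually_notMem h0] with x hx
    refine cauchySeq_tendsto_of_complete (cauchySeq_of_summable_dist ?_)
    refine hsum.of_norm_bounded_eventually_nat ?_
    filter_upwards [hx] with n hn
    rw [Real.norm_of_nonneg dist_nonneg]
    exact hdist n x hn
  obtain ⟨F, hF, hlim⟩ := exists_stronglyMeasurable_limit_of_tendsto_ae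
    (fun n => Lp.aestronglyMeasurable (T ((hg2 n).toLp (g n)))) hconv
  refine ⟨F, hF.aestronglyMeasurable, fun ε hε l hl => ?_⟩
  have hC : (0 : ℝ≥0) < 4 * C + 1 := by positivity
  obtain ⟨N, hN⟩ := exists_pow_lt_of_lt_one (lt_min (half_pos hl) (div_pos hε hC))
    (show (1 / 2 : ℝ≥0) < 1 by norm_num)
  have hN1 : 2 * h N ≤ l := by
    have : h N ≤ l / 2 := (hN.trans_le (min_le_left _ _)).le
    rwa [le_div_iff₀ two_pos, mul_comm] at this
  have hN2 : (4 * C + 1) * h N ≤ ε := by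
    have : h N ≤ ε / (4 * C + 1) := (hN.trans_le (min_le_right _ _)).le
    rwa [le_div_iff₀ hC, mul_comm] at this
  have hN3 : h N ^ 2 ≤ ε := by
    refine le_trans ?_ hN2
    calc h N ^ 2 = h N * h N := sq _
      _ ≤ 1 * h N := by gcongr; exact hle1 N
      _ ≤ (4 * C + 1) * h N := by gcongr; exact le_add_self
  have hN4 : 4 * C * h N ≤ ε := le_trans (by gcongr; exact le_self_add) hN2
  refine ⟨g N, hg1 N, hg2 N, (hfg N).le.trans (by exact_mod_cast hN3), ?_⟩
  have hsub : {x | l < ‖F x - a N x‖₊} ≤ᵐ[μ] (⋃ m, S (N + m) : Set X) := by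
    filter_upwards [hlim] with x hx hlt
    by_contra hc
    have hc' : ∀ m, x ∉ S (N + m) := fun m hm => hc (Set.mem_iUnion.2 ⟨m, hm⟩)
    have hlt : l < ‖F x - a N x‖₊ := hlt
    have h1 := dist_le_of_le_geometric_of_tendsto₀ (f := fun m => a (N + m) x) (a := F x)
      (1 / 2) (h N : ℝ) (by norm_num) (fun m => by
        refine (hdist (N + m) x (hc' m)).trans_eq ?_
        simp only [h, pow_add]
        push_cast
        ring) (hx.comp (tendsto_add_atTop_nat N |>.congr fun m => add_comm m N))
    rw [dist_comm, dist_eq_norm, ← coe_nnnorm] at h1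
    have h2 : (l : ℝ) < ‖F x - a N x‖₊ := by exact_mod_cast hlt
    have h3 : (2 : ℝ) * h N ≤ l := by exact_mod_cast hN1
    have h4 : (h N : ℝ) / (1 - 1 / 2) = 2 * h N := by ring
    simp only [add_zero] at h1
    linarith
  calc μ {x | l < ‖F x - a N x‖₊} ≤ μ (⋃ m, S (N + m)) := measure_mono_ae hsub
    _ ≤ ∑' m, μ (S (N + m)) := measure_iUnion_le _
    _ ≤ (4 * C * h N : ℝ≥0) := htail N
    _ ≤ ε := by exact_mod_cast hN4

/-- Uniqueness of limits in measure makes their choice linear. It also yields uniqueness of the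
extension: for any competitor its own weak bound shows that its values are such limits. -/
theorem WeakTypeOne.exists_unique_extension (hw : WeakTypeOne T C) :
    ∃! T' : Lp ℂ 1 μ →ₗ[ℂ] (X →ₘ[μ] ℂ),
      (∃ C : ℝ≥0, ∀ f : Lp ℂ 1 μ, weakL1Norm μ (T' f) ≤ C * ‖f‖ₑ) ∧
      ∀ (f : X → ℂ) (hf2 : MemLp f 2 μ) (hf1 : MemLp f 1 μ),
        T' (hf1.toLp f) =ᵐ[μ] T (hf2.toLp f) := by
  have hex : ∀ f : Lp ℂ 1 μ, ∃ F : X →ₘ[μ] ℂ, IsMeasureLimit T f F := fun f => by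
    obtain ⟨F, hF, hlim⟩ := hw.exists_isMeasureLimit (Lp.memLp f)
    exact ⟨AEEqFun.mk F hF, hlim.congr Filter.EventuallyEq.rfl (AEEqFun.coeFn_mk F hF).symm⟩
  choose F hF using hex
  have huniq : ∀ (f : Lp ℂ 1 μ) (G : X →ₘ[μ] ℂ), IsMeasureLimit T f G → G = F f := fun f G hG =>
    AEEqFun.ext (hw.isMeasureLimit_unique (Lp.aestronglyMeasurable f) hG (hF f))
  let L : Lp ℂ 1 μ →ₗ[ℂ] (X →ₘ[μ] ℂ) :=
    { toFun := F
      map_add' := fun f g => by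
        refine (huniq _ _ ?_).symm
        exact ((hF f).add (Lp.aestronglyMeasurable f) (Lp.aestronglyMeasurable g) (hF g)).congr
          (Lp.coeFn_add f g).symm (AEEqFun.coeFn_add _ _).symm
      map_smul' := fun c f => by
        refine (huniq _ _ ?_).symm
        exact ((hF f).const_smul c).congr (Lp.coeFn_smul c f).symm (AEEqFun.coeFn_smul _ _).symm }
  refine ⟨L, ⟨⟨2 * C, fun f => iSup_le fun l => ?_⟩, fun f hf2 hf1 => ?_⟩, ?_⟩
  · rw [Lp.enorm_def]
    exact hw.meas_le_of_isMeasureLimit (Lp.aestronglyMeasurable f) (hF f) l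
  · refine hw.isMeasureLimit_unique hf1.1 ((hF (hf1.toLp f)).congr hf1.coeFn_toLp
      Filter.EventuallyEq.rfl) (isMeasureLimit_self hf1 hf2 Filter.EventuallyEq.rfl)
  · rintro T' ⟨⟨C', hC'⟩, hT'⟩
    refine LinearMap.ext fun f => huniq f _ fun ε hε l hl => ?_
    -- The tolerance `ε / (1 + C' / l)` is at most `ε`, and `C'` times it is at most `l * ε`, as the
    -- weak bound at level `l` requires.
    have hk : (0 : ℝ≥0) < 1 + C' / l := by positivity
    obtain ⟨g, hg1, hg2, hfg⟩ := exists_memLp_one_two_approx one_ne_zero ENNReal.one_ne_top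
      (Lp.memLp f) (ε := ((ε / (1 + C' / l) : ℝ≥0) : ℝ≥0∞))
      (by exact_mod_cast (div_pos hε hk).ne')
    refine ⟨g, hg1, hg2, hfg.le.trans ?_, ?_⟩
    · exact_mod_cast div_le_self zero_le le_self_add
    · have h1 : ‖f - hg1.toLp g‖ₑ ≤ ((ε / (1 + C' / l) : ℝ≥0) : ℝ≥0∞) := by
        rw [Lp.enorm_def]
        refine le_of_eq_of_le (eLpNorm_congr_ae ?_) hfg.le
        filter_upwards [Lp.coeFn_sub f (hg1.toLp g), hg1.coeFn_toLp] with x h1 h2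
        rw [h1, Pi.sub_apply, Pi.sub_apply, h2]
      have h2 : (l : ℝ≥0∞) * μ {x | l < ‖T' (f - hg1.toLp g) x‖₊} ≤
          C' * ((ε / (1 + C' / l) : ℝ≥0) : ℝ≥0∞) :=
        (le_iSup (fun t : ℝ≥0 => (t : ℝ≥0∞) * μ {x | t < ‖T' (f - hg1.toLp g) x‖₊}) l).trans
          ((hC' _).trans (mul_le_mul_right h1 _))
      have e : (fun x => T' f x - T (hg2.toLp g) x) =ᵐ[μ] T' (f - hg1.toLp g) := by
        rw [map_sub]
        filter_upwards [AEEqFun.coeFn_sub (T' f) (T' (hg1.toLp g)), hT' g hg2 hg1] with x h3 h4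
        rw [h3, Pi.sub_apply, h4]
      rw [meas_congr_lt e]
      have h3 : (C' * (ε / (1 + C' / l)) : ℝ≥0) ≤ l * ε := by
        rw [← mul_div_assoc, div_le_iff₀ hk, mul_add, mul_one]
        calc C' * ε = l * ε * (C' / l) := by field_simp
          _ ≤ _ := le_add_self
      have h4 : (l : ℝ≥0∞) * μ {x | l < ‖T' (f - hg1.toLp g) x‖₊} ≤ l * ε :=
        h2.trans (by exact_mod_cast h3)
      exact (ENNReal.mul_le_mul_iff_right (by exact_mod_cast hl.ne') ENNReal.coe_ne_top).1 h4

end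

end

section
/-! ### The imaginary powers on `L^p` -/

theorem WeakTypeOne.exists_eLpNorm_le {X : Type*} [MeasurableSpace X] {μ : Measure X} [SFinite μ]
    {T S : Lp ℂ 2 μ →L[ℂ] Lp ℂ 2 μ} {C C' : ℝ≥0} (hT : ∀ f, ‖T f‖ ≤ ‖f‖)
    (hS : ∀ f, ‖S f‖ ≤ ‖f‖) (hTS : ∀ g f, inner ℂ g (T f) = inner ℂ (S g) f)
    (hwT : WeakTypeOne T C) (hwS : WeakTypeOne S C') {p : ℝ≥0∞} (hp : 1 < p) (hpt : p ≠ ∞) :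
    ∃ K : ℝ≥0, ∀ (f : X → ℂ) (hf2 : MemLp f 2 μ),
      eLpNorm (T (hf2.toLp f)) p μ ≤ K * eLpNorm f p μ := by
  have hp1 : 1 < p.toReal := by
    rw [← ENNReal.toReal_one]
    exact (ENNReal.toReal_lt_toReal ENNReal.one_ne_top hpt).2 hp
  have hp0 : p ≠ 0 := (zero_lt_one.trans hp).ne'
  obtain ⟨K, hK, h⟩ := WeakTypeOne.exists_strong_type hT hS hTS hwT hwS hp1
  have hK' : K ^ (1 / p.toReal) ≠ ∞ := ENNReal.rpow_ne_top_of_nonneg (by positivity) hK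
  refine ⟨(K ^ (1 / p.toReal)).toNNReal, fun f hf2 => ?_⟩
  rw [ENNReal.coe_toNNReal hK', eLpNorm_congr_ae hf2.1.ae_eq_mk]
  have hm : MemLp (hf2.1.mk f) 2 μ := (memLp_congr_ae hf2.1.ae_eq_mk).1 hf2
  have e : hf2.toLp f = hm.toLp _ := MemLp.toLp_congr _ _ hf2.1.ae_eq_mk
  rw [e]
  exact eLpNorm_le_of_lintegral_rpow_le hp0 hpt (h _ hf2.1.stronglyMeasurable_mk hm)

variable {d : ℕ} {α : Fin d → ℝ}

theorem inner_imaginaryPowerL_right (hd : 0 < d) (hα : ∀ j, -1 / 2 ≤ α j) (γ : ℝ)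
    (g f : Lp ℂ 2 (weightMeasure α)) :
    inner ℂ g (imaginaryPowerL hd hα γ f) = inner ℂ (imaginaryPowerL hd hα (-γ) g) f := by
  rw [imaginaryPowerL_apply, imaginaryPowerL_apply]
  exact inner_imaginaryPower_right hd hα γ g f

end

end DunklOsc

end

theorem theorem3p1 (d : ℕ) (hd : 0 < d) (α : Fin d → ℝ) (hα : ∀ j, -1 / 2 ≤ α j)
    (γ : ℝ) (hγ : γ ≠ 0) :
    -- the spectral series converges in L² for every f in L²
    (∀ f : Lp ℂ 2 (DunklOsc.weightMeasure α),
      HasSum (DunklOsc.spectralTerm hα γ f) (DunklOsc.imaginaryPower hα γ f)) ∧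
    -- unique bounded extension to L^p for 1 < p < ∞
    (∀ (p : ℝ≥0∞) [Fact (1 ≤ p)], 1 < p → p ≠ ∞ →
      ∃! T : Lp ℂ p (DunklOsc.weightMeasure α) →L[ℂ] Lp ℂ p (DunklOsc.weightMeasure α),
        ∀ (f : EuclideanSpace ℝ (Fin d) → ℂ) (hf2 : MemLp f 2 (DunklOsc.weightMeasure α))
          (hfp : MemLp f p (DunklOsc.weightMeasure α)),
          T (hfp.toLp f) =ᵐ[DunklOsc.weightMeasure α]
            DunklOsc.imaginaryPower hα γ (hf2.toLp f)) ∧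
    -- unique bounded extension from L¹ to weak L¹
    (∃! T : Lp ℂ 1 (DunklOsc.weightMeasure α) →ₗ[ℂ]
        (EuclideanSpace ℝ (Fin d) →ₘ[DunklOsc.weightMeasure α] ℂ),
        (∃ C : ℝ≥0, ∀ f : Lp ℂ 1 (DunklOsc.weightMeasure α),
          DunklOsc.weakL1Norm (DunklOsc.weightMeasure α) (T f) ≤ C * ‖f‖ₑ) ∧
        ∀ (f : EuclideanSpace ℝ (Fin d) → ℂ) (hf2 : MemLp f 2 (DunklOsc.weightMeasure α))
          (hf1 : MemLp f 1 (DunklOsc.weightMeasure α)),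
          T (hf1.toLp f) =ᵐ[DunklOsc.weightMeasure α]
            DunklOsc.imaginaryPower hα γ (hf2.toLp f)) := by
  refine ⟨DunklOsc.hasSum_spectralTerm hd hα γ, fun p _ hp hpt => ?_, ?_⟩
  · obtain ⟨C, hC⟩ := DunklOsc.exists_weakTypeOne_imaginaryPowerL hd hα hγ
    -- The operator with `-γ` is the adjoint; its weak type bound is needed for `p > 2`.
    obtain ⟨C', hC'⟩ := DunklOsc.exists_weakTypeOne_imaginaryPowerL hd hα (neg_ne_zero.2 hγ)
    obtain ⟨K, hK⟩ := DunklOsc.WeakTypeOne.exists_eLpNorm_le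
      (DunklOsc.norm_imaginaryPowerL_le hd hα γ) (DunklOsc.norm_imaginaryPowerL_le hd hα (-γ))
      (DunklOsc.inner_imaginaryPowerL_right hd hα γ) hC hC' hp hpt
    have h := DunklOsc.exists_unique_extension hpt (fun f hf2 _ => hK f hf2)
    simp only [DunklOsc.imaginaryPowerL_apply] at h
    exact h
  · obtain ⟨C, hC⟩ := DunklOsc.exists_weakTypeOne_imaginaryPowerL hd hα hγ
    have h := hC.exists_unique_extension
    simp only [DunklOsc.imaginaryPowerL_apply] at h
    exact h
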